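/- Let $\Delta_0$ be a finite lattice triangulation in $\mathbb{Z}^2$ all of whose triangles have area $\tfrac12$ (the toric diagram of a smooth toric Calabi--Yau threefold). An edge $ij$ that lies in two triangles $ij\alpha$, $ij\beta$ is a compact toric curve $C_{ij}$; in suitable affine lattice coordinates $i=(0,0)$, $j=(1,0)$, $\alpha=(0,-1)$, $\beta=(1-m,1)$, where the names are chosen so that $m=m_{ij}\ge 0$, and $C_{ij}$ is called a $(-1-m_{ij},-1+m_{ij})$-curve. Write $\operatorname{def}(\Delta)=\sum_{C_{ij}}m_{ij}$ for the geometric count of deformations of the tangent sheaf (up to the constant $3n_{\mathrm{int}}$, where $n_{\mathrm{int}}$ is the number of interior points, which flops do not change). A flop replaces a $(-1,-1)$-curve, i.e. the diagonal of a parallelogram formed by two adjacent triangles, by the other diagonal. Let $R$ be a set of triangles of $\Delta_0$ that belong to one regular triangular tessellation (the triangles $p,p+a,p+b$ and $p+a,p+b,p+a+b$, $p\in\mathbb{Z}^2$, for a lattice basis $a,b$), such that all edges of triangles of $R$, including those on the border of $R$, are $(-1,-1)$-curves of $\Delta_0$. Let $\Delta_n$ arise from $\Delta_0$ by $n$ successive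 flops inside $R$ (the triangles of $\Delta_0$ outside $R$ are never changed; curves created by earlier flops may be flopped). Then $$\operatorname{def}(\Delta_n)-\operatorname{def}(\Delta_0)\le 4n,$$ and, if no flop is the inverse of an earlier one, $$\operatorname{def}(\Delta_n)-\operatorname{def}(\Delta_0)\ge 4\sqrt n .$$ The lower bound is attained when the flops fill a $\sqrt n\times\sqrt n$ quadrilateral: if $n=k^2$ and $R$ contains a $k\times k$ lattice parallelogram whose $k^2$ unit cells are each cut into two triangles of $R$ by parallel diagonals, then there is a sequence of $n$ flops inside $R$, none the inverse of an earlier one, whose flopped curves are exactly these $k^2$ diagonals, and for every such sequence $\operatorname{def}(\Delta_n)-\operatorname{def}(\Delta_0)=4\sqrt n$. -/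

import Mathlib

/-- Points of the lattice plane that contains the point set of a toric Calabi-Yau threefold. -/
abbrev LatticePoint : Type := ℤ × ℤ

/-- The determinant of two lattice vectors. -/
def latticeDet (u v : LatticePoint) : ℤ := u.1 * v.2 - u.2 * v.1

/-- The lattice polytope spanned by a finite set of lattice points, in the real plane. -/
def latticeHull (t : Finset LatticePoint) : Set (ℝ × ℝ) :=
  convexHull ℝ ((fun p : LatticePoint => ((p.1 : ℝ), (p.2 : ℝ))) '' (t : Set LatticePoint))

/-- A lattice triangle of area `1/2`, given by its three vertices. -/
def IsUnimodularTriangle (t : Finset LatticePoint) : Prop :=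
  ∃ p q r : LatticePoint, t = {p, q, r} ∧ |latticeDet (q - p) (r - p)| = 1

/-- A finite lattice triangulation with all triangles of area `1/2`, given by its set of triangles:
any two of them meet in the common face spanned by their common vertices. -/
structure IsTriangulation (T : Finset (Finset LatticePoint)) : Prop where
  unimodular : ∀ t ∈ T, IsUnimodularTriangle t
  inter_subset : ∀ t ∈ T, ∀ t' ∈ T, latticeHull t ∩ latticeHull t' ⊆ latticeHull (t ∩ t')

/-- The compact toric curves, that is, the edges which are an edge of two different triangles. -/
def toricCurves (T : Finset (Finset LatticePoint)) : Finset (Finset LatticePoint) :=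
  (T.biUnion (Finset.powersetCard 2)).filter
    (fun e => ∃ t ∈ T, ∃ t' ∈ T, t ≠ t' ∧ e ⊆ t ∧ e ⊆ t')

/-- The edge `e` is a toric curve with normal bundle `O(-1-m) ⊕ O(-1+m)`, where `m ≥ 0`:
its ends can be named `i, j` and the third vertices of the two adjacent triangles `α, β` so that
`α + β = (1 + m) i + (1 - m) j`. In the affine lattice coordinates with `i = (0,0)`, `j = (1,0)`,
`α = (0,-1)` this says that `β = (1 - m, 1)`. -/
def IsCurveOfType (T : Finset (Finset LatticePoint)) (e : Finset LatticePoint) (m : ℕ) : Prop :=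
  ∃ i j α β : LatticePoint, e = {i, j} ∧ i ≠ j ∧ α ≠ β ∧
    ({i, j, α} : Finset LatticePoint) ∈ T ∧ ({i, j, β} : Finset LatticePoint) ∈ T ∧
    α + β = (1 + (m : ℤ)) • i + (1 - (m : ℤ)) • j

/-- The number `m` of a toric curve (the only `m` with `IsCurveOfType T e m`, in a
triangulation). -/
noncomputable def curveNumber (T : Finset (Finset LatticePoint)) (e : Finset LatticePoint) : ℕ :=
  sInf {m : ℕ | IsCurveOfType T e m}

/-- The sum of the numbers `m` over all compact toric curves. -/
noncomputable def deformationCount (T : Finset (Finset LatticePoint)) : ℕ :=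
  ∑ e ∈ toricCurves T, curveNumber T e

/-- `R` is a region of `T` which is part of a regular triangular tessellation, and in which all
edges (those on the border of the region included) are `(-1,-1)`-curves. The regular tessellation
spanned by a lattice basis `a, b` has the triangles `p, p + a, p + b` and
`p + a, p + b, p + a + b`, for all lattice points `p`. -/
structure IsRegularRegion (T R : Finset (Finset LatticePoint)) : Prop where
  subset : R ⊆ T
  tessellation : ∃ a b : LatticePoint, latticeDet a b = 1 ∧ ∀ t ∈ R, ∃ p : LatticePoint,
    t = {p, p + a, p + b} ∨ t = {p + a, p + b, p + a + b}
  curves : ∀ t ∈ R, ∀ e ⊆ t, e.card = 2 → IsCurveOfType T e 0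

/-- `T'` arises from `T` by the flop which replaces the `(-1,-1)`-curve `C` by `C'`: the two
triangles at `C` form a parallelogram, and its diagonal `C` is replaced by the diagonal `C'`. -/
def IsFlop (T T' : Finset (Finset LatticePoint)) (C C' : Finset LatticePoint) : Prop :=
  ∃ i j α β : LatticePoint, C = {i, j} ∧ C' = {α, β} ∧ i ≠ j ∧ α ≠ β ∧
    ({i, j, α} : Finset LatticePoint) ∈ T ∧ ({i, j, β} : Finset LatticePoint) ∈ T ∧
    α + β = i + j ∧
    T' = (T \ {{i, j, α}, {i, j, β}}) ∪ {{α, β, i}, {α, β, j}}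

/-- `n` successive flops `T 0 = T₀, T 1, …, T n` inside the region `R` of `T₀` (the triangles of
`T₀` outside `R` are kept all the time); the flop number `k` replaces `C k` by `C' k`. -/
structure IsFlopSequence (T₀ R : Finset (Finset LatticePoint)) (n : ℕ)
    (T : ℕ → Finset (Finset LatticePoint)) (C C' : ℕ → Finset LatticePoint) : Prop where
  start : T 0 = T₀
  flop : ∀ k < n, IsFlop (T k) (T (k + 1)) (C k) (C' k)
  inside : ∀ k ≤ n, T₀ \ R ⊆ T k

/-- None of the `n` flops is the inverse of an earlier one. -/
def NoFlopUndone (n : ℕ) (C C' : ℕ → Finset LatticePoint) : Prop :=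
  ∀ k l : ℕ, k < l → l < n → ¬ (C l = C' k ∧ C' l = C k)

/-- The corner `o + r u + s v` of a unit cell of the grid spanned by `u, v` at `o`. -/
def cellCorner (o u v : LatticePoint) (c : ℕ × ℕ) : LatticePoint :=
  o + (c.1 : ℤ) • u + (c.2 : ℤ) • v

/-- The `k × k` quadrilateral with corner `o` and sides `k u, k v` lies in the region `R`, and each
of its `k²` unit cells is cut into two triangles of `R` by the diagonal that is parallel to
`u - v`. -/
def IsQuadrilateralIn (R : Finset (Finset LatticePoint)) (k : ℕ) (o u v : LatticePoint) : Prop :=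
  ∀ c ∈ Finset.range k ×ˢ Finset.range k,
    ({cellCorner o u v c, cellCorner o u v c + u, cellCorner o u v c + v} :
      Finset LatticePoint) ∈ R ∧
    ({cellCorner o u v c + u, cellCorner o u v c + v, cellCorner o u v c + u + v} :
      Finset LatticePoint) ∈ R

/-- The diagonals of the `k²` unit cells of the `k × k` quadrilateral. -/
def quadrilateralDiagonals (k : ℕ) (o u v : LatticePoint) : Finset (Finset LatticePoint) :=
  (Finset.range k ×ˢ Finset.range k).image
    (fun c => {cellCorner o u v c + u, cellCorner o u v c + v})

/-! ### Lattice determinants and unimodular triangles -/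

/-! The edge vectors of a triangle of area 1/2, up to sign, form a triangle of the Farey graph,
whose edges are the lattice bases {±u, ±v}. Such a Farey edge, with a choice of side, is encoded by
the form Q = `basisForm u v`, which sends X u + Y v to X Y. On the edges of a unimodular triangle
either Q ≥ 0 throughout (the triangle is beyond Q) or Q ≤ 0 throughout. A flop in a parallelogram
with sides u, v moves both of its triangles across the single Farey edge {±u, ±v} and across no
other (`diagonals_nonneg_iff`). The number m of a curve counts the Farey edges between its two
triangles; the proof needs only that at most m of them separate the two (`card_le_of_separates`).

Upper bound: a flop changes m by at most one on the four sides of the parallelogram, and its new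
diagonal has m = 0 (`deformationCount_flopSet_le`).

Lower bound: no two edges of a triangulation share a midpoint, and a flop keeps the midpoint of the
flopped edge. If no flop is undone, the form of a flop is negative on the edge at its midpoint at
all times before that flop (`neg_of_midpoint`). Hence flops with the same form Q have different
midpoints, the triangles of R are not beyond Q, and Q and -Q do not both occur. The flops with form
Q thus fill pairwise different cells of one lattice grid, and modulo two the inner triangles beyond
Q at an edge are counted by the cells with that edge as a side (`parity_inner`). So each boundary
side of this set of cells is a curve separated by Q (`isSeparatedBy_of_parity`); on the border of R
this holds because a border curve has m = 0, so that the triangle outside has the same edge vectors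
as the triangles of R. A set of N cells has at least 4√N boundary sides, and the sum over the forms
is at least 4√n, since a sum of roots is at least the root of the sum. Curves between two outer
triangles contribute equally before and after, and all other curves contribute 0 at the start.

Equality: when the flopped curves are the diagonals of a k × k quadrilateral, all flops have the
same form and the inner triangles have only two shapes. Then only the boundary sides of the
quadrilateral, 4k in number, can have m ≠ 0, and there m ≤ 1. -/

lemma latticeDet_swap (u v : LatticePoint) : latticeDet v u = -latticeDet u v := by
  simp only [latticeDet]; ring

lemma latticeDet_self (u : LatticePoint) : latticeDet u u = 0 := by
  simp only [latticeDet]; ring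

lemma mem_triple {x a b c : LatticePoint} :
    x ∈ ({a, b, c} : Finset LatticePoint) ↔ x = a ∨ x = b ∨ x = c := by simp

lemma triple_rotate (a b c : LatticePoint) : ({a, b, c} : Finset LatticePoint) = {b, c, a} := by
  ext x; simp only [mem_triple]; tauto

lemma triple_swap (a b c : LatticePoint) : ({a, b, c} : Finset LatticePoint) = {b, a, c} := by
  ext x; simp only [mem_triple]; tauto

lemma triple_swap_right (a b c : LatticePoint) :
    ({a, b, c} : Finset LatticePoint) = {a, c, b} := by
  ext x; simp only [mem_triple]; tauto

lemma ne_of_abs_latticeDet_eq_one {p q r : LatticePoint}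
    (h : |latticeDet (q - p) (r - p)| = 1) : p ≠ q ∧ p ≠ r ∧ q ≠ r := by
  refine ⟨?_, ?_, ?_⟩ <;> rintro rfl <;> simp [latticeDet, mul_comm] at h

/-- The six ways to name the vertices of a triangle. -/
lemma triple_eq_cases {p q r a b c : LatticePoint} (hpq : p ≠ q) (hpr : p ≠ r) (hqr : q ≠ r)
    (h : ({p, q, r} : Finset LatticePoint) = {a, b, c}) :
    (p = a ∧ q = b ∧ r = c) ∨ (p = a ∧ q = c ∧ r = b) ∨ (p = b ∧ q = a ∧ r = c) ∨
      (p = b ∧ q = c ∧ r = a) ∨ (p = c ∧ q = a ∧ r = b) ∨ (p = c ∧ q = b ∧ r = a) := by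
  have hp : p ∈ ({a, b, c} : Finset LatticePoint) := by rw [← h]; simp
  have hq : q ∈ ({a, b, c} : Finset LatticePoint) := by rw [← h]; simp
  have hr : r ∈ ({a, b, c} : Finset LatticePoint) := by rw [← h]; simp
  rw [mem_triple] at hp hq hr
  rcases hp with rfl | rfl | rfl <;> rcases hq with rfl | rfl | rfl <;>
    rcases hr with rfl | rfl | rfl <;> simp_all

lemma pair_eq_cases {a b c d : LatticePoint} (h : ({a, b} : Finset LatticePoint) = {c, d}) :
    (a = c ∧ b = d) ∨ (a = d ∧ b = c) := by
  have h' : ({a, b} : Set LatticePoint) = {c, d} := by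
    have := congrArg (fun s : Finset LatticePoint => (s : Set LatticePoint)) h
    simpa using this
  exact Set.pair_eq_pair_iff.mp h'

/-- Renaming the vertices changes the determinant at most by its sign, so the naming provided by the
definition can be replaced by any other. -/
lemma IsUnimodularTriangle.abs_det {p q r : LatticePoint}
    (h : IsUnimodularTriangle {p, q, r}) (hpq : p ≠ q) (hpr : p ≠ r) (hqr : q ≠ r) :
    |latticeDet (q - p) (r - p)| = 1 := by
  obtain ⟨a, b, c, he, hd⟩ := h
  have key : ∀ x y z : LatticePoint,
      latticeDet (z - y) (x - y) = latticeDet (y - x) (z - x) ∧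
      latticeDet (x - y) (z - y) = - latticeDet (y - x) (z - x) := by
    intro x y z
    constructor <;> simp only [latticeDet, Prod.fst_sub, Prod.snd_sub] <;> ring
  rcases triple_eq_cases hpq hpr hqr he with ⟨rfl, rfl, rfl⟩ | ⟨rfl, rfl, rfl⟩ | ⟨rfl, rfl, rfl⟩ |
    ⟨rfl, rfl, rfl⟩ | ⟨rfl, rfl, rfl⟩ | ⟨rfl, rfl, rfl⟩
  · exact hd
  · rwa [latticeDet_swap, abs_neg]
  · rwa [(key _ _ _).2, abs_neg] at hd
  · rwa [(key _ _ _).1, (key _ _ _).1] at hd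
  · rwa [(key _ _ _).1] at hd
  · rwa [(key _ _ _).1, latticeDet_swap, abs_neg] at hd

lemma IsUnimodularTriangle.exists_apex {t : Finset LatticePoint} (h : IsUnimodularTriangle t)
    {p q : LatticePoint} (hp : p ∈ t) (hq : q ∈ t) (hpq : p ≠ q) :
    ∃ r, t = {p, q, r} ∧ p ≠ r ∧ q ≠ r ∧ |latticeDet (q - p) (r - p)| = 1 := by
  have h' := h
  obtain ⟨a, b, c, rfl, hd⟩ := h
  obtain ⟨hab, hac, hbc⟩ := ne_of_abs_latticeDet_eq_one hd
  have : ∃ r, ({a, b, c} : Finset LatticePoint) = {p, q, r} ∧ p ≠ r ∧ q ≠ r := by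
    rw [mem_triple] at hp hq
    rcases hp with rfl | rfl | rfl <;> rcases hq with rfl | rfl | rfl
    · exact absurd rfl hpq
    · exact ⟨c, rfl, hac, hbc⟩
    · exact ⟨b, triple_swap_right _ _ _, hab, hbc.symm⟩
    · exact ⟨c, triple_swap _ _ _, hbc, hac⟩
    · exact absurd rfl hpq
    · exact ⟨a, triple_rotate _ _ _, hab.symm, hac.symm⟩
    · exact ⟨b, (triple_rotate _ _ _).symm, hbc.symm, hab⟩
    · exact ⟨a, by rw [triple_rotate, triple_swap], hac.symm, hab.symm⟩
    · exact absurd rfl hpq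
  obtain ⟨r, hr, h1, h2⟩ := this
  rw [hr] at h'
  exact ⟨r, hr, h1, h2, h'.abs_det hpq h1 h2⟩

/-! ### Combinatorial triangulations and flops -/

/-- The combinatorial properties of a unimodular triangulation: each directed edge has at most one
triangle on its left, and no two edges have the same midpoint. -/
structure IsCombTriangulation (T : Finset (Finset LatticePoint)) : Prop where
  unimodular : ∀ t ∈ T, IsUnimodularTriangle t
  apex : ∀ p q r r' : LatticePoint, {p, q, r} ∈ T → {p, q, r'} ∈ T →
    latticeDet (q - p) (r - p) = 1 → latticeDet (q - p) (r' - p) = 1 → r = r'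
  midpoint : ∀ t ∈ T, ∀ t' ∈ T, ∀ p ∈ t, ∀ q ∈ t, ∀ p' ∈ t', ∀ q' ∈ t', p ≠ q → p' ≠ q' →
    p + q = p' + q' → p = p' ∨ p = q'

/-- The conditions are universal in the triangles. This makes them available for the inner and the
outer triangles separately. -/
lemma IsCombTriangulation.mono {T S : Finset (Finset LatticePoint)} (h : IsCombTriangulation T)
    (hS : S ⊆ T) : IsCombTriangulation S where
  unimodular t ht := h.unimodular t (hS ht)
  apex p q r r' hr hr' := h.apex p q r r' (hS hr) (hS hr')
  midpoint t ht t' ht' := h.midpoint t (hS ht) t' (hS ht')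

lemma latticeDet_flip (p q r : LatticePoint) :
    latticeDet (p - q) (r - q) = - latticeDet (q - p) (r - p) := by
  simp only [latticeDet, Prod.fst_sub, Prod.snd_sub]; ring

/-- Two triangles on the same side of an edge agree. -/
lemma IsCombTriangulation.apex_eq {T : Finset (Finset LatticePoint)} (h : IsCombTriangulation T)
    {p q r r' : LatticePoint} (hr : {p, q, r} ∈ T) (hr' : {p, q, r'} ∈ T)
    (hd : |latticeDet (q - p) (r - p)| = 1)
    (hd' : latticeDet (q - p) (r' - p) = latticeDet (q - p) (r - p)) : r = r' := by
  rcases abs_eq (by norm_num : (0 : ℤ) ≤ 1) |>.mp hd with h1 | h1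
  · exact h.apex p q r r' hr hr' h1 (hd'.trans h1)
  · rw [triple_swap] at hr hr'
    refine h.apex q p r r' hr hr' ?_ ?_
    · rw [latticeDet_flip, h1]; rfl
    · rw [latticeDet_flip, hd', h1]; rfl

/-- The set of triangles after the flop of the diagonal `ij` of a parallelogram. -/
def flopSet (I : Finset (Finset LatticePoint)) (i j α β : LatticePoint) :
    Finset (Finset LatticePoint) :=
  (I \ {{i, j, α}, {i, j, β}}) ∪ {{α, β, i}, {α, β, j}}

/-- A parallelogram formed by two triangles of `T` with the common edge `ij`. -/
structure IsFlopQuad (T : Finset (Finset LatticePoint)) (i j α β : LatticePoint) : Prop where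
  ne : i ≠ j
  ne' : α ≠ β
  left : {i, j, α} ∈ T
  right : {i, j, β} ∈ T
  add_eq : α + β = i + j

/-- The four vertices of the parallelogram are distinct and it has area one. -/
lemma parallelogram_ne {i j α β : LatticePoint} (hij : i ≠ j) (h' : α ≠ β)
    (hu : IsUnimodularTriangle {i, j, α}) (h : α + β = i + j) :
    i ≠ α ∧ i ≠ β ∧ j ≠ α ∧ j ≠ β ∧ |latticeDet (j - i) (α - i)| = 1 := by
  obtain ⟨r, hr, h1, h2, h3⟩ := hu.exists_apex (p := i) (q := j) (by simp) (by simp) hij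
  have hr' : r ∈ ({i, j, α} : Finset LatticePoint) := by rw [hr]; simp
  rw [mem_triple] at hr'
  rcases hr' with rfl | rfl | rfl
  · exact absurd rfl h1
  · exact absurd rfl h2
  · refine ⟨h1, ?_, h2, ?_, h3⟩
    · rintro rfl; exact h2 (by rw [add_comm] at h; exact (add_left_cancel h).symm)
    · rintro rfl; exact h1 ((add_right_cancel h).symm)

/-- An edge other than the new diagonal of a triangle created by a flop was an edge of a triangle
removed by the flop; the third vertex has moved by the edge vector. -/
lemma flop_new_old {i j α β p q r : LatticePoint} (h : α + β = i + j)
    (hpq : p ≠ q) (hpr : p ≠ r) (hqr : q ≠ r)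
    (ht : ({p, q, r} : Finset LatticePoint) = {α, β, i} ∨
      ({p, q, r} : Finset LatticePoint) = {α, β, j})
    (hne : ({p, q} : Finset LatticePoint) ≠ {α, β}) :
    ∃ r₀, (({p, q, r₀} : Finset LatticePoint) = {i, j, α} ∨
      ({p, q, r₀} : Finset LatticePoint) = {i, j, β}) ∧ (r₀ = r + (q - p) ∨ r₀ = r + (p - q)) := by
  have e1 : j = α + β - i := by rw [h]; abel
  have e2 : i = α + β - j := by rw [h]; abel
  rcases ht with ht | ht <;> rcases triple_eq_cases hpq hpr hqr ht with
    ⟨rfl, rfl, rfl⟩ | ⟨rfl, rfl, rfl⟩ | ⟨rfl, rfl, rfl⟩ | ⟨rfl, rfl, rfl⟩ | ⟨rfl, rfl, rfl⟩ |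
    ⟨rfl, rfl, rfl⟩
  · exact absurd rfl hne
  · exact ⟨j, Or.inl (by ext; simp only [mem_triple]; tauto), Or.inr (by rw [e1]; abel)⟩
  · exact absurd (Finset.pair_comm _ _) hne
  · exact ⟨j, Or.inr (by ext; simp only [mem_triple]; tauto), Or.inr (by rw [e1]; abel)⟩
  · exact ⟨j, Or.inl (by ext; simp only [mem_triple]; tauto), Or.inl (by rw [e1]; abel)⟩
  · exact ⟨j, Or.inr (by ext; simp only [mem_triple]; tauto), Or.inl (by rw [e1]; abel)⟩
  · exact absurd rfl hne
  · exact ⟨i, Or.inl (by ext; simp only [mem_triple]; tauto), Or.inr (by rw [e2]; abel)⟩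
  · exact absurd (Finset.pair_comm _ _) hne
  · exact ⟨i, Or.inr (by ext; simp only [mem_triple]; tauto), Or.inr (by rw [e2]; abel)⟩
  · exact ⟨i, Or.inl (by ext; simp only [mem_triple]; tauto), Or.inl (by rw [e2]; abel)⟩
  · exact ⟨i, Or.inr (by ext; simp only [mem_triple]; tauto), Or.inl (by rw [e2]; abel)⟩

lemma triple_apex_eq {p q r r' : LatticePoint} (h1 : p ≠ r) (h2 : q ≠ r)
    (h : ({p, q, r} : Finset LatticePoint) = {p, q, r'}) : r = r' := by
  have : r ∈ ({p, q, r'} : Finset LatticePoint) := by rw [← h]; simp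
  rw [mem_triple] at this
  tauto

lemma new_pair {i j α β p q r r' : LatticePoint} (hij : i ≠ j) (hpq : p ≠ q)
    (t1 : ({p, q, r} : Finset LatticePoint) = {α, β, i})
    (t2 : ({p, q, r'} : Finset LatticePoint) = {α, β, j}) :
    ({p, q} : Finset LatticePoint) = {α, β} := by
  have key : ∀ x : LatticePoint, x ∈ ({p, q, r} : Finset LatticePoint) →
      x ∈ ({p, q, r'} : Finset LatticePoint) → x = α ∨ x = β := by
    intro x h1 h2
    rw [t1, mem_triple] at h1
    rw [t2, mem_triple] at h2
    rcases h1 with h1 | h1 | h1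
    · exact Or.inl h1
    · exact Or.inr h1
    · rcases h2 with h2 | h2 | h2
      · exact Or.inl h2
      · exact Or.inr h2
      · exact absurd (h1.symm.trans h2) hij
  rcases key p (by simp) (by simp) with rfl | rfl <;>
    rcases key q (by simp) (by simp) with rfl | rfl
  · exact absurd rfl hpq
  · rfl
  · exact Finset.pair_comm _ _
  · exact absurd rfl hpq

namespace IsFlopQuad

variable {T : Finset (Finset LatticePoint)} {i j α β : LatticePoint}

lemma distinct (h : IsFlopQuad T i j α β) (hT : IsCombTriangulation T) :
    i ≠ α ∧ i ≠ β ∧ j ≠ α ∧ j ≠ β ∧ |latticeDet (j - i) (α - i)| = 1 :=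
  parallelogram_ne h.ne h.ne' (hT.unimodular _ h.left) h.add_eq

/-- The new diagonal is not an edge of the triangulation before the flop. -/
lemma not_mem_old (h : IsFlopQuad T i j α β) (hT : IsCombTriangulation T)
    {t : Finset LatticePoint} (ht : t ∈ T) : ¬ (α ∈ t ∧ β ∈ t) := by
  rintro ⟨h1, h2⟩
  obtain ⟨n1, n2, n3, n4, -⟩ := h.distinct hT
  rcases hT.midpoint _ ht _ h.left α h1 β h2 i (by simp) j (by simp) h.ne' h.ne h.add_eq with h | h
  · exact n1 h.symm
  · exact n3 h.symm

/-- The triangles of the old diagonal are the two removed triangles. -/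
lemma eq_of_mem_old (h : IsFlopQuad T i j α β) (hT : IsCombTriangulation T)
    {t : Finset LatticePoint} (ht : t ∈ T) (hi : i ∈ t) (hj : j ∈ t) :
    t = {i, j, α} ∨ t = {i, j, β} := by
  obtain ⟨n1, n2, n3, n4, hd⟩ := h.distinct hT
  obtain ⟨r, rfl, h1, h2, h3⟩ := (hT.unimodular t ht).exists_apex hi hj h.ne
  have hβ : latticeDet (j - i) (β - i) = - latticeDet (j - i) (α - i) := by
    have : β = i + j - α := by rw [← h.add_eq]; abel
    rw [this]; simp only [latticeDet, Prod.fst_sub, Prod.snd_sub, Prod.fst_add, Prod.snd_add]; ring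
  by_cases hs : latticeDet (j - i) (r - i) = latticeDet (j - i) (α - i)
  · left; rw [hT.apex_eq h.left ht hd hs]
  · right
    rw [hT.apex_eq h.right ht (by rw [hβ, abs_neg, hd]) ?_]
    rw [hβ]
    rcases abs_eq (by norm_num : (0 : ℤ) ≤ 1) |>.mp hd with h1 | h1 <;>
    rcases abs_eq (by norm_num : (0 : ℤ) ≤ 1) |>.mp h3 with h2 | h2 <;> omega

lemma mem_flopSet {I : Finset (Finset LatticePoint)} {t : Finset LatticePoint} :
    t ∈ flopSet I i j α β ↔
      (t ∈ I ∧ t ≠ {i, j, α} ∧ t ≠ {i, j, β}) ∨ t = {α, β, i} ∨ t = {α, β, j} := by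
  simp only [flopSet, Finset.mem_union, Finset.mem_sdiff, Finset.mem_insert,
    Finset.mem_singleton, not_or]

/-- The old diagonal is not an edge of the triangulation after the flop. -/
lemma not_mem_new (h : IsFlopQuad T i j α β) (hT : IsCombTriangulation T)
    {t : Finset LatticePoint} (ht : t ∈ flopSet T i j α β) : ¬ (i ∈ t ∧ j ∈ t) := by
  rintro ⟨h1, h2⟩
  obtain ⟨n1, n2, n3, n4, -⟩ := h.distinct hT
  have n0 := h.ne
  rcases mem_flopSet.mp ht with ⟨ht, hn, hn'⟩ | rfl | rfl
  · rcases h.eq_of_mem_old hT ht h1 h2 with h | h <;> contradiction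
  · rw [mem_triple] at h2; rcases h2 with h | h | h <;> simp_all
  · rw [mem_triple] at h1; rcases h1 with h | h | h <;> simp_all

lemma new_unimodular (h : IsFlopQuad T i j α β) (hT : IsCombTriangulation T)
    {t : Finset LatticePoint} (ht : t = {α, β, i} ∨ t = {α, β, j}) : IsUnimodularTriangle t := by
  obtain ⟨n1, n2, n3, n4, hd⟩ := h.distinct hT
  have e : β = i + j - α := by rw [← h.add_eq]; abel
  rcases ht with rfl | rfl
  · refine ⟨_, _, _, rfl, ?_⟩
    rw [← hd, ← abs_neg]; congr 1
    rw [e]; simp only [latticeDet, Prod.fst_sub, Prod.snd_sub, Prod.fst_add, Prod.snd_add]; ring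
  · refine ⟨_, _, _, rfl, ?_⟩
    rw [← hd]; congr 1
    rw [e]; simp only [latticeDet, Prod.fst_sub, Prod.snd_sub, Prod.fst_add, Prod.snd_add]; ring

/-- Apart from the new diagonal a flop creates no edges, and the old diagonal, the only edge with
its midpoint, is gone. This carries the midpoint condition through a flop. -/
lemma midpoint_new (h : IsFlopQuad T i j α β) (hT : IsCombTriangulation T)
    {t : Finset LatticePoint} (ht : t ∈ flopSet T i j α β) {p q : LatticePoint}
    (hp : p ∈ t) (hq : q ∈ t) (hpq : p ≠ q) :
    ({p, q} : Finset LatticePoint) = {α, β} ∨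
      (p + q ≠ i + j ∧ ∃ t' ∈ T, p ∈ t' ∧ q ∈ t') := by
  by_cases hne : ({p, q} : Finset LatticePoint) = {α, β}
  · exact Or.inl hne
  right
  have key : ∃ t' ∈ T, p ∈ t' ∧ q ∈ t' := by
    rcases mem_flopSet.mp ht with ⟨ht, -, -⟩ | ht | ht
    · exact ⟨t, ht, hp, hq⟩
    all_goals
      obtain ⟨r, hr, h1, h2, -⟩ := (h.new_unimodular hT (by tauto)).exists_apex hp hq hpq
      obtain ⟨r₀, hr₀, -⟩ := flop_new_old h.add_eq hpq h1 h2 (by rw [← hr]; tauto) hne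
      refine ⟨{p, q, r₀}, ?_, by simp, by simp⟩
      rcases hr₀ with e | e
      · rw [e]; exact h.left
      · rw [e]; exact h.right
  refine ⟨fun hs => ?_, key⟩
  obtain ⟨t', ht', hp', hq'⟩ := key
  have hpq' := hT.midpoint _ ht' _ h.left p hp' q hq' i (by simp) j (by simp) hpq h.ne hs
  refine h.not_mem_new hT ht ?_
  rcases hpq' with rfl | rfl
  · exact ⟨hp, by rwa [← add_left_cancel hs]⟩
  · rw [add_comm] at hs
    exact ⟨by rwa [← add_right_cancel hs], hp⟩

/-- A flop of a combinatorial triangulation is a combinatorial triangulation. -/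
lemma isCombTriangulation (h : IsFlopQuad T i j α β) (hT : IsCombTriangulation T) :
    IsCombTriangulation (flopSet T i j α β) := by
  obtain ⟨n1, n2, n3, n4, hd⟩ := h.distinct hT
  have hu : ∀ t ∈ flopSet T i j α β, IsUnimodularTriangle t := by
    intro t ht
    rcases mem_flopSet.mp ht with ⟨ht, -, -⟩ | ht | ht
    · exact hT.unimodular t ht
    · exact h.new_unimodular hT (Or.inl ht)
    · exact h.new_unimodular hT (Or.inr ht)
  have hdis : ∀ {p q r : LatticePoint}, latticeDet (q - p) (r - p) = 1 →
      p ≠ q ∧ p ≠ r ∧ q ≠ r := fun hd => ne_of_abs_latticeDet_eq_one (by rw [hd]; rfl)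
  -- The apex moves parallel to the edge, hence stays on the same side of it.
  have hpres : ∀ {p q r r₀ : LatticePoint}, latticeDet (q - p) (r - p) = 1 →
      (r₀ = r + (q - p) ∨ r₀ = r + (p - q)) → latticeDet (q - p) (r₀ - p) = 1 := by
    intro p q r r₀ h1 h2
    rw [← h1]
    rcases h2 with rfl | rfl <;>
      simp only [latticeDet, Prod.fst_sub, Prod.snd_sub, Prod.fst_add, Prod.snd_add] <;> ring
  have old_of : ∀ {p q r₀ : LatticePoint}, (({p, q, r₀} : Finset LatticePoint) = {i, j, α} ∨
      ({p, q, r₀} : Finset LatticePoint) = {i, j, β}) → {p, q, r₀} ∈ T := by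
    rintro p q r₀ (e | e)
    · rw [e]; exact h.left
    · rw [e]; exact h.right
  -- If a new and a kept triangle were on the same side of an edge, then so would be a removed and a
  -- kept one before the flop; these would agree.
  have mixed : ∀ p q r r' : LatticePoint,
      (({p, q, r} : Finset LatticePoint) = {α, β, i} ∨
        ({p, q, r} : Finset LatticePoint) = {α, β, j}) →
      ({p, q, r'} ∈ T ∧ ({p, q, r'} : Finset LatticePoint) ≠ {i, j, α} ∧
        ({p, q, r'} : Finset LatticePoint) ≠ {i, j, β}) →
      latticeDet (q - p) (r - p) = 1 → latticeDet (q - p) (r' - p) = 1 → False := by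
    rintro p q r r' hn ⟨ho, hoα, hoβ⟩ h1 h2
    obtain ⟨d1, d2, d3⟩ := hdis h1
    have hne : ({p, q} : Finset LatticePoint) ≠ {α, β} := by
      intro e
      apply h.not_mem_old hT ho
      rcases pair_eq_cases e with ⟨rfl, rfl⟩ | ⟨rfl, rfl⟩ <;> simp
    obtain ⟨r₀, hr₀, hs⟩ := flop_new_old h.add_eq d1 d2 d3 hn hne
    obtain rfl := hT.apex p q r₀ r' (old_of hr₀) ho (hpres h1 hs) h2
    tauto
  have both : ∀ p q r r' : LatticePoint,
      (({p, q, r} : Finset LatticePoint) = {α, β, i} ∨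
        ({p, q, r} : Finset LatticePoint) = {α, β, j}) →
      (({p, q, r'} : Finset LatticePoint) = {α, β, i} ∨
        ({p, q, r'} : Finset LatticePoint) = {α, β, j}) →
      latticeDet (q - p) (r - p) = 1 → latticeDet (q - p) (r' - p) = 1 → r = r' := by
    intro p q r r' ht ht' h1 h2
    obtain ⟨d1, d2, d3⟩ := hdis h1
    obtain ⟨-, d4, d5⟩ := hdis h2
    by_cases hne : ({p, q} : Finset LatticePoint) = {α, β}
    · by_contra hrr
      -- The apexes over the new diagonal are `i` and `j`, which lie on opposite sides of it because
      -- their midpoint is on it.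
      have hs : r + r' = p + q := by
        have hr : r = i ∨ r = j := by
          have : ∀ x : LatticePoint, ({p, q, r} : Finset LatticePoint) = {α, β, x} → r = x := by
            intro x e
            have : r ∈ ({α, β, x} : Finset LatticePoint) := by rw [← e]; simp
            rw [mem_triple] at this
            rcases pair_eq_cases hne with ⟨rfl, rfl⟩ | ⟨rfl, rfl⟩ <;> tauto
          rcases ht with e | e
          · exact Or.inl (this _ e)
          · exact Or.inr (this _ e)
        have hr' : r' = i ∨ r' = j := by
          have : ∀ x : LatticePoint, ({p, q, r'} : Finset LatticePoint) = {α, β, x} → r' = x := by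
            intro x e
            have : r' ∈ ({α, β, x} : Finset LatticePoint) := by rw [← e]; simp
            rw [mem_triple] at this
            rcases pair_eq_cases hne with ⟨rfl, rfl⟩ | ⟨rfl, rfl⟩ <;> tauto
          rcases ht' with e | e
          · exact Or.inl (this _ e)
          · exact Or.inr (this _ e)
        have hadd := h.add_eq
        rcases hr with rfl | rfl <;> rcases hr' with rfl | rfl
        · exact absurd rfl hrr
        · rw [← hadd]; rcases pair_eq_cases hne with ⟨rfl, rfl⟩ | ⟨rfl, rfl⟩ <;> abel
        · rw [add_comm, ← hadd]; rcases pair_eq_cases hne with ⟨rfl, rfl⟩ | ⟨rfl, rfl⟩ <;> abel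
        · exact absurd rfl hrr
      obtain rfl : r' = p + q - r := by rw [← hs]; abel
      simp only [latticeDet, Prod.fst_sub, Prod.snd_sub, Prod.fst_add, Prod.snd_add] at h1 h2
      linarith
    · rcases ht with t1 | t1 <;> rcases ht' with t2 | t2
      · exact triple_apex_eq d2 d3 (t1.trans t2.symm)
      · exact absurd (new_pair h.ne d1 t1 t2) hne
      · exact absurd (new_pair h.ne d1 t2 t1) hne
      · exact triple_apex_eq d2 d3 (t1.trans t2.symm)
  refine ⟨hu, ?_, ?_⟩
  · intro p q r r' ht ht' h1 h2
    rcases mem_flopSet.mp ht with ho | hn <;> rcases mem_flopSet.mp ht' with ho' | hn'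
    · exact hT.apex p q r r' ho.1 ho'.1 h1 h2
    · exact (mixed p q r' r hn' ho h2 h1).elim
    · exact (mixed p q r r' hn ho' h1 h2).elim
    · exact both p q r r' hn hn' h1 h2
  · intro t ht t' ht' p hp q hq p' hp' q' hq' hpq hpq' hs
    rcases h.midpoint_new hT ht hp hq hpq with e | ⟨e, s, hs1, hps, hqs⟩ <;>
    rcases h.midpoint_new hT ht' hp' hq' hpq' with e' | ⟨e', s', hs1', hps', hqs'⟩
    · rcases pair_eq_cases (e.trans e'.symm) with h | h
      · exact Or.inl h.1
      · exact Or.inr h.1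
    · exfalso; apply e'
      rw [← hs, ← h.add_eq]
      rcases pair_eq_cases e with ⟨rfl, rfl⟩ | ⟨rfl, rfl⟩
      · rfl
      · exact add_comm _ _
    · exfalso; apply e
      rw [hs, ← h.add_eq]
      rcases pair_eq_cases e' with ⟨rfl, rfl⟩ | ⟨rfl, rfl⟩
      · rfl
      · exact add_comm _ _
    · exact hT.midpoint s hs1 s' hs1' p hps q hqs p' hps' q' hqs' hpq hpq' hs

end IsFlopQuad

/-! ### Lattice triangulations are combinatorial triangulations -/

lemma convexCombination_mem_latticeHull {t : Finset LatticePoint} {p q r : LatticePoint}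
    (hp : p ∈ t) (hq : q ∈ t) (hr : r ∈ t) {a b c : ℝ} (ha : 0 ≤ a) (hb : 0 ≤ b) (hc : 0 ≤ c)
    (h : a + b + c = 1) :
    (a * p.1 + b * q.1 + c * r.1, a * p.2 + b * q.2 + c * r.2) ∈ latticeHull t := by
  have hmem : ∀ x ∈ t, ((x.1 : ℝ), (x.2 : ℝ)) ∈ latticeHull t := fun x hx =>
    subset_convexHull ℝ _ ⟨x, by exact_mod_cast hx, rfl⟩
  have hconv : Convex ℝ (latticeHull t) := convex_convexHull ℝ _
  have := hconv.sum_mem (t := Finset.univ) (w := ![a, b, c])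
    (z := ![((p.1 : ℝ), (p.2 : ℝ)), ((q.1 : ℝ), (q.2 : ℝ)), ((r.1 : ℝ), (r.2 : ℝ))])
    (by intro i _; fin_cases i <;> simpa) (by simpa [Fin.sum_univ_three])
    (by intro i _; fin_cases i <;> simp [hmem, hp, hq, hr])
  simpa [Fin.sum_univ_three] using this

lemma affine_eq_zero_of_mem_latticeHull {t : Finset LatticePoint} {A B c : ℝ}
    (h : ∀ x ∈ t, A * x.1 + B * x.2 + c = 0) {z : ℝ × ℝ} (hz : z ∈ latticeHull t) :
    A * z.1 + B * z.2 + c = 0 := by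
  have hsub : latticeHull t ⊆ {z : ℝ × ℝ | A * z.1 + B * z.2 + c = 0} := by
    apply convexHull_min
    · rintro _ ⟨x, hx, rfl⟩
      exact h x (by exact_mod_cast hx)
    · intro x hx y hy a b _ _ hab
      simp only [Set.mem_ofPred_eq, Prod.fst_add, Prod.snd_add, Prod.smul_fst, Prod.smul_snd,
        smul_eq_mul] at *
      linear_combination a * hx + b * hy - c * hab
  exact hsub hz

/-- A point of a unimodular triangle's edge interior determines the edge as a face. -/
lemma vertex_mem_of_midpoint_mem_latticeHull {s : Finset LatticePoint} {p q r : LatticePoint}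
    (hd : |latticeDet (q - p) (r - p)| = 1) (hs : s ⊆ {p, q, r})
    (h : ((p.1 + q.1 : ℝ) / 2, (p.2 + q.2 : ℝ) / 2) ∈ latticeHull s) : p ∈ s := by
  by_contra hp
  -- The affine function vanishes on the line `q r`, and its value at the midpoint of `p q` is half
  -- the determinant of the triangle.
  have h0 := affine_eq_zero_of_mem_latticeHull (A := -((r.2 : ℝ) - q.2)) (B := (r.1 : ℝ) - q.1)
    (c := ((r.2 : ℝ) - q.2) * q.1 - ((r.1 : ℝ) - q.1) * q.2) (t := s) (by
      intro x hx
      have hx' := hs hx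
      rw [mem_triple] at hx'
      rcases hx' with rfl | rfl | rfl
      · exact absurd hx hp
      · ring
      · ring) h
  have h1 : ((latticeDet (q - p) (r - p) : ℤ) : ℝ) = 0 := by
    simp only [latticeDet, Prod.fst_sub, Prod.snd_sub]
    push_cast
    linear_combination 2 * h0
  have h2 : latticeDet (q - p) (r - p) = 0 := by exact_mod_cast h1
  rw [h2] at hd
  norm_num at hd

lemma eq_smul_add_smul {d w : LatticePoint} (h : latticeDet d w = 1) (z : LatticePoint) :
    z = latticeDet z w • d + latticeDet d z • w := by
  obtain ⟨d1, d2⟩ := d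
  obtain ⟨w1, w2⟩ := w
  obtain ⟨z1, z2⟩ := z
  simp only [latticeDet] at *
  ext
  · simp; linear_combination (-z1) * h
  · simp; linear_combination (-z2) * h

/-- The only place where convex geometry enters. Two triangles on the same side of an edge overlap
just above its midpoint, away from their common face. If two edges share a midpoint, the common face
contains this point, hence the ends of the edges. -/
lemma IsTriangulation.isCombTriangulation {T : Finset (Finset LatticePoint)}
    (hT : IsTriangulation T) : IsCombTriangulation T := by
  refine ⟨hT.unimodular, ?_, ?_⟩
  · intro p q r r' ht ht' h1 h2
    by_contra hne
    have hd := ne_of_abs_latticeDet_eq_one (p := p) (q := q) (r := r) (by rw [h1]; rfl)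
    have hd' := ne_of_abs_latticeDet_eq_one (p := p) (q := q) (r := r') (by rw [h2]; rfl)
    -- Both apexes have height one over the primitive vector `q - p`.
    obtain ⟨k, hk⟩ : ∃ k : ℤ, r' = r + k • (q - p) := by
      refine ⟨latticeDet (r' - r) (r - p), ?_⟩
      have e := eq_smul_add_smul h1 (r' - r)
      have e0 : latticeDet (q - p) (r' - r) = 0 := by
        simp only [latticeDet, Prod.fst_sub, Prod.snd_sub] at *
        linarith
      rw [e0, zero_smul, add_zero] at e
      rw [← e]; abel
    -- The common point is (1/2 - l) p + (1/2) q + l r. In terms of `r'` the weights of `p, q` are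
    -- shifted by ± l k, and this `l` is small enough to keep them nonnegative.
    set l : ℝ := 1 / (2 * (|(k : ℝ)| + 1)) with hl
    have hl0 : 0 < l := by positivity
    have hl1 : l * |(k : ℝ)| + l = 1 / 2 := by rw [hl]; field_simp
    have ha1 : l * k ≤ l * |(k : ℝ)| := by gcongr; exact le_abs_self _
    have ha2 : -(l * k) ≤ l * |(k : ℝ)| := by
      rw [← mul_neg]; gcongr; exact neg_le_abs _
    have m1 := convexCombination_mem_latticeHull (t := {p, q, r}) (p := p) (q := q) (r := r)
      (by simp) (by simp) (by simp) (a := 1 / 2 - l) (b := 1 / 2) (c := l)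
      (by nlinarith [abs_nonneg (k : ℝ)]) (by norm_num) hl0.le (by ring)
    have m2 := convexCombination_mem_latticeHull (t := {p, q, r'}) (p := p) (q := q) (r := r')
      (by simp) (by simp) (by simp) (a := 1 / 2 - l + l * k) (b := 1 / 2 - l * k) (c := l)
      (by linarith) (by linarith) hl0.le (by ring)
    have e : ((1 / 2 - l + l * k) * p.1 + (1 / 2 - l * k) * q.1 + l * r'.1,
        (1 / 2 - l + l * k) * p.2 + (1 / 2 - l * k) * q.2 + l * r'.2) =
        (((1 / 2 - l) * p.1 + 1 / 2 * q.1 + l * r.1 : ℝ),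
          ((1 / 2 - l) * p.2 + 1 / 2 * q.2 + l * r.2 : ℝ)) := by
      rw [hk]
      ext <;> simp <;> ring
    rw [e] at m2
    have m := hT.inter_subset _ ht _ ht' ⟨m1, m2⟩
    -- The common face lies on the line `p q`, whereas the common point has height `l > 0` over it.
    have h0 := affine_eq_zero_of_mem_latticeHull (A := -((q.2 : ℝ) - p.2)) (B := (q.1 : ℝ) - p.1)
      (c := ((q.2 : ℝ) - p.2) * p.1 - ((q.1 : ℝ) - p.1) * p.2) (by
        intro x hx
        rw [Finset.mem_inter, mem_triple, mem_triple] at hx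
        have : x = p ∨ x = q := by
          rcases hx with ⟨h | h | h, h' | h' | h'⟩
          all_goals first
            | exact Or.inl h
            | exact Or.inr h
            | exact Or.inl h'
            | exact Or.inr h'
            | exact absurd (h.symm.trans h') hne
        rcases this with rfl | rfl <;> ring) m
    have h1' : ((latticeDet (q - p) (r - p) : ℤ) : ℝ) = 1 := by rw [h1]; norm_num
    simp only [latticeDet, Prod.fst_sub, Prod.snd_sub] at h1'
    push_cast at h1'
    have : l = 0 := by linear_combination h0 - l * h1'
    exact hl0.ne' this
  · intro t ht t' ht' p hp q hq p' hp' q' hq' hpq hpq' hs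
    obtain ⟨r, rfl, h1, h2, h3⟩ := (hT.unimodular t ht).exists_apex hp hq hpq
    obtain ⟨r', rfl, h1', h2', h3'⟩ := (hT.unimodular t' ht').exists_apex hp' hq' hpq'
    have hm : ((p.1 + q.1 : ℝ) / 2, (p.2 + q.2 : ℝ) / 2) ∈ latticeHull {p, q, r} := by
      have := convexCombination_mem_latticeHull (t := {p, q, r}) hp hq hq
        (a := 1 / 2) (b := 1 / 2) (c := 0) (by norm_num) (by norm_num) le_rfl (by norm_num)
      convert this using 2 <;> ring
    have es : ((p.1 + q.1 : ℝ) / 2, (p.2 + q.2 : ℝ) / 2) =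
        ((p'.1 + q'.1 : ℝ) / 2, (p'.2 + q'.2 : ℝ) / 2) := by
      have e1 := congrArg Prod.fst hs
      have e2 := congrArg Prod.snd hs
      simp only [Prod.fst_add, Prod.snd_add] at e1 e2
      have e1' : (p.1 + q.1 : ℝ) = p'.1 + q'.1 := by exact_mod_cast e1
      have e2' : (p.2 + q.2 : ℝ) = p'.2 + q'.2 := by exact_mod_cast e2
      rw [e1', e2']
    have hm' : ((p.1 + q.1 : ℝ) / 2, (p.2 + q.2 : ℝ) / 2) ∈ latticeHull {p', q', r'} := by
      rw [es]
      have := convexCombination_mem_latticeHull (t := {p', q', r'}) hp' hq' hq'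
        (a := 1 / 2) (b := 1 / 2) (c := 0) (by norm_num) (by norm_num) le_rfl (by norm_num)
      convert this using 2 <;> ring
    have hi := hT.inter_subset _ ht _ ht' ⟨hm, hm'⟩
    have a1 := vertex_mem_of_midpoint_mem_latticeHull h3 Finset.inter_subset_left hi
    have i1 := hi
    rw [es] at i1
    have a2 := vertex_mem_of_midpoint_mem_latticeHull h3' Finset.inter_subset_right i1
    have a3 := vertex_mem_of_midpoint_mem_latticeHull (s := {p, q, r} ∩ {p', q', r'})
      (p := q') (q := p') (r := r')
      (by rw [latticeDet_flip, abs_neg, h3']) (by rw [triple_swap q' p' r']; exact Finset.inter_subset_right)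
      (by rwa [add_comm (q'.1 : ℝ), add_comm (q'.2 : ℝ)])
    have b2 := (Finset.mem_inter.mp a2).1
    have b3 := (Finset.mem_inter.mp a3).1
    rw [mem_triple] at b2 b3
    rcases b2 with rfl | rfl | rfl
    · exact Or.inl rfl
    · right; rw [add_comm] at hs; exact add_left_cancel hs
    · rcases b3 with rfl | rfl | rfl
      · exact Or.inr rfl
      · exact absurd (add_right_cancel hs) h1
      · exact absurd rfl hpq'

/-! ### The number of a toric curve -/

/-- The signed number of the edge `pq`, which depends on the order of its ends. -/
def HasShift (T : Finset (Finset LatticePoint)) (p q : LatticePoint) (s : ℤ) : Prop :=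
  p ≠ q ∧ ∃ γ γ' : LatticePoint, {p, q, γ} ∈ T ∧ {p, q, γ'} ∈ T ∧ γ ≠ γ' ∧
    γ + γ' = (1 + s) • p + (1 - s) • q

lemma HasShift.symm {T : Finset (Finset LatticePoint)} {p q : LatticePoint} {s : ℤ}
    (h : HasShift T p q s) : HasShift T q p (-s) := by
  obtain ⟨hpq, γ, γ', h1, h2, h3, h4⟩ := h
  refine ⟨hpq.symm, γ, γ', by rwa [triple_swap], by rwa [triple_swap], h3, ?_⟩
  rw [h4, add_comm, sub_neg_eq_add]; rfl

lemma HasShift.mono {T S : Finset (Finset LatticePoint)} (hS : S ⊆ T) {p q : LatticePoint} {s : ℤ}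
    (h : HasShift S p q s) : HasShift T p q s := by
  obtain ⟨hpq, γ, γ', h1, h2, h3, h4⟩ := h
  exact ⟨hpq, γ, γ', hS h1, hS h2, h3, h4⟩

/-- The condition m ≥ 0 fixes the order of the ends. The signed version allows any order, at the
price of the sign in `HasShift.symm`. -/
lemma isCurveOfType_iff {T : Finset (Finset LatticePoint)} {e : Finset LatticePoint} {m : ℕ} :
    IsCurveOfType T e m ↔ ∃ p q, e = {p, q} ∧ HasShift T p q m := by
  constructor
  · rintro ⟨i, j, α, β, he, hij, hne, h1, h2, h3⟩
    exact ⟨i, j, he, hij, α, β, h1, h2, hne, h3⟩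
  · rintro ⟨i, j, he, hij, α, β, h1, h2, hne, h3⟩
    exact ⟨i, j, α, β, he, hij, hne, h1, h2, h3⟩

lemma add_eq_of_latticeDet_eq_neg {p q γ γ' : LatticePoint}
    (h1 : latticeDet (q - p) (γ - p) = 1 ∨ latticeDet (q - p) (γ - p) = -1)
    (h : latticeDet (q - p) (γ' - p) = - latticeDet (q - p) (γ - p)) :
    ∃ s : ℤ, γ + γ' = (1 + s) • p + (1 - s) • q := by
  set D := latticeDet (q - p) (γ - p) with hD
  refine ⟨- D * latticeDet (γ + γ' - p - q) (γ - p), ?_⟩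
  obtain ⟨p1, p2⟩ := p
  obtain ⟨q1, q2⟩ := q
  obtain ⟨a1, a2⟩ := γ
  obtain ⟨b1, b2⟩ := γ'
  simp only [latticeDet, Prod.mk_sub_mk, Prod.mk_add_mk, Prod.smul_mk, smul_eq_mul] at *
  -- The vector `γ + γ' - p - q` has height zero, so it is a multiple of `q - p`; the witness is
  -- minus the coefficient, computed by Cramer's rule in the basis `q - p, γ - p`.
  have hDD : D * D = 1 := by rcases h1 with h | h <;> rw [h] <;> norm_num
  have h0 : (q1 - p1) * (a2 + b2 - p2 - q2) - (q2 - p2) * (a1 + b1 - p1 - q1) = 0 := by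
    rw [hD] at h
    linarith
  ext
  · simp only
    linear_combination (-(a1 + b1 - p1 - q1)) * hDD + (D * (a1 + b1 - p1 - q1)) * hD
      + D * (a1 - p1) * h0
  · simp only
    linear_combination (-(a2 + b2 - p2 - q2)) * hDD + (D * (a2 + b2 - p2 - q2)) * hD
      + D * (a2 - p2) * h0

lemma latticeDet_opposite {p q γ γ' : LatticePoint} {s : ℤ}
    (h : γ + γ' = (1 + s) • p + (1 - s) • q) :
    latticeDet (q - p) (γ' - p) = - latticeDet (q - p) (γ - p) := by
  obtain ⟨p1, p2⟩ := p
  obtain ⟨q1, q2⟩ := q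
  obtain ⟨a1, a2⟩ := γ
  obtain ⟨b1, b2⟩ := γ'
  simp only [latticeDet, Prod.mk_sub_mk, Prod.mk_add_mk, Prod.smul_mk, smul_eq_mul,
    Prod.mk.injEq] at *
  obtain ⟨h1, h2⟩ := h
  linear_combination (q1 - p1) * h2 - (q2 - p2) * h1

namespace IsCombTriangulation

variable {T : Finset (Finset LatticePoint)}

lemma ne_and_abs_det (hT : IsCombTriangulation T) {p q r : LatticePoint} (hpq : p ≠ q)
    (ht : {p, q, r} ∈ T) : p ≠ r ∧ q ≠ r ∧ |latticeDet (q - p) (r - p)| = 1 := by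
  obtain ⟨r', hr, h1, h2, h3⟩ := (hT.unimodular _ ht).exists_apex (p := p) (q := q)
    (by simp) (by simp) hpq
  obtain rfl := triple_apex_eq h1 h2 hr.symm
  exact ⟨h1, h2, h3⟩

lemma det_or (hT : IsCombTriangulation T) {p q r : LatticePoint} (hpq : p ≠ q)
    (ht : {p, q, r} ∈ T) :
    latticeDet (q - p) (r - p) = 1 ∨ latticeDet (q - p) (r - p) = -1 :=
  (abs_eq (by norm_num : (0 : ℤ) ≤ 1)).mp (hT.ne_and_abs_det hpq ht).2.2

/-- An edge of two different triangles has a signed number. -/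
lemma hasShift (hT : IsCombTriangulation T) {p q γ γ' : LatticePoint} (hpq : p ≠ q)
    (h1 : {p, q, γ} ∈ T) (h2 : {p, q, γ'} ∈ T) (hne : γ ≠ γ') :
    ∃ s : ℤ, HasShift T p q s ∧ γ + γ' = (1 + s) • p + (1 - s) • q := by
  have d1 := hT.det_or hpq h1
  have d2 := hT.det_or hpq h2
  have : latticeDet (q - p) (γ' - p) = - latticeDet (q - p) (γ - p) := by
    by_contra hcon
    refine hne (hT.apex_eq h1 h2 (hT.ne_and_abs_det hpq h1).2.2 ?_)
    rcases d1 with d1 | d1 <;> rcases d2 with d2 | d2 <;> rw [d1, d2] at hcon ⊢ <;> simp at hcon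
  obtain ⟨s, hs⟩ := add_eq_of_latticeDet_eq_neg d1 this
  exact ⟨s, ⟨hpq, γ, γ', h1, h2, hne, hs⟩, hs⟩

/-- The two triangles at an edge are the only ones. -/
lemma apex_or (hT : IsCombTriangulation T) {p q γ γ' δ : LatticePoint} (hpq : p ≠ q)
    (h1 : {p, q, γ} ∈ T) (h2 : {p, q, γ'} ∈ T) (hne : γ ≠ γ') (h3 : {p, q, δ} ∈ T) :
    δ = γ ∨ δ = γ' := by
  obtain ⟨s, -, hs⟩ := hT.hasShift hpq h1 h2 hne
  have hd := latticeDet_opposite hs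
  by_cases hc : latticeDet (q - p) (δ - p) = latticeDet (q - p) (γ - p)
  · exact Or.inl (hT.apex_eq h1 h3 (hT.ne_and_abs_det hpq h1).2.2 hc).symm
  · right
    refine (hT.apex_eq h2 h3 (hT.ne_and_abs_det hpq h2).2.2 ?_).symm
    rw [hd]
    rcases hT.det_or hpq h1 with d1 | d1 <;> rcases hT.det_or hpq h3 with d2 | d2 <;>
      rw [d1, d2] at hc ⊢ <;> simp at hc ⊢

/-- The two apexes over an edge are unique up to order, so their sum is determined, and `p ≠ q`
allows to solve for the coefficient. -/
lemma hasShift_unique (hT : IsCombTriangulation T) {p q : LatticePoint} {s s' : ℤ}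
    (h : HasShift T p q s) (h' : HasShift T p q s') : s = s' := by
  obtain ⟨hpq, γ, γ', h1, h2, h3, h4⟩ := h
  obtain ⟨-, δ, δ', k1, k2, k3, k4⟩ := h'
  have e : γ + γ' = δ + δ' := by
    rcases hT.apex_or hpq h1 h2 h3 k1 with rfl | rfl <;>
    rcases hT.apex_or hpq h1 h2 h3 k2 with rfl | rfl
    · exact absurd rfl k3
    · rfl
    · exact add_comm _ _
    · exact absurd rfl k3
  rw [h4, k4] at e
  have e' : (s - s') • (p - q) = 0 := by
    have : (s - s') • (p - q) = ((1 + s) • p + (1 - s) • q) - ((1 + s') • p + (1 - s') • q) := by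
      module
    rw [this, e, sub_self]
  rcases smul_eq_zero.mp e' with h | h
  · linarith
  · exact absurd (sub_eq_zero.mp h) hpq

/-- The two orders of the ends give the values `s` and `-s`, so exactly one natural number qualifies
and the infimum is taken over a singleton. -/
lemma curveNumber_eq (hT : IsCombTriangulation T) {p q : LatticePoint} {s : ℤ}
    (h : HasShift T p q s) : curveNumber T {p, q} = s.natAbs := by
  have key : {m : ℕ | IsCurveOfType T {p, q} m} = {s.natAbs} := by
    ext m
    simp only [Set.mem_ofPred_eq, Set.mem_singleton_iff]
    rw [isCurveOfType_iff]
    constructor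
    · rintro ⟨a, b, he, hs⟩
      rcases pair_eq_cases he with ⟨rfl, rfl⟩ | ⟨rfl, rfl⟩
      · have := hT.hasShift_unique h hs; omega
      · have := hT.hasShift_unique h hs.symm; omega
    · rintro rfl
      rcases Int.natAbs_eq s with hs | hs
      · exact ⟨p, q, rfl, by rwa [← hs]⟩
      · refine ⟨q, p, Finset.pair_comm _ _, ?_⟩
        have := h.symm
        rwa [hs, neg_neg] at this
  rw [curveNumber, key, csInf_singleton]

lemma mem_toricCurves (hT : IsCombTriangulation T) {e : Finset LatticePoint} :
    e ∈ toricCurves T ↔ ∃ p q s, e = {p, q} ∧ HasShift T p q s := by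
  simp only [toricCurves, Finset.mem_filter, Finset.mem_biUnion, Finset.mem_powersetCard]
  constructor
  · rintro ⟨⟨-, -, -, hc⟩, t, ht, t', ht', hne, he, he'⟩
    obtain ⟨p, q, hpq, rfl⟩ := Finset.card_eq_two.mp hc
    obtain ⟨γ, rfl, -⟩ := (hT.unimodular t ht).exists_apex (he (by simp : p ∈ _))
      (he (by simp : q ∈ _)) hpq
    obtain ⟨γ', rfl, -⟩ := (hT.unimodular t' ht').exists_apex (he' (by simp : p ∈ _))
      (he' (by simp : q ∈ _)) hpq
    obtain ⟨s, hs, -⟩ := hT.hasShift hpq ht ht' (by rintro rfl; exact hne rfl)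
    exact ⟨p, q, s, rfl, hs⟩
  · rintro ⟨p, q, s, rfl, hpq, γ, γ', h1, h2, h3, -⟩
    have hsub : ∀ r, ({p, q} : Finset LatticePoint) ⊆ {p, q, r} := by
      intro r x hx
      simp only [Finset.mem_insert, Finset.mem_singleton] at hx ⊢
      tauto
    obtain ⟨n1, n2, -⟩ := hT.ne_and_abs_det hpq h1
    exact ⟨⟨_, h1, hsub γ, Finset.card_pair hpq⟩, _, h1, _, h2,
      fun e => h3 (triple_apex_eq n1 n2 e), hsub γ, hsub γ'⟩

lemma toricCurves_mono {O : Finset (Finset LatticePoint)} (hO : O ⊆ T) :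
    toricCurves O ⊆ toricCurves T := by
  intro e he
  simp only [toricCurves, Finset.mem_filter, Finset.mem_biUnion] at he ⊢
  obtain ⟨⟨a, ha, hc⟩, t, ht, t', ht', h⟩ := he
  exact ⟨⟨a, hO ha, hc⟩, t, hO ht, t', hO ht', h⟩

lemma curveNumber_mono (hT : IsCombTriangulation T) {O : Finset (Finset LatticePoint)} (hO : O ⊆ T)
    {e : Finset LatticePoint} (he : e ∈ toricCurves O) : curveNumber T e = curveNumber O e := by
  obtain ⟨p, q, s, rfl, hs⟩ := (hT.mono hO).mem_toricCurves.mp he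
  rw [hT.curveNumber_eq (hs.mono hO), (hT.mono hO).curveNumber_eq hs]

/-- A curve with both triangles in `O` has the same number in `O` and in `T`. Used with the outer
triangles `T₀ \ R` as `O`, whose share is constant during the flops. -/
lemma deformationCount_eq_add (hT : IsCombTriangulation T) {O : Finset (Finset LatticePoint)}
    (hO : O ⊆ T) : deformationCount T =
      ∑ e ∈ toricCurves T \ toricCurves O, curveNumber T e + deformationCount O := by
  rw [deformationCount, deformationCount, ← Finset.sum_sdiff (toricCurves_mono hO)]
  congr 1
  exact Finset.sum_congr rfl fun e he => hT.curveNumber_mono hO he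

end IsCombTriangulation

/-- The triangles outside a regular region contribute the whole number. -/
lemma IsRegularRegion.deformationCount_eq {T R : Finset (Finset LatticePoint)}
    (hT : IsCombTriangulation T) (hR : IsRegularRegion T R) :
    deformationCount T = deformationCount (T \ R) := by
  rw [hT.deformationCount_eq_add (Finset.sdiff_subset : T \ R ⊆ T), Nat.add_eq_right]
  refine Finset.sum_eq_zero fun e he => ?_
  rw [Finset.mem_sdiff] at he
  obtain ⟨p, q, s, rfl, hs⟩ := hT.mem_toricCurves.mp he.1
  -- A curve that does not lie between two outer triangles is an edge of a triangle of `R`, so it is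
  -- a (-1,-1)-curve.
  have hr : ∃ t ∈ R, ({p, q} : Finset LatticePoint) ⊆ t := by
    by_contra hcon
    push Not at hcon
    obtain ⟨hpq, γ, γ', h1, h2, h3, h4⟩ := hs
    apply he.2
    rw [(hT.mono Finset.sdiff_subset).mem_toricCurves]
    refine ⟨p, q, s, rfl, hpq, γ, γ', ?_, ?_, h3, h4⟩
    · exact Finset.mem_sdiff.mpr ⟨h1, fun h => hcon _ h (by intro x; simp; tauto)⟩
    · exact Finset.mem_sdiff.mpr ⟨h2, fun h => hcon _ h (by intro x; simp; tauto)⟩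
  obtain ⟨t, ht, hsub⟩ := hr
  obtain ⟨a, b, he, hab⟩ := isCurveOfType_iff.mp
    (hR.curves t ht _ hsub (Finset.card_pair hs.1))
  rw [he, hT.curveNumber_eq hab]; rfl

/-! ### Indefinite binary forms as edges of the Farey graph -/

/-- The quadratic form `X u + Y v ↦ X Y`, for a lattice basis `u, v`. -/
def basisForm (u v z : LatticePoint) : ℤ := latticeDet z v * latticeDet u z

/-- `Q` is the form of a lattice basis. -/
def IsBasisForm (Q : LatticePoint → ℤ) : Prop :=
  ∃ u v : LatticePoint, |latticeDet u v| = 1 ∧ Q = basisForm u v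

/-- The form `Q` is nonnegative on all edges of the triangle `t`. -/
def IsBeyond (Q : LatticePoint → ℤ) (t : Finset LatticePoint) : Prop :=
  ∀ p ∈ t, ∀ q ∈ t, 0 ≤ Q (p - q)

lemma basisForm_comm (u v : LatticePoint) : basisForm u v = basisForm v u := by
  funext z; simp only [basisForm, latticeDet]; ring

lemma basisForm_neg_left (u v : LatticePoint) : basisForm (-u) v = -basisForm u v := by
  funext z; simp only [basisForm, latticeDet, Pi.neg_apply, Prod.fst_neg, Prod.snd_neg]; ring

lemma basisForm_neg_right (u v : LatticePoint) : basisForm u (-v) = -basisForm u v := by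
  rw [basisForm_comm, basisForm_neg_left, basisForm_comm]

lemma basisForm_neg_arg (u v z : LatticePoint) : basisForm u v (-z) = basisForm u v z := by
  simp only [basisForm, latticeDet, Prod.fst_neg, Prod.snd_neg]; ring

lemma basisForm_parallelogram (x y u v : LatticePoint) :
    basisForm x y (u + v) + basisForm x y (v - u) = 2 * basisForm x y u + 2 * basisForm x y v := by
  simp only [basisForm, latticeDet, Prod.fst_add, Prod.snd_add, Prod.fst_sub, Prod.snd_sub]; ring

lemma IsBasisForm.neg_arg {Q : LatticePoint → ℤ} (h : IsBasisForm Q) (z : LatticePoint) :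
    Q (-z) = Q z := by
  obtain ⟨u, v, hd, rfl⟩ := h
  exact basisForm_neg_arg u v z

lemma IsBasisForm.sub_comm {Q : LatticePoint → ℤ} (h : IsBasisForm Q) (p q : LatticePoint) :
    Q (p - q) = Q (q - p) := by
  rw [← neg_sub, h.neg_arg]

lemma IsBasisForm.zero {Q : LatticePoint → ℤ} (h : IsBasisForm Q) : Q 0 = 0 := by
  obtain ⟨u, v, hd, rfl⟩ := h
  simp [basisForm, latticeDet]

/-- If a b > 0 > c d, then a d and b c are nonzero integers of opposite signs, and their difference
is at least two in absolute value. -/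
lemma mul_nonneg_of_unimodular {a b c d : ℤ} (h : |a * d - b * c| = 1) (hab : 0 < a * b) :
    0 ≤ c * d := by
  by_contra! hcd
  rw [abs_eq (by norm_num)] at h
  rcases pos_and_pos_or_neg_and_neg_of_mul_pos hab with ⟨h1, h2⟩ | ⟨h1, h2⟩ <;>
  rcases mul_neg_iff.mp hcd with ⟨h3, h4⟩ | ⟨h3, h4⟩ <;>
  rcases h with h | h <;> nlinarith

/-- Multiplicativity of the determinant: the left side is the determinant of the coordinates of `z,
w` with respect to `u, v`, up to scaling. -/
lemma latticeDet_mul_latticeDet (u v z w : LatticePoint) :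
    latticeDet z v * latticeDet u w - latticeDet u z * latticeDet w v =
      latticeDet u v * latticeDet z w := by
  simp only [latticeDet]; ring

lemma IsBasisForm.nonneg_of_pos {Q : LatticePoint → ℤ} (h : IsBasisForm Q) {z w : LatticePoint}
    (hd : |latticeDet z w| = 1) (hz : 0 < Q z) : 0 ≤ Q w := by
  obtain ⟨u, v, huv, rfl⟩ := h
  refine mul_nonneg_of_unimodular (a := latticeDet z v) (b := latticeDet u z) ?_ hz
  rw [latticeDet_mul_latticeDet, abs_mul, huv, hd, one_mul]

lemma isBeyond_triple {Q : LatticePoint → ℤ} (h : IsBasisForm Q) {p q r : LatticePoint} :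
    IsBeyond Q {p, q, r} ↔ 0 ≤ Q (q - p) ∧ 0 ≤ Q (r - p) ∧ 0 ≤ Q (r - q) := by
  constructor
  · intro hb
    exact ⟨hb _ (by simp) _ (by simp), hb _ (by simp) _ (by simp), hb _ (by simp) _ (by simp)⟩
  · rintro ⟨h1, h2, h3⟩ a ha b hb
    rw [mem_triple] at ha hb
    rcases ha with rfl | rfl | rfl <;> rcases hb with rfl | rfl | rfl <;>
      first
        | (rw [sub_self, h.zero])
        | assumption
        | (rw [h.sub_comm]; assumption)

/-- A triangle is beyond `Q` when `Q` is positive on one of its edges. -/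
lemma isBeyond_of_pos {Q : LatticePoint → ℤ} (h : IsBasisForm Q) {t : Finset LatticePoint}
    (ht : IsUnimodularTriangle t) {p q : LatticePoint} (hp : p ∈ t) (hq : q ∈ t)
    (hpos : 0 < Q (q - p)) : IsBeyond Q t := by
  have hpq : p ≠ q := by rintro rfl; rw [sub_self, h.zero] at hpos; exact lt_irrefl _ hpos
  obtain ⟨r, rfl, -, -, hd⟩ := ht.exists_apex hp hq hpq
  rw [isBeyond_triple h]
  refine ⟨hpos.le, h.nonneg_of_pos hd hpos, h.nonneg_of_pos (z := q - p) ?_ hpos⟩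
  rw [← hd]; congr 1; simp only [latticeDet, Prod.fst_sub, Prod.snd_sub]; ring

lemma isBeyond_or_isBeyond_neg {Q : LatticePoint → ℤ} (h : IsBasisForm Q) {t : Finset LatticePoint}
    (ht : IsUnimodularTriangle t) : IsBeyond Q t ∨ IsBeyond (-Q) t := by
  by_cases hc : ∃ p ∈ t, ∃ q ∈ t, 0 < Q (q - p)
  · obtain ⟨p, hp, q, hq, hpos⟩ := hc
    exact Or.inl (isBeyond_of_pos h ht hp hq hpos)
  · push Not at hc
    exact Or.inr fun p hp q hq => by simpa using hc q hq p hp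

/-- The hypotheses say |a| ≤ c - 1 and |d| ≤ b - 1, so b c - a d ≥ b c - (b - 1)(c - 1) = b + c - 1.
As this determinant is at most one, b = c = 1 and a = d = 0. -/
lemma basis_of_signs_aux {a b c d : ℤ} (h : |a * d - b * c| = 1) (h1 : a < c) (h2 : d < b)
    (h3 : 0 < a + c) (h4 : 0 < b + d) : a = 0 ∧ d = 0 ∧ b * c = 1 := by
  have hb : 1 ≤ b := by omega
  have hc : 1 ≤ c := by omega
  have hle : b * c - a * d ≤ 1 := by
    have := neg_abs_le (a * d - b * c); omega
  rcases lt_trichotomy a 0 with ha | rfl | ha <;> rcases lt_trichotomy d 0 with hd | rfl | hd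
  · nlinarith [mul_nonneg (by omega : 0 ≤ c - 1 + a) (by omega : 0 ≤ -d),
      mul_nonneg (by omega : 0 ≤ c - 1) (by omega : 0 ≤ b - 1 + d)]
  · nlinarith
  · nlinarith
  · nlinarith
  · refine ⟨rfl, rfl, ?_⟩; nlinarith
  · nlinarith
  · nlinarith
  · nlinarith
  · nlinarith [mul_nonneg (by omega : 0 ≤ c - 1 - a) (by omega : 0 ≤ d),
      mul_nonneg (by omega : 0 ≤ c - 1) (by omega : 0 ≤ b - 1 - d)]

/-- Exchanging or negating the vectors (a, b), (c, d) reduces the four sign patterns of their sum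
and difference to one. -/
lemma basis_of_signs {a b c d : ℤ} (h : |a * d - b * c| = 1) (h1 : (c - a) * (d - b) < 0)
    (h2 : 0 < (a + c) * (b + d)) : (a = 0 ∧ d = 0 ∧ b * c = 1) ∨ (b = 0 ∧ c = 0 ∧ a * d = 1) := by
  rcases mul_neg_iff.mp h1 with ⟨h3, h4⟩ | ⟨h3, h4⟩ <;>
  rcases pos_and_pos_or_neg_and_neg_of_mul_pos h2 with ⟨h5, h6⟩ | ⟨h5, h6⟩
  · exact Or.inl (basis_of_signs_aux h (by omega) (by omega) h5 (by omega))
  · obtain ⟨e1, e2, e3⟩ := basis_of_signs_aux (a := -c) (b := -d) (c := -a) (d := -b)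
      (by rw [← h, ← abs_neg]; congr 1; ring) (by omega) (by omega) (by omega) (by omega)
    exact Or.inr ⟨by omega, by omega, by linarith⟩
  · obtain ⟨e1, e2, e3⟩ := basis_of_signs_aux (a := c) (b := d) (c := a) (d := b)
      (by rw [← h, ← abs_neg]; congr 1; ring) (by omega) (by omega) (by omega) (by omega)
    exact Or.inr ⟨by omega, by omega, by linarith⟩
  · obtain ⟨e1, e2, e3⟩ := basis_of_signs_aux (a := -a) (b := -b) (c := -c) (d := -d)
      (by rw [← h]; congr 1; ring) (by omega) (by omega) (by omega) (by omega)
    exact Or.inl ⟨by omega, by omega, by linarith⟩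

/-- The only parallelogram whose diagonals have different signs is the one that spans the form. -/
lemma basis_of_diagonals {x y u v : LatticePoint} (hxy : |latticeDet x y| = 1)
    (hd : |latticeDet u v| = 1) (h1 : basisForm x y (v - u) < 0) (h2 : 0 < basisForm x y (u + v)) :
    (u = x ∧ v = y) ∨ (u = -x ∧ v = -y) ∨ (u = y ∧ v = x) ∨ (u = -y ∧ v = -x) := by
  have hdet : |latticeDet u y * latticeDet x v - latticeDet x u * latticeDet v y| = 1 := by
    rw [latticeDet_mul_latticeDet, abs_mul, hxy, hd, one_mul]
  have e1 : basisForm x y (v - u) =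
      (latticeDet v y - latticeDet u y) * (latticeDet x v - latticeDet x u) := by
    simp only [basisForm, latticeDet, Prod.fst_sub, Prod.snd_sub]; ring
  have e2 : basisForm x y (u + v) =
      (latticeDet u y + latticeDet v y) * (latticeDet x u + latticeDet x v) := by
    simp only [basisForm, latticeDet, Prod.fst_add, Prod.snd_add]; ring
  rw [e1] at h1
  rw [e2] at h2
  have hexp : ∀ z : LatticePoint,
      latticeDet x y • z = latticeDet z y • x + latticeDet x z • y := by
    intro z
    ext <;> simp only [latticeDet, Prod.smul_fst, Prod.smul_snd, Prod.fst_add, Prod.snd_add,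
      smul_eq_mul] <;> ring
  have hu := hexp u
  have hv := hexp v
  rw [abs_eq (by norm_num)] at hxy
  rcases basis_of_signs hdet h1 h2 with ⟨h3, h4, h5⟩ | ⟨h3, h4, h5⟩ <;> rw [h3] at hu <;>
    rw [h4] at hv <;> rcases Int.mul_eq_one_iff_eq_one_or_neg_one.mp h5 with ⟨h6, h7⟩ | ⟨h6, h7⟩ <;>
    rw [h6] at hu <;> rw [h7] at hv <;> rcases hxy with h | h <;> rw [h] at hu hv <;>
    simp only [one_smul, neg_smul, zero_smul, zero_add, add_zero, neg_inj] at hu hv <;>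
    (try rw [neg_eq_iff_eq_neg] at hu hv) <;> tauto

lemma IsBasisForm.eq_of_diagonals {Q : LatticePoint → ℤ} (h : IsBasisForm Q) {u v : LatticePoint}
    (hd : |latticeDet u v| = 1) (h1 : Q (v - u) < 0) (h2 : 0 < Q (u + v)) :
    Q = basisForm u v := by
  obtain ⟨x, y, hxy, rfl⟩ := h
  rcases basis_of_diagonals hxy hd h1 h2 with ⟨rfl, rfl⟩ | ⟨rfl, rfl⟩ | ⟨rfl, rfl⟩ | ⟨rfl, rfl⟩
  · rfl
  · rw [basisForm_neg_left, basisForm_neg_right, neg_neg]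
  · exact basisForm_comm _ _
  · rw [basisForm_neg_left, basisForm_neg_right, neg_neg, basisForm_comm]

/-- A form that vanishes on a primitive vector `d` belongs to a basis that contains `d`. -/
lemma IsBasisForm.exists_of_eq_zero {Q : LatticePoint → ℤ} (h : IsBasisForm Q)
    {d w : LatticePoint} (hd : latticeDet d w = 1) (hQ : Q d = 0) :
    ∃ k : ℤ, Q = basisForm d (w + k • d) ∨ Q = -basisForm d (w + k • d) := by
  have key : ∀ u v : LatticePoint, |latticeDet u v| = 1 → latticeDet u d = 0 →
      ∃ k : ℤ, basisForm u v = basisForm d (w + k • d) ∨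
        basisForm u v = -basisForm d (w + k • d) := by
    intro u v huv h0
    have eu : u = latticeDet u w • d := by
      have := eq_smul_add_smul hd u
      rwa [latticeDet_swap u d, h0, neg_zero, zero_smul, add_zero] at this
    set ε := latticeDet u w with hε
    have ev := eq_smul_add_smul hd v
    set σ := latticeDet d v with hσ
    have hprod : |ε * σ| = 1 := by
      rw [← huv, hσ]; congr 1
      conv_rhs => rw [eu]
      simp only [latticeDet, Prod.smul_fst, Prod.smul_snd, smul_eq_mul]; ring
    have hσ1 : σ * σ = 1 := by
      rw [abs_mul] at hprod
      have : |σ| = 1 := Int.eq_one_of_mul_eq_one_left (abs_nonneg _) hprod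
      rw [← abs_mul_abs_self, this, one_mul]
    generalize latticeDet v w = τ at ev
    -- Here u = ε d and v = τ d + σ w = σ (w + σ τ d), because σ is its own inverse.
    refine ⟨σ * τ, ?_⟩
    have e : basisForm u v = (ε * σ) • basisForm d (w + (σ * τ) • d) := by
      funext z
      rw [eu, ev]
      clear_value σ ε
      simp only [basisForm, latticeDet, Prod.smul_fst, Prod.smul_snd, smul_eq_mul, Prod.fst_add,
        Prod.snd_add, Pi.smul_apply]
      linear_combination (-(ε * τ * (z.1 * d.2 - z.2 * d.1) *
        (d.1 * z.2 - d.2 * z.1))) * hσ1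
    rw [e]
    rcases (abs_eq (by norm_num : (0 : ℤ) ≤ 1)).mp hprod with h | h <;> rw [h]
    · left; rw [one_smul]
    · right; rw [neg_one_smul]
  obtain ⟨u, v, huv, rfl⟩ := h
  rcases mul_eq_zero.mp hQ with h0 | h0
  · obtain ⟨k, hk⟩ := key v u (by rw [latticeDet_swap, abs_neg, huv])
      (by rw [latticeDet_swap, h0, neg_zero])
    exact ⟨k, by rwa [basisForm_comm]⟩
  · exact key u v huv h0

/-- The triangles `t, t'` are on different sides of the form `Q`. -/
def Separates (Q : LatticePoint → ℤ) (t t' : Finset LatticePoint) : Prop :=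
  (IsBeyond Q t ∧ ¬ IsBeyond Q t') ∨ (IsBeyond Q t' ∧ ¬ IsBeyond Q t)

/-- A form that is nonzero on the common edge has both triangles on the same side. Hence `Q`
vanishes on `d = q - p` and belongs to a basis `d, w + k d`, a Farey edge at the vertex `d`. The two
triangles occupy the sectors `0` and `s` of the fan at `d`, so `k` is between them. One of the two
intervals is empty, and the other has |s| elements. -/
lemma Separates.exists_index {Q : LatticePoint → ℤ} (hQ : IsBasisForm Q) {p q γ γ' : LatticePoint}
    {s : ℤ} (hd : latticeDet (q - p) (γ - p) = 1) (hs : γ + γ' = (1 + s) • p + (1 - s) • q)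
    (h : Separates Q {p, q, γ} {p, q, γ'}) :
    ∃ k ∈ Finset.Ico 0 s ∪ Finset.Ico s 0, Q = basisForm (q - p) (γ - p + k • (q - p)) ∨
      Q = -basisForm (q - p) (γ - p + k • (q - p)) := by
  have hd' : |latticeDet (q - p) (γ' - p)| = 1 := by
    rw [latticeDet_opposite hs, abs_neg, hd]; rfl
  have hu : IsUnimodularTriangle {p, q, γ} := ⟨_, _, _, rfl, by rw [hd]; rfl⟩
  have hu' : IsUnimodularTriangle {p, q, γ'} := ⟨_, _, _, rfl, hd'⟩
  have h0 : Q (q - p) = 0 := by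
    by_contra hne
    rcases lt_or_gt_of_ne hne with hlt | hgt
    · rcases h with ⟨h, -⟩ | ⟨h, -⟩ <;>
      · have := h q (by simp) p (by simp)
        omega
    · have b1 := isBeyond_of_pos hQ hu (p := p) (q := q) (by simp) (by simp) hgt
      have b2 := isBeyond_of_pos hQ hu' (p := p) (q := q) (by simp) (by simp) hgt
      rcases h with ⟨-, h⟩ | ⟨-, h⟩ <;> contradiction
  obtain ⟨k, hk⟩ := hQ.exists_of_eq_zero hd h0
  refine ⟨k, ?_, hk⟩
  have e1 : γ' - p = (1 - s) • (q - p) - (γ - p) := by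
    rw [eq_sub_of_add_eq' hs]; module
  have e2 : γ' - q = -(s • (q - p)) - (γ - p) := by
    rw [eq_sub_of_add_eq' hs]; module
  have e3 : γ - q = (γ - p) - (q - p) := by abel
  rw [Separates, isBeyond_triple hQ, isBeyond_triple hQ, e1, e2, e3] at h
  generalize q - p = d at *
  generalize γ - p = w at *
  have v0 : ∀ l m : ℤ, basisForm d (w + k • d) (l • d + m • w) = m * (l - m * k) := by
    intro l m
    simp only [basisForm, latticeDet, Prod.smul_fst, Prod.smul_snd, smul_eq_mul, Prod.fst_add,
        Prod.snd_add] at hd ⊢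
    linear_combination (m * (l - m * k) * (d.1 * w.2 - d.2 * w.1 + 1)) * hd
  have v1 : basisForm d (w + k • d) w = -k := by
    have := v0 0 1; rw [zero_smul, zero_add, one_smul] at this; rw [this]; ring
  have v2 : basisForm d (w + k • d) (w - d) = -k - 1 := by
    have := v0 (-1) 1
    rw [one_smul, neg_one_smul, neg_add_eq_sub] at this; rw [this]; ring
  have v3 : basisForm d (w + k • d) ((1 - s) • d - w) = s - k - 1 := by
    have := v0 (1 - s) (-1)
    rw [neg_one_smul, ← sub_eq_add_neg] at this; rw [this]; ring
  have v4 : basisForm d (w + k • d) (-(s • d) - w) = s - k := by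
    have := v0 (-s) (-1)
    rw [neg_one_smul, neg_smul, ← sub_eq_add_neg] at this; rw [this]; ring
  rw [h0] at h
  -- For Q = `basisForm d (w + k • d)` the first triangle is beyond Q exactly when k < 0, the second
  -- exactly when k < s; for -Q the inequalities are reversed.
  simp only [Finset.mem_union, Finset.mem_Ico]
  rcases hk with rfl | rfl
  · rw [v1, v2, v3, v4] at h; omega
  · simp only [Pi.neg_apply] at h
    rw [v1, v2, v3, v4] at h; omega

/-- An edge with number `m` is separated by at most `m` forms, if of two opposite forms at most
one is counted. -/
lemma card_le_of_separates {T : Finset (Finset LatticePoint)} (hT : IsCombTriangulation T)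
    {p q : LatticePoint} {s : ℤ} (hs : HasShift T p q s) (S : Finset (LatticePoint → ℤ))
    (hS : ∀ Q ∈ S, IsBasisForm Q ∧ -Q ∉ S ∧ ∃ γ γ', {p, q, γ} ∈ T ∧ {p, q, γ'} ∈ T ∧
      IsBeyond Q {p, q, γ} ∧ ¬ IsBeyond Q {p, q, γ'}) : S.card ≤ s.natAbs := by
  classical
  obtain ⟨hpq, γ, γ', h1, h2, hne, h4⟩ := hs
  wlog hd : latticeDet (q - p) (γ - p) = 1 generalizing γ γ'
  · refine this γ' γ h2 h1 hne.symm (by rw [add_comm, h4]) ?_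
    rw [latticeDet_opposite h4]
    rcases hT.det_or hpq h1 with h | h
    · exact absurd h hd
    · rw [h]; rfl
  have hsub : S ⊆ (Finset.Ico 0 s ∪ Finset.Ico s 0).biUnion (fun k =>
      S.filter (fun Q => Q = basisForm (q - p) (γ - p + k • (q - p)) ∨
        Q = -basisForm (q - p) (γ - p + k • (q - p)))) := by
    intro Q hQ
    obtain ⟨hQf, -, δ, δ', d1, d2, b1, b2⟩ := hS Q hQ
    have hsep : Separates Q {p, q, γ} {p, q, γ'} := by
      rcases hT.apex_or hpq h1 h2 hne d1 with rfl | rfl <;>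
      rcases hT.apex_or hpq h1 h2 hne d2 with rfl | rfl
      · exact absurd b1 b2
      · exact Or.inl ⟨b1, b2⟩
      · exact Or.inr ⟨b1, b2⟩
      · exact absurd b1 b2
    obtain ⟨k, hk, hkQ⟩ := hsep.exists_index hQf hd h4
    rw [Finset.mem_biUnion]
    exact ⟨k, hk, Finset.mem_filter.mpr ⟨hQ, hkQ⟩⟩
  -- Each index allows two opposite forms, of which `S` contains at most one.
  have hone : ∀ k ∈ Finset.Ico 0 s ∪ Finset.Ico s 0,
      (S.filter (fun Q => Q = basisForm (q - p) (γ - p + k • (q - p)) ∨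
        Q = -basisForm (q - p) (γ - p + k • (q - p)))).card ≤ 1 := by
    intro k _
    rw [Finset.card_le_one]
    intro Q hQ Q' hQ'
    rw [Finset.mem_filter] at hQ hQ'
    obtain ⟨hQ, e⟩ := hQ
    obtain ⟨hQ', e'⟩ := hQ'
    rcases e with e | e <;> rcases e' with e' | e'
    · rw [e, e']
    · exact absurd (by rwa [e, ← e']) (hS Q hQ).2.1
    · exact absurd (by rwa [e', ← e]) (hS Q' hQ').2.1
    · rw [e, e']
  calc S.card ≤ _ := Finset.card_le_card hsub
    _ ≤ _ := Finset.card_biUnion_le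
    _ ≤ ∑ k ∈ Finset.Ico 0 s ∪ Finset.Ico s 0, 1 := Finset.sum_le_sum hone
    _ = (Finset.Ico 0 s ∪ Finset.Ico s 0).card := by simp
    _ ≤ (Finset.Ico 0 s).card + (Finset.Ico s 0).card := Finset.card_union_le _ _
    _ = s.natAbs := by rw [Int.card_Ico, Int.card_Ico]; omega

/-! ### The perimeter of a set of lattice cells -/

/-- Each line `g = c` that meets `M` contains an `f`-minimal element `z` of `M`; the point `z - x`
is on the same line and lower, so it is not in `M`. -/
lemma card_image_le_card_boundary (M : Finset LatticePoint) (x : LatticePoint)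
    (f g : LatticePoint → ℤ) (hf : ∀ z, f (z - x) < f z) (hg : ∀ z, g (z - x) = g z) :
    (M.image g).card ≤ (M.filter (fun z => z - x ∉ M)).card := by
  refine (Finset.card_le_card ?_).trans (Finset.card_image_le (f := g))
  intro c hc
  obtain ⟨z₀, hz₀, rfl⟩ := Finset.mem_image.mp hc
  obtain ⟨z, hz, hmin⟩ := Finset.exists_min_image (M.filter (fun z => g z = g z₀)) f
    ⟨z₀, Finset.mem_filter.mpr ⟨hz₀, rfl⟩⟩
  rw [Finset.mem_filter] at hz
  refine Finset.mem_image.mpr ⟨z, Finset.mem_filter.mpr ⟨hz.1, fun hcon => ?_⟩, hz.2⟩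
  have := hmin (z - x) (Finset.mem_filter.mpr ⟨hcon, by rw [hg, hz.2]⟩)
  exact absurd (hf z) (not_lt.mpr this)

/-- `e` is a side of the lattice cell with sides `x, y` at `z`. -/
def IsCellSide (x y z : LatticePoint) (e : Finset LatticePoint) : Prop :=
  e = {z, z + y} ∨ e = {z + x, z + x + y} ∨ e = {z, z + x} ∨ e = {z + y, z + y + x}

lemma isCellSide_comm {x y z : LatticePoint} {e : Finset LatticePoint} :
    IsCellSide x y z e ↔ IsCellSide y x z e := by
  unfold IsCellSide; tauto

open scoped Classical in
/-- The number modulo two of the cells of `M` with side `e`. -/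
noncomputable def sideParity (x y : LatticePoint) (M : Finset LatticePoint)
    (e : Finset LatticePoint) : ZMod 2 :=
  ∑ z ∈ M, if IsCellSide x y z e then 1 else 0

lemma sideParity_comm (x y : LatticePoint) (M : Finset LatticePoint) (e : Finset LatticePoint) :
    sideParity x y M e = sideParity y x M e := by
  classical
  exact Finset.sum_congr rfl fun z _ => if_congr isCellSide_comm rfl rfl

lemma two_smul_injective {a b : LatticePoint} (h : a + a = b + b) : a = b := by
  have h1 := congrArg Prod.fst h
  have h2 := congrArg Prod.snd h
  simp only [Prod.fst_add, Prod.snd_add] at h1 h2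
  ext <;> omega

lemma pair_add_eq_cases {a b d d' : LatticePoint}
    (h : ({a, a + d} : Finset LatticePoint) = {b, b + d'}) : (a = b ∧ d = d') ∨ d = -d' := by
  rcases pair_eq_cases h with ⟨rfl, h2⟩ | ⟨rfl, h2⟩
  · exact Or.inl ⟨rfl, add_left_cancel h2⟩
  · right
    rw [add_assoc, add_eq_left, add_comm] at h2
    exact eq_neg_of_add_eq_zero_left h2

lemma ne_of_basis {x y : LatticePoint} (h : |latticeDet x y| = 1) :
    x ≠ 0 ∧ y ≠ 0 ∧ x ≠ y ∧ x ≠ -y := by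
  refine ⟨?_, ?_, ?_, ?_⟩ <;> rintro rfl <;> simp [latticeDet, mul_comm] at h

lemma latticePoint_ne_neg {x : LatticePoint} (h : x ≠ 0) : x ≠ -x := by
  intro hx
  apply h
  apply two_smul_injective
  nth_rewrite 2 [hx]
  simp

lemma isCellSide_pair_iff {x y : LatticePoint} (h : |latticeDet x y| = 1) {z w : LatticePoint} :
    IsCellSide x y z {w, w + y} ↔ z = w ∨ z = w - x := by
  obtain ⟨hx, hy, hxy, hxy'⟩ := ne_of_basis h
  have hyy := latticePoint_ne_neg hy
  constructor
  · rintro (h | h | h | h)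
    · rcases pair_add_eq_cases h with ⟨h, -⟩ | h
      · exact Or.inl h.symm
      · contradiction
    · rcases pair_add_eq_cases h with ⟨h, -⟩ | h
      · right; rw [h]; abel
      · contradiction
    · rcases pair_add_eq_cases h with ⟨-, h⟩ | h
      · exact absurd h.symm hxy
      · exact absurd (by rw [h, neg_neg]) hxy'
    · rcases pair_add_eq_cases h with ⟨-, h⟩ | h
      · exact absurd h.symm hxy
      · exact absurd (by rw [h, neg_neg]) hxy'
  · rintro (rfl | rfl)
    · exact Or.inl rfl
    · right; left; rw [sub_add_cancel]

lemma sideParity_pair {x y : LatticePoint} (h : |latticeDet x y| = 1) (M : Finset LatticePoint)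
    (w : LatticePoint) : sideParity x y M {w, w + y} =
      (if w ∈ M then 1 else 0) + (if w - x ∈ M then 1 else 0) := by
  classical
  have hne : w ≠ w - x := by
    intro hw
    exact (ne_of_basis h).1 (sub_eq_self.mp hw.symm)
  simp only [sideParity, isCellSide_pair_iff h]
  rw [← Finset.sum_ite_eq' M w (fun _ => (1 : ZMod 2)),
    ← Finset.sum_ite_eq' M (w - x) (fun _ => (1 : ZMod 2)), ← Finset.sum_add_distrib]
  refine Finset.sum_congr rfl fun z _ => ?_
  by_cases h1 : z = w
  · subst h1; simp [hne]
  · by_cases h2 : z = w - x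
    · subst h2; simp [hne.symm]
    · simp [h1, h2]

open scoped Classical in
/-- The boundary sides of a set of lattice cells. -/
noncomputable def cellBoundary (x y : LatticePoint) (M : Finset LatticePoint) :
    Finset (Finset LatticePoint) :=
  ((M.filter (fun z => z - x ∉ M)).image (fun z => {z, z + y}) ∪
    (M.filter (fun z => z - -x ∉ M)).image (fun z => {z + x, z + x + y})) ∪
  ((M.filter (fun z => z - y ∉ M)).image (fun z => {z, z + x}) ∪
    (M.filter (fun z => z - -y ∉ M)).image (fun z => {z + y, z + y + x}))

lemma sideParity_of_mem_cellBoundary {x y : LatticePoint} (h : |latticeDet x y| = 1)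
    {M : Finset LatticePoint} {e : Finset LatticePoint} (he : e ∈ cellBoundary x y M) :
    sideParity x y M e = 1 ∧ e.card = 2 := by
  have h' : |latticeDet y x| = 1 := by rw [latticeDet_swap, abs_neg, h]
  obtain ⟨hx, hy, -, -⟩ := ne_of_basis h
  have hc : ∀ a d : LatticePoint, d ≠ 0 → ({a, a + d} : Finset LatticePoint).card = 2 :=
    fun a d hd => Finset.card_pair fun e => hd (left_eq_add.mp e)
  simp only [cellBoundary, Finset.mem_union, Finset.mem_image, Finset.mem_filter] at he
  rcases he with (⟨z, ⟨hz, hz'⟩, rfl⟩ | ⟨z, ⟨hz, hz'⟩, rfl⟩) | (⟨z, ⟨hz, hz'⟩, rfl⟩ |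
    ⟨z, ⟨hz, hz'⟩, rfl⟩)
  · exact ⟨by rw [sideParity_pair h, if_pos hz, if_neg hz', add_zero], hc _ _ hy⟩
  · refine ⟨?_, hc _ _ hy⟩
    rw [sub_neg_eq_add] at hz'
    rw [sideParity_pair h, add_sub_cancel_right, if_pos hz, if_neg hz', zero_add]
  · exact ⟨by rw [sideParity_comm, sideParity_pair h', if_pos hz, if_neg hz', add_zero], hc _ _ hx⟩
  · refine ⟨?_, hc _ _ hx⟩
    rw [sub_neg_eq_add] at hz'
    rw [sideParity_comm, sideParity_pair h', add_sub_cancel_right, if_pos hz, if_neg hz', zero_add]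

/-- A segment is a side of at most two cells of the grid, so odd parity means that exactly one of
them is in `M`. -/
lemma mem_cellBoundary_of_sideParity {x y : LatticePoint} (h : |latticeDet x y| = 1)
    {M : Finset LatticePoint} {e : Finset LatticePoint} (he : sideParity x y M e = 1) :
    e ∈ cellBoundary x y M := by
  classical
  have h' : |latticeDet y x| = 1 := by rw [latticeDet_swap, abs_neg, h]
  have h11 : (1 : ZMod 2) + 1 ≠ 1 := by decide
  obtain ⟨z, hz, hs⟩ : ∃ z ∈ M, IsCellSide x y z e := by
    by_contra! hcon
    rw [sideParity, Finset.sum_eq_zero fun z hz => if_neg (hcon z hz)] at he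
    exact absurd he (by decide)
  simp only [cellBoundary, Finset.mem_union, Finset.mem_image, Finset.mem_filter]
  rcases hs with rfl | rfl | rfl | rfl
  · left; left
    refine ⟨z, ⟨hz, fun hcon => ?_⟩, rfl⟩
    rw [sideParity_pair h, if_pos hz, if_pos hcon] at he
    exact h11 he
  · left; right
    refine ⟨z, ⟨hz, fun hcon => ?_⟩, rfl⟩
    rw [sub_neg_eq_add] at hcon
    rw [sideParity_pair h, add_sub_cancel_right, if_pos hz, if_pos hcon] at he
    exact h11 he
  · right; left
    refine ⟨z, ⟨hz, fun hcon => ?_⟩, rfl⟩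
    rw [sideParity_comm, sideParity_pair h', if_pos hz, if_pos hcon] at he
    exact h11 he
  · right; right
    refine ⟨z, ⟨hz, fun hcon => ?_⟩, rfl⟩
    rw [sub_neg_eq_add] at hcon
    rw [sideParity_comm, sideParity_pair h', add_sub_cancel_right, if_pos hz, if_pos hcon] at he
    exact h11 he

lemma card_cellBoundary {x y : LatticePoint} (h : |latticeDet x y| = 1)
    (M : Finset LatticePoint) : (cellBoundary x y M).card =
      ((M.filter (fun z => z - x ∉ M)).card + (M.filter (fun z => z - -x ∉ M)).card) +
      ((M.filter (fun z => z - y ∉ M)).card + (M.filter (fun z => z - -y ∉ M)).card) := by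
  classical
  obtain ⟨hx, hy, hxy, hxy'⟩ := ne_of_basis h
  have hxx := latticePoint_ne_neg hx
  have hyy := latticePoint_ne_neg hy
  have hinj : ∀ a d : LatticePoint, d ≠ -d → Function.Injective
      (fun z : LatticePoint => ({z + a, z + a + d} : Finset LatticePoint)) := by
    intro a d hd z z' hz
    rcases pair_add_eq_cases hz with ⟨h, -⟩ | h
    · exact add_right_cancel h
    · contradiction
  have hinj0 : ∀ d : LatticePoint, d ≠ -d → Function.Injective
      (fun z : LatticePoint => ({z, z + d} : Finset LatticePoint)) := by
    intro d hd
    simpa using hinj 0 d hd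
  have hdis : ∀ a d : LatticePoint, d ≠ -d → Disjoint
      ((M.filter (fun z => z - a ∉ M)).image (fun z => ({z, z + d} : Finset LatticePoint)))
      ((M.filter (fun z => z - -a ∉ M)).image (fun z => {z + a, z + a + d})) := by
    intro a d hd
    rw [Finset.disjoint_left]
    intro e he he'
    rw [Finset.mem_image] at he he'
    obtain ⟨z, hz, rfl⟩ := he
    obtain ⟨z', hz', he⟩ := he'
    rw [Finset.mem_filter] at hz hz'
    rcases pair_add_eq_cases he with ⟨h, -⟩ | h
    · apply hz.2; rw [← h, add_sub_cancel_right]; exact hz'.1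
    · contradiction
  rw [cellBoundary, Finset.card_union_of_disjoint, Finset.card_union_of_disjoint (hdis x y hyy),
    Finset.card_union_of_disjoint (hdis y x hxx), Finset.card_image_of_injective _ (hinj0 y hyy),
    Finset.card_image_of_injective _ (hinj0 x hxx), Finset.card_image_of_injective _ (hinj x y hyy),
    Finset.card_image_of_injective _ (hinj y x hxx)]
  rw [Finset.disjoint_left]
  intro e he he'
  have key : ∀ a b : LatticePoint,
      ({a, a + x} : Finset LatticePoint) = {b, b + y} → False := by
    intro a b hab
    rcases pair_add_eq_cases hab with ⟨-, h⟩ | h <;> contradiction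
  simp only [Finset.mem_union, Finset.mem_image] at he he'
  rcases he with ⟨z, -, rfl⟩ | ⟨z, -, rfl⟩ <;> rcases he' with ⟨z', -, he⟩ | ⟨z', -, he⟩ <;>
    exact key _ _ he

/-- The isoperimetric inequality for lattice cells. -/
lemma four_mul_sqrt_le_card_cellBoundary {x y : LatticePoint} (h : |latticeDet x y| = 1)
    (M : Finset LatticePoint) :
    4 * Real.sqrt (M.card : ℝ) ≤ ((cellBoundary x y M).card : ℝ) := by
  have hD : latticeDet x y * latticeDet x y = 1 := by rw [← abs_mul_abs_self, h, one_mul]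
  -- The coordinates with respect to `x, y`; the factor `latticeDet x y` = ±1 corrects the
  -- orientation.
  set f : LatticePoint → ℤ := fun z => latticeDet x y * latticeDet z y with hf
  set g : LatticePoint → ℤ := fun z => latticeDet x y * latticeDet x z with hg
  have f1 : ∀ z, f (z - x) = f z - 1 := by
    intro z
    rw [← hD]; simp only [hf, latticeDet, Prod.fst_sub, Prod.snd_sub]; ring
  have f2 : ∀ z, f (z - y) = f z := by
    intro z
    simp only [hf, latticeDet, Prod.fst_sub, Prod.snd_sub]; ring
  have g1 : ∀ z, g (z - x) = g z := by
    intro z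
    simp only [hg, latticeDet, Prod.fst_sub, Prod.snd_sub]; ring
  have g2 : ∀ z, g (z - y) = g z - 1 := by
    intro z
    rw [← hD]; simp only [hg, latticeDet, Prod.fst_sub, Prod.snd_sub]; ring
  have f1' : ∀ z, f (z - -x) = f z + 1 := by
    intro z; have := f1 (z + x); rw [add_sub_cancel_right] at this; rw [sub_neg_eq_add]; omega
  have g1' : ∀ z, g (z - -x) = g z := by
    intro z; have := g1 (z + x); rw [add_sub_cancel_right] at this; rw [sub_neg_eq_add]; omega
  have f2' : ∀ z, f (z - -y) = f z := by
    intro z; have := f2 (z + y); rw [add_sub_cancel_right] at this; rw [sub_neg_eq_add]; omega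
  have g2' : ∀ z, g (z - -y) = g z + 1 := by
    intro z; have := g2 (z + y); rw [add_sub_cancel_right] at this; rw [sub_neg_eq_add]; omega
  have b1 := card_image_le_card_boundary M x f g (fun z => by rw [f1]; omega) g1
  have b2 := card_image_le_card_boundary M (-x) (-f) g
    (fun z => by simp only [Pi.neg_apply]; rw [f1']; omega) g1'
  have b3 := card_image_le_card_boundary M y g f (fun z => by rw [g2]; omega) f2
  have b4 := card_image_le_card_boundary M (-y) (-g) f
    (fun z => by simp only [Pi.neg_apply]; rw [g2']; omega) f2'
  have hcard : M.card ≤ (M.image f).card * (M.image g).card := by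
    rw [← Finset.card_product]
    refine Finset.card_le_card_of_injOn (fun z => (f z, g z)) ?_ ?_
    · intro z hz
      exact Finset.mem_product.mpr ⟨Finset.mem_image_of_mem f hz, Finset.mem_image_of_mem g hz⟩
    · intro z _ w _ hzw
      obtain ⟨hzf, hzg⟩ := Prod.mk.inj hzw
      have hexp : ∀ z : LatticePoint, z = f z • x + g z • y := by
        intro z
        simp only [hf, hg]
        ext
        · simp only [latticeDet, Prod.smul_fst, Prod.fst_add, smul_eq_mul] at hD ⊢
          linear_combination (-z.1) * hD
        · simp only [latticeDet, Prod.smul_snd, Prod.snd_add, smul_eq_mul] at hD ⊢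
          linear_combination (-z.2) * hD
      rw [hexp z, hexp w, hzf, hzg]
  -- Each occupied row and each occupied column contributes two boundary sides. With |M| ≤ A B for
  -- the numbers A, B of occupied columns and rows, the bound follows from AB ≤ ((A + B)/2)².
  have hP : 2 * ((M.image f).card + (M.image g).card) ≤ (cellBoundary x y M).card := by
    rw [card_cellBoundary h]; omega
  have hP' : (2 : ℝ) * ((M.image f).card + (M.image g).card) ≤ (cellBoundary x y M).card := by
    exact_mod_cast hP
  have hcard' : (M.card : ℝ) ≤ (M.image f).card * (M.image g).card := by exact_mod_cast hcard
  refine le_trans ?_ hP'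
  have hA : (0 : ℝ) ≤ (M.image f).card := Nat.cast_nonneg _
  have hB : (0 : ℝ) ≤ (M.image g).card := Nat.cast_nonneg _
  generalize ((M.image f).card : ℝ) = A at *
  generalize ((M.image g).card : ℝ) = B at *
  have : Real.sqrt (M.card : ℝ) ≤ (A + B) / 2 := by
    apply Real.sqrt_le_iff.mpr
    constructor
    · positivity
    · nlinarith [sq_nonneg (A - B)]
  linarith

/-! ### The effect of a flop on the parities of edges -/

/-- `e` is a side of the parallelogram with diagonals `ij` and `αβ`. -/
def IsQuadSide (i j α β : LatticePoint) (e : Finset LatticePoint) : Prop :=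
  e = {i, α} ∨ e = {i, β} ∨ e = {j, α} ∨ e = {j, β}

lemma isQuadSide_swap {i j α β : LatticePoint} {e : Finset LatticePoint} :
    IsQuadSide α β i j e ↔ IsQuadSide i j α β e := by
  unfold IsQuadSide
  rw [Finset.pair_comm α i, Finset.pair_comm α j, Finset.pair_comm β i, Finset.pair_comm β j]
  tauto

lemma subset_triple_iff {a b c : LatticePoint} {e : Finset LatticePoint} (he : e.card = 2) :
    e ⊆ {a, b, c} ↔ (a ≠ b ∧ e = {a, b}) ∨ (c ≠ a ∧ e = {c, a}) ∨ (c ≠ b ∧ e = {c, b}) := by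
  obtain ⟨p, q, hpq, rfl⟩ := Finset.card_eq_two.mp he
  constructor
  · intro h
    have hp := mem_triple.mp (h (by simp : p ∈ _))
    have hq := mem_triple.mp (h (by simp : q ∈ _))
    rcases hp with rfl | rfl | rfl <;> rcases hq with rfl | rfl | rfl <;>
      first
        | exact absurd rfl hpq
        | exact Or.inl ⟨hpq, rfl⟩
        | exact Or.inl ⟨hpq.symm, Finset.pair_comm _ _⟩
        | exact Or.inr (Or.inl ⟨hpq, rfl⟩)
        | exact Or.inr (Or.inl ⟨hpq.symm, Finset.pair_comm _ _⟩)
        | exact Or.inr (Or.inr ⟨hpq, rfl⟩)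
        | exact Or.inr (Or.inr ⟨hpq.symm, Finset.pair_comm _ _⟩)
  · rintro (⟨-, h⟩ | ⟨-, h⟩ | ⟨-, h⟩) <;> rw [h] <;> intro x <;> simp <;> tauto

open scoped Classical in
/-- Two triangles with a common edge, modulo two, are bounded by the parallelogram. -/
lemma parity_quad {i j α β : LatticePoint} (hij : i ≠ j) (hαβ : α ≠ β) (h1 : i ≠ α) (h2 : i ≠ β)
    (h3 : j ≠ α) (h4 : j ≠ β) {e : Finset LatticePoint} (he : e.card = 2) :
    ((if e ⊆ {α, β, i} then 1 else 0) + (if e ⊆ {α, β, j} then 1 else 0) : ZMod 2) =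
      if IsQuadSide i j α β e then 1 else 0 := by
  simp only [subset_triple_iff he]
  have h11 : (1 : ZMod 2) + 1 = 0 := by decide
  by_cases hA : e = {α, β}
  · have hQ : ¬ IsQuadSide i j α β e := by
      have hi : i ∉ e := by rw [hA]; simp [h1, h2]
      have hj : j ∉ e := by rw [hA]; simp [h3, h4]
      rintro (h | h | h | h)
      · exact hi (by rw [h]; simp)
      · exact hi (by rw [h]; simp)
      · exact hj (by rw [h]; simp)
      · exact hj (by rw [h]; simp)
    rw [if_pos (Or.inl ⟨hαβ, hA⟩), if_pos (Or.inl ⟨hαβ, hA⟩), if_neg hQ, h11]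
  · by_cases hi : e = {i, α} ∨ e = {i, β}
    · have hQ : IsQuadSide i j α β e := by unfold IsQuadSide; tauto
      have hj : j ∉ e := by
        rcases hi with h | h <;> rw [h] <;> simp [h3, h4, hij.symm]
      have hj1 : e ≠ {j, α} := fun h => hj (by rw [h]; simp)
      have hj2 : e ≠ {j, β} := fun h => hj (by rw [h]; simp)
      rw [if_pos (by tauto), if_neg (by tauto), if_pos hQ, add_zero]
    · by_cases hj : e = {j, α} ∨ e = {j, β}
      · have hQ : IsQuadSide i j α β e := by unfold IsQuadSide; tauto
        rw [if_neg (by tauto), if_pos (by tauto), if_pos hQ, zero_add]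
      · have hQ : ¬ IsQuadSide i j α β e := by unfold IsQuadSide; tauto
        rw [if_neg (by tauto), if_neg (by tauto), if_neg hQ, zero_add]

/-- The form that changes its sign from the old to the new diagonal of a flop. -/
def flopForm (i j α : LatticePoint) : LatticePoint → ℤ := basisForm (i - α) (j - α)

namespace IsFlopQuad

variable {T : Finset (Finset LatticePoint)} {i j α β : LatticePoint}

lemma abs_det_sides (h : IsFlopQuad T i j α β) (hT : IsCombTriangulation T) :
    |latticeDet (i - α) (j - α)| = 1 := by
  rw [← (h.distinct hT).2.2.2.2]
  congr 1
  simp only [latticeDet, Prod.fst_sub, Prod.snd_sub]; ring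

lemma isBasisForm (h : IsFlopQuad T i j α β) (hT : IsCombTriangulation T) :
    IsBasisForm (flopForm i j α) :=
  ⟨_, _, h.abs_det_sides hT, rfl⟩

lemma new_sub (h : IsFlopQuad T i j α β) : β - α = (i - α) + (j - α) := by
  have : β = i + j - α := by rw [← h.add_eq]; abel
  rw [this]; abel

lemma old_sub : j - i = (j - α) - (i - α) := by abel

lemma flopForm_old (h : IsFlopQuad T i j α β) (hT : IsCombTriangulation T) :
    flopForm i j α (j - i) = -1 := by
  have hd := h.abs_det_sides hT
  rw [old_sub (α := α), flopForm]
  generalize i - α = u at *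
  generalize j - α = v at *
  have : latticeDet u v * latticeDet u v = 1 := by rw [← abs_mul_abs_self, hd, one_mul]
  rw [← this]
  simp only [basisForm, latticeDet, Prod.fst_sub, Prod.snd_sub]; ring

lemma flopForm_new (h : IsFlopQuad T i j α β) (hT : IsCombTriangulation T) :
    flopForm i j α (β - α) = 1 := by
  have hd := h.abs_det_sides hT
  rw [h.new_sub, flopForm]
  generalize i - α = u at *
  generalize j - α = v at *
  have : latticeDet u v * latticeDet u v = 1 := by rw [← abs_mul_abs_self, hd, one_mul]
  rw [← this]
  simp only [basisForm, latticeDet, Prod.fst_add, Prod.snd_add]; ring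

lemma isBeyond_left {Q : LatticePoint → ℤ} (hQ : IsBasisForm Q) :
    IsBeyond Q {i, j, α} ↔ 0 ≤ Q (j - i) ∧ 0 ≤ Q (i - α) ∧ 0 ≤ Q (j - α) := by
  rw [isBeyond_triple hQ, hQ.sub_comm α i, hQ.sub_comm α j]

lemma isBeyond_right (h : IsFlopQuad T i j α β) {Q : LatticePoint → ℤ} (hQ : IsBasisForm Q) :
    IsBeyond Q {i, j, β} ↔ 0 ≤ Q (j - i) ∧ 0 ≤ Q (i - α) ∧ 0 ≤ Q (j - α) := by
  have e : β = i + j - α := by rw [← h.add_eq]; abel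
  have e1 : β - i = j - α := by rw [e]; abel
  have e2 : β - j = i - α := by rw [e]; abel
  rw [isBeyond_triple hQ, e1, e2]; tauto

lemma isBeyond_new_left (h : IsFlopQuad T i j α β) {Q : LatticePoint → ℤ} (hQ : IsBasisForm Q) :
    IsBeyond Q {α, β, i} ↔ 0 ≤ Q (β - α) ∧ 0 ≤ Q (i - α) ∧ 0 ≤ Q (j - α) := by
  have e : β = i + j - α := by rw [← h.add_eq]; abel
  have e1 : β - i = j - α := by rw [e]; abel
  rw [isBeyond_triple hQ, hQ.sub_comm i β, e1]

lemma isBeyond_new_right (h : IsFlopQuad T i j α β) {Q : LatticePoint → ℤ} (hQ : IsBasisForm Q) :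
    IsBeyond Q {α, β, j} ↔ 0 ≤ Q (β - α) ∧ 0 ≤ Q (i - α) ∧ 0 ≤ Q (j - α) := by
  have e : β = i + j - α := by rw [← h.add_eq]; abel
  have e2 : β - j = i - α := by rw [e]; abel
  rw [isBeyond_triple hQ, hQ.sub_comm j β, e2]; tauto

/-- A flop preserves beyondness with respect to all forms except its own form up to sign. -/
lemma diagonals_nonneg_iff (h : IsFlopQuad T i j α β) (hT : IsCombTriangulation T)
    {Q : LatticePoint → ℤ} (hQ : IsBasisForm Q) (h1 : Q ≠ flopForm i j α)
    (h2 : Q ≠ -flopForm i j α) :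
    (0 ≤ Q (j - i) ∧ 0 ≤ Q (i - α) ∧ 0 ≤ Q (j - α)) ↔
      (0 ≤ Q (β - α) ∧ 0 ≤ Q (i - α) ∧ 0 ≤ Q (j - α)) := by
  have hd := h.abs_det_sides hT
  -- By the parallelogram law, if `Q` is nonnegative on the sides and negative on one diagonal, it
  -- is positive on the other; these signs determine `Q`.
  have hpar : Q ((i - α) + (j - α)) + Q ((j - α) - (i - α)) = 2 * Q (i - α) + 2 * Q (j - α) := by
    obtain ⟨x, y, -, rfl⟩ := hQ
    exact basisForm_parallelogram x y _ _
  rw [h.new_sub, old_sub (α := α)]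
  rw [flopForm] at h1 h2
  generalize i - α = u at *
  generalize j - α = v at *
  refine and_congr_left fun ⟨hu, hv⟩ => ?_
  constructor
  · intro h3
    by_contra! h4
    apply h2
    -- Replacing `u` by `-u` exchanges the two diagonals.
    rw [← basisForm_neg_left]
    refine hQ.eq_of_diagonals ?_ ?_ ?_
    · rw [← hd, ← abs_neg]; congr 1; simp only [latticeDet, Prod.fst_neg, Prod.snd_neg]; ring
    · rwa [sub_neg_eq_add, add_comm]
    · rw [neg_add_eq_sub]; omega
  · intro h3
    by_contra! h4
    apply h1
    exact hQ.eq_of_diagonals hd h4 (by omega)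

/-- Modulo two, removing triangles is the same as adding them. -/
lemma sum_flopSet (h : IsFlopQuad T i j α β) (hT : IsCombTriangulation T)
    (f : Finset LatticePoint → ZMod 2) :
    ∑ t ∈ flopSet T i j α β, f t =
      ∑ t ∈ T, f t + (f {i, j, α} + f {i, j, β}) + (f {α, β, i} + f {α, β, j}) := by
  obtain ⟨n1, n2, n3, n4, -⟩ := h.distinct hT
  have hne : ({i, j, α} : Finset LatticePoint) ≠ {i, j, β} := fun e =>
    h.ne' (triple_apex_eq n1 n3 e)
  have hne' : ({α, β, i} : Finset LatticePoint) ≠ {α, β, j} := fun e =>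
    h.ne (triple_apex_eq n1.symm n2.symm e)
  have hdis : Disjoint (T \ {{i, j, α}, {i, j, β}}) {{α, β, i}, {α, β, j}} := by
    rw [Finset.disjoint_left]
    intro t ht ht'
    apply h.not_mem_old hT (Finset.mem_sdiff.mp ht).1
    rw [Finset.mem_insert, Finset.mem_singleton] at ht'
    rcases ht' with rfl | rfl <;> simp
  have hsub : ({{i, j, α}, {i, j, β}} : Finset (Finset LatticePoint)) ⊆ T := by
    intro t ht
    rw [Finset.mem_insert, Finset.mem_singleton] at ht
    rcases ht with rfl | rfl
    · exact h.left
    · exact h.right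
  have hs := Finset.sum_sdiff (f := f) hsub
  rw [Finset.sum_pair hne] at hs
  rw [flopSet, Finset.sum_union hdis, Finset.sum_pair hne', ← hs, add_assoc (∑ _ ∈ _, _),
    CharTwo.add_self_eq_zero, add_zero]

open scoped Classical in
/-- The parity of the triangles at an edge, among those with a property that the flop preserves. -/
lemma parity_flopSet_of_iff (h : IsFlopQuad T i j α β) (hT : IsCombTriangulation T)
    (B : Finset LatticePoint → Prop) (h1 : B {i, j, α} ↔ B {i, j, β})
    (h2 : B {i, j, α} ↔ B {α, β, i}) (h3 : B {i, j, α} ↔ B {α, β, j})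
    {e : Finset LatticePoint} (he : e.card = 2) :
    ∑ t ∈ flopSet T i j α β, (if B t ∧ e ⊆ t then (1 : ZMod 2) else 0) =
      ∑ t ∈ T, (if B t ∧ e ⊆ t then (1 : ZMod 2) else 0) := by
  obtain ⟨n1, n2, n3, n4, -⟩ := h.distinct hT
  rw [h.sum_flopSet hT, ← h1, ← h2, ← h3]
  by_cases hB : B {i, j, α}
  · simp only [hB, true_and]
    rw [parity_quad h.ne h.ne' n1 n2 n3 n4 he,
      parity_quad h.ne' h.ne n1.symm n3.symm n2.symm n4.symm he, add_assoc]
    rw [if_congr isQuadSide_swap rfl rfl, CharTwo.add_self_eq_zero, add_zero]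
  · simp [hB]

open scoped Classical in
/-- The parity of the triangles beyond the form of the flop at an edge changes by the sides of the
parallelogram. -/
lemma parity_flopSet_flopForm (h : IsFlopQuad T i j α β) (hT : IsCombTriangulation T)
    {e : Finset LatticePoint} (he : e.card = 2) :
    ∑ t ∈ flopSet T i j α β,
        (if IsBeyond (flopForm i j α) t ∧ e ⊆ t then (1 : ZMod 2) else 0) =
      ∑ t ∈ T, (if IsBeyond (flopForm i j α) t ∧ e ⊆ t then (1 : ZMod 2) else 0) +
        if IsQuadSide i j α β e then 1 else 0 := by
  obtain ⟨n1, n2, n3, n4, -⟩ := h.distinct hT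
  have hQ := h.isBasisForm hT
  have b1 : ¬ IsBeyond (flopForm i j α) {i, j, α} := by
    rw [isBeyond_left hQ, h.flopForm_old hT]; omega
  have b2 : ¬ IsBeyond (flopForm i j α) {i, j, β} := by
    rw [h.isBeyond_right hQ, h.flopForm_old hT]; omega
  have b3 : IsBeyond (flopForm i j α) {α, β, i} :=
    isBeyond_of_pos hQ (h.new_unimodular hT (Or.inl rfl)) (p := α) (q := β) (by simp) (by simp)
      (by rw [h.flopForm_new hT]; norm_num)
  have b4 : IsBeyond (flopForm i j α) {α, β, j} :=
    isBeyond_of_pos hQ (h.new_unimodular hT (Or.inr rfl)) (p := α) (q := β) (by simp) (by simp)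
      (by rw [h.flopForm_new hT]; norm_num)
  rw [h.sum_flopSet hT]
  simp only [b1, b2, b3, b4, true_and, false_and, if_false, add_zero]
  rw [parity_quad h.ne h.ne' n1 n2 n3 n4 he]

end IsFlopQuad

/-! ### Runs of flops -/

/-- An edge other than the old diagonal is an edge of a triangle after the flop. -/
lemma IsFlopQuad.exists_mem_flopSet {T : Finset (Finset LatticePoint)} {i j α β : LatticePoint}
    (h : IsFlopQuad T i j α β) (hT : IsCombTriangulation T) {t : Finset LatticePoint} (ht : t ∈ T)
    {p q : LatticePoint} (hp : p ∈ t) (hq : q ∈ t) (hpq : p ≠ q)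
    (hne : ({p, q} : Finset LatticePoint) ≠ {i, j}) :
    ∃ t' ∈ flopSet T i j α β, p ∈ t' ∧ q ∈ t' := by
  by_cases hc : t = {i, j, α} ∨ t = {i, j, β}
  · obtain ⟨r, rfl, h1, h2, -⟩ := (hT.unimodular t ht).exists_apex hp hq hpq
    obtain ⟨r₀, hr₀, -⟩ := flop_new_old h.add_eq.symm hpq h1 h2 hc hne
    exact ⟨{p, q, r₀}, mem_flopSet.mpr (Or.inr hr₀), by simp, by simp⟩
  · exact ⟨t, mem_flopSet.mpr (Or.inl ⟨ht, by tauto⟩), hp, hq⟩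

lemma pair_eq_of_add_eq_of_sub_eq {a b c d : LatticePoint} (h : a + b = c + d)
    (h' : b - a = d - c ∨ b - a = -(d - c)) : ({a, b} : Finset LatticePoint) = {c, d} := by
  rcases h' with h' | h'
  · have hb : b = d := two_smul_injective (by
      have : b + b = (a + b) + (b - a) := by abel
      rw [this, h, h']; abel)
    subst hb
    rw [add_right_cancel h]
  · have hb : b = c := two_smul_injective (by
      have : b + b = (a + b) + (b - a) := by abel
      rw [this, h, h']; abel)
    subst hb
    rw [add_comm] at h
    rw [add_left_cancel h, Finset.pair_comm]

/-- Successive flops inside `R`, with names for the vertices of the parallelograms. -/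
structure IsFlopRun (T₀ R : Finset (Finset LatticePoint)) (n : ℕ)
    (T : ℕ → Finset (Finset LatticePoint)) (i j α β : ℕ → LatticePoint) : Prop where
  start : T 0 = T₀
  comb : ∀ k ≤ n, IsCombTriangulation (T k)
  quad : ∀ k < n, IsFlopQuad (T k) (i k) (j k) (α k) (β k)
  step : ∀ k < n, T (k + 1) = flopSet (T k) (i k) (j k) (α k) (β k)
  inside : ∀ k ≤ n, T₀ \ R ⊆ T k

lemma IsFlopSequence.exists_isFlopRun {T₀ R : Finset (Finset LatticePoint)} {n : ℕ}
    {T : ℕ → Finset (Finset LatticePoint)} {C C' : ℕ → Finset LatticePoint}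
    (h : IsFlopSequence T₀ R n T C C') (hT : IsCombTriangulation T₀) :
    ∃ i j α β : ℕ → LatticePoint, IsFlopRun T₀ R n T i j α β ∧
      ∀ k < n, C k = {i k, j k} ∧ C' k = {α k, β k} := by
  have hflop : ∀ k, ∃ i j α β : LatticePoint, k < n → C k = {i, j} ∧ C' k = {α, β} ∧
      IsFlopQuad (T k) i j α β ∧ T (k + 1) = flopSet (T k) i j α β := by
    intro k
    by_cases hk : k < n
    · obtain ⟨i, j, α, β, h1, h2, h3, h4, h5, h6, h7, h8⟩ := h.flop k hk
      exact ⟨i, j, α, β, fun _ => ⟨h1, h2, ⟨h3, h4, h5, h6, h7⟩, h8⟩⟩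
    · exact ⟨0, 0, 0, 0, fun h => absurd h hk⟩
  choose i j α β hf using hflop
  refine ⟨i, j, α, β, ⟨h.start, ?_, fun k hk => (hf k hk).2.2.1, fun k hk => (hf k hk).2.2.2,
    h.inside⟩, fun k hk => ⟨(hf k hk).1, (hf k hk).2.1⟩⟩
  intro k
  induction k with
  | zero => intro _; rw [h.start]; exact hT
  | succ k ih =>
    intro hk
    rw [(hf k hk).2.2.2]
    exact (hf k hk).2.2.1.isCombTriangulation (ih (by omega))

namespace IsFlopRun

variable {T₀ R : Finset (Finset LatticePoint)} {n : ℕ} {T : ℕ → Finset (Finset LatticePoint)}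
  {i j α β : ℕ → LatticePoint}

lemma comb_inner (h : IsFlopRun T₀ R n T i j α β) {k : ℕ} (hk : k ≤ n) :
    IsCombTriangulation (T k \ (T₀ \ R)) := (h.comb k hk).mono Finset.sdiff_subset

/-- A triangle at the old diagonal disappears in the flop, while outer triangles are kept; so both
triangles of the parallelogram are inner. -/
lemma quad_inner (h : IsFlopRun T₀ R n T i j α β) {k : ℕ} (hk : k < n) :
    IsFlopQuad (T k \ (T₀ \ R)) (i k) (j k) (α k) (β k) := by
  have hq := h.quad k hk
  have hout : ∀ t, i k ∈ t → j k ∈ t → t ∉ T₀ \ R := by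
    intro t h1 h2 ht
    have := h.inside (k + 1) hk ht
    rw [h.step k hk] at this
    exact hq.not_mem_new (h.comb k hk.le) this ⟨h1, h2⟩
  exact ⟨hq.ne, hq.ne', Finset.mem_sdiff.mpr ⟨hq.left, hout _ (by simp) (by simp)⟩,
    Finset.mem_sdiff.mpr ⟨hq.right, hout _ (by simp) (by simp)⟩, hq.add_eq⟩

/-- The new triangles are inner because the new diagonal was no edge before the flop. -/
lemma step_inner (h : IsFlopRun T₀ R n T i j α β) {k : ℕ} (hk : k < n) :
    T (k + 1) \ (T₀ \ R) = flopSet (T k \ (T₀ \ R)) (i k) (j k) (α k) (β k) := by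
  have hq := h.quad k hk
  have hout : ∀ t, α k ∈ t → β k ∈ t → t ∉ T₀ \ R := fun t h1 h2 ht =>
    hq.not_mem_old (h.comb k hk.le) (h.inside k hk.le ht) ⟨h1, h2⟩
  have o1 := hout {α k, β k, i k} (by simp) (by simp)
  have o2 := hout {α k, β k, j k} (by simp) (by simp)
  rw [h.step k hk]
  clear hout
  generalize T₀ \ R = O at *
  ext t
  rw [Finset.mem_sdiff, IsFlopQuad.mem_flopSet, IsFlopQuad.mem_flopSet,
    Finset.mem_sdiff]
  constructor
  · tauto
  · rintro (h | h | h)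
    · tauto
    · subst h; tauto
    · subst h; tauto

lemma inner_zero (h : IsFlopRun T₀ R n T i j α β) (hR : R ⊆ T₀) : T 0 \ (T₀ \ R) = R := by
  rw [h.start, Finset.sdiff_sdiff_eq_self hR]

/-- The form of the flop number `k`. -/
lemma isBasisForm (h : IsFlopRun T₀ R n T i j α β) {k : ℕ} (hk : k < n) :
    IsBasisForm (flopForm (i k) (j k) (α k)) := (h.quad k hk).isBasisForm (h.comb k hk.le)

/-- Edges with the same midpoint differ by twice a lattice vector, so the parity of the form is the
one at the flopped edge, where the value is -1. In particular the form does not vanish. -/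
lemma odd_of_midpoint (h : IsFlopRun T₀ R n T i j α β) {k : ℕ} (hk : k < n) {p q : LatticePoint}
    (hpq : p + q = i k + j k) : ∃ c : ℤ, flopForm (i k) (j k) (α k) (q - p) = 2 * c - 1 := by
  have h1 := (h.quad k hk).flopForm_old (h.comb k hk.le)
  have e : q - p = (j k - i k) + (i k - p) + (i k - p) := by
    rw [eq_sub_of_add_eq' hpq]; abel
  rw [e]
  rw [flopForm] at *
  generalize i k - α k = u at *
  generalize j k - α k = v at *
  generalize j k - i k = z at *
  generalize i k - p = w
  refine ⟨latticeDet z v * latticeDet u w + latticeDet w v * latticeDet u z +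
    2 * (latticeDet w v * latticeDet u w), ?_⟩
  simp only [basisForm, latticeDet, Prod.fst_add, Prod.snd_add] at *
  linear_combination h1

/-- The flop number `k` is the inverse of an earlier flop, when its form takes opposite signs on the
diagonals of that flop and the midpoints agree. -/
lemma inverse_of_signs (h : IsFlopRun T₀ R n T i j α β) {k l : ℕ} (hk : k < n) (hl : l < n)
    (hm : i l + j l = i k + j k) (h1 : 0 < flopForm (i k) (j k) (α k) (j l - i l))
    (h2 : flopForm (i k) (j k) (α k) (β l - α l) < 0) :
    ({i k, j k} : Finset LatticePoint) = {α l, β l} ∧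
      ({α k, β k} : Finset LatticePoint) = {i l, j l} := by
  have hd := (h.quad k hk).abs_det_sides (h.comb k hk.le)
  have hd' := (h.quad l hl).abs_det_sides (h.comb l hl.le)
  have a1 := (h.quad l hl).new_sub
  have a2 := (h.quad k hk).new_sub
  have b1 := IsFlopQuad.old_sub (i := i l) (j := j l) (α := α l)
  have b2 := IsFlopQuad.old_sub (i := i k) (j := j k) (α := α k)
  have c1 := (h.quad l hl).add_eq
  have c2 := (h.quad k hk).add_eq
  -- The sign change is opposite to that of the form of flop `l`, so one side is negated to exchange
  -- the diagonals.
  have key := basis_of_diagonals (u := -(i l - α l)) (v := j l - α l) hd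
    (by rw [← hd', ← abs_neg]; congr 1; simp only [latticeDet, Prod.fst_neg, Prod.snd_neg]; ring)
    (by rw [sub_neg_eq_add, add_comm, ← a1]; exact h2)
    (by rw [neg_add_eq_sub, ← b1]; exact h1)
  constructor
  · refine pair_eq_of_add_eq_of_sub_eq (by rw [c1, hm]) ?_
    rw [a1, b2]
    generalize i k - α k = x at *
    generalize j k - α k = y at *
    generalize i l - α l = z at *
    generalize j l - α l = w at *
    rcases key with ⟨h3, rfl⟩ | ⟨h3, rfl⟩ | ⟨h3, rfl⟩ | ⟨h3, rfl⟩ <;>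
      rw [neg_eq_iff_eq_neg] at h3 <;> subst h3
    · left; abel
    · right; abel
    · right; abel
    · left; abel
  · refine pair_eq_of_add_eq_of_sub_eq (by rw [c2, hm]) ?_
    rw [b1, a2]
    generalize i k - α k = x at *
    generalize j k - α k = y at *
    generalize i l - α l = z at *
    generalize j l - α l = w at *
    rcases key with ⟨h3, rfl⟩ | ⟨h3, rfl⟩ | ⟨h3, rfl⟩ | ⟨h3, rfl⟩ <;>
      rw [neg_eq_iff_eq_neg] at h3 <;> subst h3
    · left; abel
    · right; abel
    · left; abel
    · right; abel

/-- No flop of the run is the inverse of an earlier one. -/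
def NotUndone (n : ℕ) (i j α β : ℕ → LatticePoint) : Prop :=
  ∀ l k : ℕ, l < k → k < n → ¬ (({i k, j k} : Finset LatticePoint) = {α l, β l} ∧
    ({α k, β k} : Finset LatticePoint) = {i l, j l})

/-- Before the flop number `k` its form is negative on the edge at its midpoint. -/
lemma neg_of_midpoint (h : IsFlopRun T₀ R n T i j α β) (hu : NotUndone n i j α β) {k : ℕ}
    (hk : k < n) (d : ℕ) : ∀ l, l + d = k → ∀ t ∈ T l, ∀ p ∈ t, ∀ q ∈ t, p ≠ q →
      p + q = i k + j k → flopForm (i k) (j k) (α k) (q - p) < 0 := by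
  have hQ := h.isBasisForm hk
  -- Backwards in time from flop `k`, where the value is -1.
  induction d with
  | zero =>
    rintro l rfl t ht p hp q hq hpq hm
    have hq' := h.quad l hk
    have h1 := hq'.flopForm_old (h.comb l hk.le)
    rcases (h.comb l hk.le).midpoint t ht _ hq'.left p hp q hq (i l) (by simp) (j l) (by simp)
      hpq hq'.ne hm with rfl | rfl
    · have := add_left_cancel hm
      subst this
      simp only [add_zero] at *
      omega
    · rw [add_comm] at hm
      have := add_right_cancel hm
      subst this
      rw [hQ.sub_comm]
      simp only [add_zero] at *
      omega
  | succ d ih =>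
    intro l hl t ht p hp q hq hpq hm
    have hln : l < n := by omega
    have hlq := h.quad l hln
    have hlc := h.comb l hln.le
    by_cases hne : ({p, q} : Finset LatticePoint) = {i l, j l}
    · have hml : i l + j l = i k + j k := by
        rw [← hm]
        rcases pair_eq_cases hne with ⟨rfl, rfl⟩ | ⟨rfl, rfl⟩
        · rfl
        · exact add_comm _ _
      have hval : flopForm (i k) (j k) (α k) (q - p) =
          flopForm (i k) (j k) (α k) (j l - i l) := by
        rcases pair_eq_cases hne with ⟨rfl, rfl⟩ | ⟨rfl, rfl⟩
        · rfl
        · exact hQ.sub_comm _ _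
      have hnew := ih (l + 1) (by omega) {α l, β l, i l}
        (by rw [h.step l hln]; exact IsFlopQuad.mem_flopSet.mpr (Or.inr (Or.inl rfl)))
        (α l) (by simp) (β l) (by simp) hlq.ne' (by rw [hlq.add_eq, hml])
      -- The value is odd, so if not negative it is positive. Then flop `l` makes the form change
      -- from positive to negative at this midpoint, and flop `k` is its inverse.
      obtain ⟨c, hc⟩ := h.odd_of_midpoint hk hm
      by_contra! hcon
      exact hu l k (by omega) hk (h.inverse_of_signs hk hln hml (by omega) hnew)
    · obtain ⟨t', ht', hp', hq'⟩ := hlq.exists_mem_flopSet hlc ht hp hq hpq hne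
      rw [← h.step l hln] at ht'
      exact ih (l + 1) (by omega) t' ht' p hp' q hq' hpq hm

/-- At each time before the flop number `k` there is an inner edge at its midpoint. -/
lemma exists_midpoint (h : IsFlopRun T₀ R n T i j α β) {k : ℕ}
    (hk : k < n) (d : ℕ) : ∀ l, l + d = k → ∃ t ∈ T l \ (T₀ \ R), ∃ p ∈ t, ∃ q ∈ t, p ≠ q ∧
      p + q = i k + j k := by
  induction d with
  | zero =>
    rintro l rfl
    have hq := h.quad_inner hk
    exact ⟨_, hq.left, i l, by simp, j l, by simp, hq.ne, rfl⟩
  | succ d ih =>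
    intro l hl
    obtain ⟨t, ht, p, hp, q, hq, hpq, hm⟩ := ih (l + 1) (by omega)
    have hln : l < n := by omega
    have hlq := h.quad_inner hln
    rw [h.step_inner hln] at ht
    rcases hlq.midpoint_new (h.comb_inner hln.le) ht hp hq hpq with hne | ⟨-, t', ht', hp', hq'⟩
    · refine ⟨_, hlq.left, i l, by simp, j l, by simp, hlq.ne, ?_⟩
      rw [← hm, ← hlq.add_eq]
      rcases pair_eq_cases hne with ⟨rfl, rfl⟩ | ⟨rfl, rfl⟩
      · rfl
      · exact add_comm _ _
    · exact ⟨t', ht', p, hp', q, hq', hpq, hm⟩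

end IsFlopRun

/-- All triangles of a regular tessellation have the same edge vectors up to sign, and beyondness
depends on nothing else. -/
lemma IsRegularRegion.isBeyond_iff {T R : Finset (Finset LatticePoint)} (hR : IsRegularRegion T R)
    {Q : LatticePoint → ℤ} (hQ : IsBasisForm Q) {t t' : Finset LatticePoint} (ht : t ∈ R)
    (ht' : t' ∈ R) : IsBeyond Q t ↔ IsBeyond Q t' := by
  obtain ⟨a, b, -, hab⟩ := hR.tessellation
  have key : ∀ t ∈ R, (IsBeyond Q t ↔ 0 ≤ Q a ∧ 0 ≤ Q b ∧ 0 ≤ Q (b - a)) := by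
    intro t ht
    obtain ⟨p, rfl | rfl⟩ := hab t ht
    · rw [isBeyond_triple hQ, add_sub_cancel_left, add_sub_cancel_left, add_sub_add_left_eq_sub]
    · rw [isBeyond_triple hQ, add_sub_add_left_eq_sub, add_sub_cancel_left,
        show p + a + b - (p + b) = a by abel]
      tauto
  rw [key t ht, key t' ht']

namespace IsFlopRun

variable {T₀ R : Finset (Finset LatticePoint)} {n : ℕ} {T : ℕ → Finset (Finset LatticePoint)}
  {i j α β : ℕ → LatticePoint}

/-- Some triangle of `R` has an edge at the midpoint of the flop, where the form is negative at the
start; the other triangles of `R` are on the same side. -/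
lemma not_isBeyond_start (h : IsFlopRun T₀ R n T i j α β) (hu : NotUndone n i j α β)
    (hR : IsRegularRegion T₀ R) {k : ℕ} (hk : k < n) {t : Finset LatticePoint} (ht : t ∈ R) :
    ¬ IsBeyond (flopForm (i k) (j k) (α k)) t := by
  obtain ⟨t', ht', p, hp, q, hq, hpq, hm⟩ := h.exists_midpoint hk k 0 (zero_add k)
  have hneg := h.neg_of_midpoint hu hk k 0 (zero_add k) t' (Finset.mem_sdiff.mp ht').1 p hp q hq
    hpq hm
  rw [h.inner_zero hR.subset] at ht'
  rw [hR.isBeyond_iff (h.isBasisForm hk) ht ht']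
  intro hb
  exact absurd (hb q hq p hp) (not_le.mpr hneg)

/-- A triangle of `R` is beyond one of two opposite forms. Without this, a Farey edge could be
counted twice at one curve. -/
lemma form_ne_neg (h : IsFlopRun T₀ R n T i j α β) (hu : NotUndone n i j α β)
    (hR : IsRegularRegion T₀ R) {k l : ℕ} (hk : k < n) (hl : l < n) :
    flopForm (i l) (j l) (α l) ≠ -flopForm (i k) (j k) (α k) := by
  intro he
  obtain ⟨t', ht', -⟩ := h.exists_midpoint hk k 0 (zero_add k)
  have hut := (h.comb_inner (Nat.zero_le n)).unimodular t' ht'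
  rw [h.inner_zero hR.subset] at ht'
  rcases isBeyond_or_isBeyond_neg (h.isBasisForm hk) hut with hb | hb
  · exact h.not_isBeyond_start hu hR hk ht' hb
  · rw [← he] at hb
    exact h.not_isBeyond_start hu hR hl ht' hb

/-- The common form would be +1 at the shared midpoint after flop `l`, but negative there until flop
`k`. -/
lemma midpoint_ne (h : IsFlopRun T₀ R n T i j α β) (hu : NotUndone n i j α β) {k l : ℕ}
    (hlk : l < k) (hk : k < n)
    (he : flopForm (i l) (j l) (α l) = flopForm (i k) (j k) (α k)) : i l + j l ≠ i k + j k := by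
  intro hm
  have hln : l < n := hlk.trans hk
  have hlq := h.quad l hln
  have h1 := hlq.flopForm_new (h.comb l hln.le)
  have h2 := h.neg_of_midpoint hu hk (k - (l + 1)) (l + 1) (by omega) {α l, β l, i l}
    (by rw [h.step l hln]; exact IsFlopQuad.mem_flopSet.mpr (Or.inr (Or.inl rfl)))
    (α l) (by simp) (β l) (by simp) hlq.ne' (by rw [hlq.add_eq, hm])
  rw [← he] at h2
  omega

end IsFlopRun

/-! ### The lower bound -/

/-- The form determines the sides of the parallelogram up to order and a common sign. The point `z`
is `α` or `β`, whichever corner the sides leave in the directions `x, y`. -/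
lemma exists_cell_of_flopForm_eq {i j α β x y : LatticePoint} (hxy : |latticeDet x y| = 1)
    (hd : |latticeDet (i - α) (j - α)| = 1) (h : α + β = i + j)
    (hf : flopForm i j α = basisForm x y) :
    ∃ z, i + j = z + z + (x + y) ∧ ∀ e, IsQuadSide i j α β e ↔ IsCellSide x y z e := by
  have h2 : latticeDet (i - α) (j - α) * latticeDet (i - α) (j - α) = 1 := by
    rw [← abs_mul_abs_self, hd, one_mul]
  have v1 : basisForm x y ((j - α) - (i - α)) < 0 := by
    rw [← hf, flopForm]
    generalize i - α = u at *
    generalize j - α = v at *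
    simp only [basisForm, latticeDet, Prod.fst_sub, Prod.snd_sub] at *
    linarith
  have v2 : 0 < basisForm x y ((i - α) + (j - α)) := by
    rw [← hf, flopForm]
    generalize i - α = u at *
    generalize j - α = v at *
    simp only [basisForm, latticeDet, Prod.fst_add, Prod.snd_add] at *
    linarith
  have hβ : β = i + j - α := by rw [← h]; abel
  rcases basis_of_diagonals hxy hd v1 v2 with ⟨h1, h2⟩ | ⟨h1, h2⟩ | ⟨h1, h2⟩ | ⟨h1, h2⟩
  · refine ⟨α, by rw [← h1, ← h2]; abel, fun e => ?_⟩
    have e1 : i = α + x := by rw [← h1]; abel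
    have e2 : j = α + y := by rw [← h2]; abel
    have e3 : β = α + x + y := by rw [hβ, e1, e2]; abel
    have e4 : β = α + y + x := by rw [e3]; abel
    unfold IsQuadSide IsCellSide
    rw [← e3, ← e4, ← e1, ← e2, Finset.pair_comm α j, Finset.pair_comm α i]; tauto
  · refine ⟨β, ?_, fun e => ?_⟩
    · rw [hβ, ← neg_neg x, ← neg_neg y, ← h1, ← h2]; abel
    have e1 : j = β + x := by rw [hβ, ← neg_neg x, ← h1]; abel
    have e2 : i = β + y := by rw [hβ, ← neg_neg y, ← h2]; abel
    have e3 : α = β + x + y := by rw [← e1, ← neg_neg y, ← h2]; abel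
    have e4 : α = β + y + x := by rw [e3]; abel
    unfold IsQuadSide IsCellSide
    rw [← e3, ← e4, ← e1, ← e2, Finset.pair_comm β j, Finset.pair_comm β i]; tauto
  · refine ⟨α, by rw [← h1, ← h2]; abel, fun e => ?_⟩
    have e1 : j = α + x := by rw [← h2]; abel
    have e2 : i = α + y := by rw [← h1]; abel
    have e3 : β = α + x + y := by rw [hβ, e1, e2]; abel
    have e4 : β = α + y + x := by rw [e3]; abel
    unfold IsQuadSide IsCellSide
    rw [← e3, ← e4, ← e1, ← e2, Finset.pair_comm α j, Finset.pair_comm α i]; tauto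
  · refine ⟨β, ?_, fun e => ?_⟩
    · rw [hβ, ← neg_neg x, ← neg_neg y, ← h1, ← h2]; abel
    have e1 : i = β + x := by rw [hβ, ← neg_neg x, ← h2]; abel
    have e2 : j = β + y := by rw [hβ, ← neg_neg y, ← h1]; abel
    have e3 : α = β + x + y := by rw [← e1, ← neg_neg y, ← h1]; abel
    have e4 : α = β + y + x := by rw [e3]; abel
    unfold IsQuadSide IsCellSide
    rw [← e3, ← e4, ← e1, ← e2, Finset.pair_comm β j, Finset.pair_comm β i]; tauto

/-- The point reflection at the midpoint of an edge preserves the edge vectors up to sign. -/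
lemma isBeyond_iff_of_add_eq {Q : LatticePoint → ℤ} (hQ : IsBasisForm Q) {a b δ δ' : LatticePoint}
    (hs : δ + δ' = a + b) : IsBeyond Q {a, b, δ} ↔ IsBeyond Q {a, b, δ'} := by
  have e : δ' = a + b - δ := by rw [← hs]; abel
  have e1 : δ' - a = b - δ := by rw [e]; abel
  have e2 : δ' - b = a - δ := by rw [e]; abel
  rw [isBeyond_triple hQ, isBeyond_triple hQ, e1, e2, hQ.sub_comm b δ, hQ.sub_comm a δ]
  tauto

lemma Real.sqrt_sum_le_sum_sqrt {ι : Type*} (s : Finset ι) (f : ι → ℝ) (hf : ∀ i ∈ s, 0 ≤ f i) :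
    Real.sqrt (∑ i ∈ s, f i) ≤ ∑ i ∈ s, Real.sqrt (f i) := by
  apply Real.sqrt_le_iff.mpr
  refine ⟨Finset.sum_nonneg fun i _ => Real.sqrt_nonneg _, ?_⟩
  calc ∑ i ∈ s, f i = ∑ i ∈ s, Real.sqrt (f i) ^ 2 :=
        Finset.sum_congr rfl fun i hi => (Real.sq_sqrt (hf i hi)).symm
    _ ≤ _ := Finset.sum_sq_le_sq_sum_of_nonneg fun i _ => Real.sqrt_nonneg _

namespace IsFlopRun

variable {T₀ R : Finset (Finset LatticePoint)} {n : ℕ} {T : ℕ → Finset (Finset LatticePoint)}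
  {i j α β : ℕ → LatticePoint}

open scoped Classical in
-- A flop with form `Q` brings two triangles beyond `Q`, which modulo two changes the count at the
-- sides of its cell. Flops with other forms change nothing; the form `-Q` is excluded by
-- assumption.
lemma parity_inner (h : IsFlopRun T₀ R n T i j α β) (hR : R ⊆ T₀) {Q : LatticePoint → ℤ}
    (hQ : IsBasisForm Q) (hneg : ∀ l < n, Q ≠ -flopForm (i l) (j l) (α l))
    (hstart : ∀ t ∈ R, ¬ IsBeyond Q t) {e : Finset LatticePoint} (he : e.card = 2) :
    ∀ k ≤ n, ∑ t ∈ T k \ (T₀ \ R), (if IsBeyond Q t ∧ e ⊆ t then (1 : ZMod 2) else 0) =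
      ∑ l ∈ (Finset.range k).filter (fun l => flopForm (i l) (j l) (α l) = Q),
        if IsQuadSide (i l) (j l) (α l) (β l) e then 1 else 0 := by
  intro k
  induction k with
  | zero =>
    intro _
    rw [h.inner_zero hR, Finset.range_zero, Finset.filter_empty, Finset.sum_empty]
    exact Finset.sum_eq_zero fun t ht => if_neg fun hc => hstart t ht hc.1
  | succ k ih =>
    intro hk
    have hq := h.quad_inner hk
    have hc := h.comb_inner (Nat.le_of_lt hk)
    rw [h.step_inner hk, Finset.range_add_one, Finset.filter_insert]
    by_cases hkQ : flopForm (i k) (j k) (α k) = Q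
    · rw [if_pos hkQ, Finset.sum_insert (by simp), ← ih (by omega), add_comm, ← hkQ]
      exact hq.parity_flopSet_flopForm hc he
    · rw [if_neg hkQ, ← ih (by omega)]
      have hd := hq.diagonals_nonneg_iff hc hQ (Ne.symm hkQ) (hneg k hk)
      refine hq.parity_flopSet_of_iff hc _ ?_ ?_ ?_ he
      · rw [IsFlopQuad.isBeyond_left hQ, hq.isBeyond_right hQ]
      · rw [IsFlopQuad.isBeyond_left hQ, hq.isBeyond_new_left hQ, hd]
      · rw [IsFlopQuad.isBeyond_left hQ, hq.isBeyond_new_right hQ, hd]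

lemma parity_inner_all (h : IsFlopRun T₀ R n T i j α β) (hR : R ⊆ T₀)
    {e : Finset LatticePoint} (he : e.card = 2) :
    ∀ k ≤ n, ∑ t ∈ T k \ (T₀ \ R), (if e ⊆ t then (1 : ZMod 2) else 0) =
      ∑ t ∈ R, if e ⊆ t then 1 else 0 := by
  classical
  intro k
  induction k with
  | zero => intro _; rw [h.inner_zero hR]
  | succ k ih =>
    intro hk
    have hq := h.quad_inner hk
    have hc := h.comb_inner (Nat.le_of_lt hk)
    have := hq.parity_flopSet_of_iff hc (fun _ => True) Iff.rfl Iff.rfl Iff.rfl he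
    simp only [true_and] at this
    rw [h.step_inner hk, ← ih (by omega)]
    convert this

open scoped Classical in
/-- For the form `Q = basisForm x y` of a flop, the number of triangles beyond `Q` at an edge is
computed by the cells of the flops with form `Q`. -/
lemma exists_cells (h : IsFlopRun T₀ R n T i j α β) (hu : NotUndone n i j α β)
    {x y : LatticePoint} (hxy : |latticeDet x y| = 1) :
    ∃ M : Finset LatticePoint, M.card =
        ((Finset.range n).filter (fun l => flopForm (i l) (j l) (α l) = basisForm x y)).card ∧
      (∀ z ∈ M, ∃ l < n, i l + j l = z + z + (x + y)) ∧
      ∀ e, ∑ l ∈ (Finset.range n).filter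
          (fun l => flopForm (i l) (j l) (α l) = basisForm x y),
        (if IsQuadSide (i l) (j l) (α l) (β l) e then (1 : ZMod 2) else 0) =
          sideParity x y M e := by
  have hz : ∀ l, ∃ z, l < n → flopForm (i l) (j l) (α l) = basisForm x y →
      i l + j l = z + z + (x + y) ∧
        ∀ e, IsQuadSide (i l) (j l) (α l) (β l) e ↔ IsCellSide x y z e := by
    intro l
    by_cases hl : l < n ∧ flopForm (i l) (j l) (α l) = basisForm x y
    · obtain ⟨z, hz⟩ := exists_cell_of_flopForm_eq hxy
        ((h.quad l hl.1).abs_det_sides (h.comb l hl.1.le)) (h.quad l hl.1).add_eq hl.2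
      exact ⟨z, fun _ _ => hz⟩
    · exact ⟨0, fun h1 h2 => absurd ⟨h1, h2⟩ hl⟩
  choose z hz using hz
  -- Flops with the same cell have the same midpoint, which `midpoint_ne` forbids for different
  -- flops of equal form.
  have hinj : Set.InjOn z ((Finset.range n).filter
      (fun l => flopForm (i l) (j l) (α l) = basisForm x y)) := by
    intro l hl k hk hlk
    rw [Finset.mem_coe, Finset.mem_filter, Finset.mem_range] at hl hk
    have hm : i l + j l = i k + j k := by
      rw [(hz l hl.1 hl.2).1, (hz k hk.1 hk.2).1, hlk]
    rcases lt_trichotomy l k with hc | hc | hc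
    · exact absurd hm (h.midpoint_ne hu hc hk.1 (hl.2.trans hk.2.symm))
    · exact hc
    · exact absurd hm.symm (h.midpoint_ne hu hc hl.1 (hk.2.trans hl.2.symm))
  refine ⟨_, Finset.card_image_of_injOn hinj, ?_, fun e => ?_⟩
  · intro w hw
    obtain ⟨l, hl, rfl⟩ := Finset.mem_image.mp hw
    rw [Finset.mem_filter, Finset.mem_range] at hl
    exact ⟨l, hl.1, (hz l hl.1 hl.2).1⟩
  · rw [sideParity, Finset.sum_image hinj]
    refine Finset.sum_congr rfl fun l hl => ?_
    rw [Finset.mem_filter, Finset.mem_range] at hl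
    exact if_congr ((hz l hl.1 hl.2).2 e) rfl rfl

/-- The edge `pq` of `T` is separated by `Q`. -/
def _root_.IsSeparatedBy (T : Finset (Finset LatticePoint)) (Q : LatticePoint → ℤ)
    (e : Finset LatticePoint) : Prop :=
  ∃ p q γ γ', e = {p, q} ∧ p ≠ q ∧ {p, q, γ} ∈ T ∧ {p, q, γ'} ∈ T ∧
    IsBeyond Q {p, q, γ} ∧ ¬ IsBeyond Q {p, q, γ'}

lemma _root_.IsCombTriangulation.card_filter_edge {T : Finset (Finset LatticePoint)}
    (hT : IsCombTriangulation T) {p q γ γ' : LatticePoint} (hpq : p ≠ q) (h1 : {p, q, γ} ∈ T)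
    (h2 : {p, q, γ'} ∈ T) (hne : γ ≠ γ') (P : Finset LatticePoint → Prop) [DecidablePred P] :
    ∑ t ∈ T, (if P t ∧ {p, q} ⊆ t then (1 : ZMod 2) else 0) =
      (if P {p, q, γ} then 1 else 0) + (if P {p, q, γ'} then 1 else 0) := by
  obtain ⟨n1, n2, -⟩ := hT.ne_and_abs_det hpq h1
  have hne' : ({p, q, γ} : Finset LatticePoint) ≠ {p, q, γ'} := fun e =>
    hne (triple_apex_eq n1 n2 e)
  have hsub : ({{p, q, γ}, {p, q, γ'}} : Finset (Finset LatticePoint)) ⊆ T := by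
    intro t ht
    rw [Finset.mem_insert, Finset.mem_singleton] at ht
    rcases ht with rfl | rfl <;> assumption
  have hpair : ∀ r, ({p, q} : Finset LatticePoint) ⊆ {p, q, r} := by
    intro r x; simp; tauto
  rw [← Finset.sum_subset hsub, Finset.sum_pair hne']
  · simp [hpair]
  · intro t ht htn
    refine if_neg fun hc => htn ?_
    obtain ⟨r, rfl, -⟩ := (hT.unimodular t ht).exists_apex (hc.2 (by simp : p ∈ _))
      (hc.2 (by simp : q ∈ _)) hpq
    rcases hT.apex_or hpq h1 h2 hne ht with rfl | rfl <;> simp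

/-- The outer triangle at an edge with only one inner triangle is the mirror image of a triangle
of `R`. -/
lemma outer_neighbor (h : IsFlopRun T₀ R n T i j α β) (hR : IsRegularRegion T₀ R)
    {p q γ : LatticePoint} (hpq : p ≠ q) (ht : {p, q, γ} ∈ T n \ (T₀ \ R))
    (hone : ∀ γ', {p, q, γ'} ∈ T n \ (T₀ \ R) → γ' = γ) :
    ∃ δ, {p, q, δ} ∈ T₀ \ R ∧ ∃ δ', {p, q, δ'} ∈ R ∧ δ + δ' = p + q := by
  have hci := h.comb_inner le_rfl
  have hT₀ : IsCombTriangulation T₀ := by rw [← h.start]; exact h.comb 0 (Nat.zero_le n)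
  have he : ({p, q} : Finset LatticePoint).card = 2 := Finset.card_pair hpq
  have hpair : ∀ r, ({p, q} : Finset LatticePoint) ⊆ {p, q, r} := by
    intro r x; simp; tauto
  -- The parity of the inner triangles at an edge is invariant. One inner triangle at the end means
  -- an odd number at the start: exactly one of the two triangles of `T₀` at this edge is in `R`.
  have hall := h.parity_inner_all hR.subset he n le_rfl
  rw [Finset.sum_eq_single_of_mem _ ht, if_pos (hpair γ)] at hall
  swap
  · intro s hs hst
    refine if_neg fun hsub => hst ?_
    obtain ⟨r, rfl, -⟩ := (hci.unimodular s hs).exists_apex (hsub (by simp : p ∈ _))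
      (hsub (by simp : q ∈ _)) hpq
    rw [hone r hs]
  obtain ⟨r, hr, hsr⟩ : ∃ r ∈ R, {p, q} ⊆ r := by
    by_contra! hcon
    rw [Finset.sum_eq_zero fun t ht => if_neg (hcon t ht)] at hall
    exact absurd hall (by decide)
  obtain ⟨c, rfl, -⟩ := (hT₀.unimodular r (hR.subset hr)).exists_apex
    (hsr (by simp : p ∈ _)) (hsr (by simp : q ∈ _)) hpq
  obtain ⟨δ, δ', d1, d2, d3, d4⟩ : ∃ δ δ', {p, q, δ} ∈ T₀ ∧ {p, q, δ'} ∈ T₀ ∧ δ ≠ δ' ∧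
      δ + δ' = p + q := by
    obtain ⟨a, b, hab, -, δ, δ', d1, d2, d3, d4⟩ :=
      isCurveOfType_iff.mp (hR.curves _ hr _ hsr he)
    rcases pair_eq_cases hab with ⟨rfl, rfl⟩ | ⟨rfl, rfl⟩
    · exact ⟨δ, δ', d1, d2, d3, by rw [d4]; simp⟩
    · exact ⟨δ, δ', by rwa [triple_swap], by rwa [triple_swap], d3,
        by rw [d4]; simp [add_comm]⟩
  have hnot : ¬ ({p, q, δ} ∈ R ∧ {p, q, δ'} ∈ R) := by
    rintro ⟨r1, r2⟩
    have := (hT₀.mono hR.subset).card_filter_edge hpq r1 r2 d3 (fun _ => True)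
    simp only [true_and, if_true] at this
    rw [this] at hall
    exact absurd hall (by decide)
  rcases hT₀.apex_or hpq d1 d2 d3 (hR.subset hr) with rfl | rfl
  · exact ⟨δ', Finset.mem_sdiff.mpr ⟨d2, by tauto⟩, c, hr, by rw [add_comm, d4]⟩
  · exact ⟨δ, Finset.mem_sdiff.mpr ⟨d1, by tauto⟩, c, hr, d4⟩

open scoped Classical in
/-- An edge with an odd number of inner triangles beyond `Q` is separated by `Q`. -/
lemma isSeparatedBy_of_parity (h : IsFlopRun T₀ R n T i j α β) (hR : IsRegularRegion T₀ R)
    {Q : LatticePoint → ℤ} (hQ : IsBasisForm Q) (hstart : ∀ t ∈ R, ¬ IsBeyond Q t)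
    {e : Finset LatticePoint} (he : e.card = 2)
    (hodd : ∑ t ∈ T n \ (T₀ \ R), (if IsBeyond Q t ∧ e ⊆ t then (1 : ZMod 2) else 0) = 1) :
    e ∈ toricCurves (T n) \ toricCurves (T₀ \ R) ∧ IsSeparatedBy (T n) Q e := by
  have hc := h.comb n le_rfl
  have hci := h.comb_inner le_rfl
  have hO := h.inside n le_rfl
  obtain ⟨t, ht, hbt, het⟩ : ∃ t ∈ T n \ (T₀ \ R), IsBeyond Q t ∧ e ⊆ t := by
    by_contra! hcon
    rw [Finset.sum_eq_zero fun t ht => if_neg fun hc => hcon t ht hc.1 hc.2] at hodd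
    exact absurd hodd (by decide)
  obtain ⟨p, q, hpq, rfl⟩ := Finset.card_eq_two.mp he
  obtain ⟨γ, rfl, n1, n2, -⟩ := (hci.unimodular t ht).exists_apex (het (by simp : p ∈ _))
    (het (by simp : q ∈ _)) hpq
  have htT := (Finset.mem_sdiff.mp ht).1
  have htO := (Finset.mem_sdiff.mp ht).2
  -- If the neighbour is inner, it is not beyond `Q` by parity. If it is outer, it is the reflection
  -- of a triangle of `R`.
  obtain ⟨γ', hγ', hne, hb'⟩ : ∃ γ', {p, q, γ'} ∈ T n ∧ γ ≠ γ' ∧ ¬ IsBeyond Q {p, q, γ'} := by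
    by_cases hin : ∃ γ', {p, q, γ'} ∈ T n \ (T₀ \ R) ∧ γ ≠ γ'
    · obtain ⟨γ', hγ', hne⟩ := hin
      refine ⟨γ', (Finset.mem_sdiff.mp hγ').1, hne, fun hb' => ?_⟩
      rw [hci.card_filter_edge hpq ht hγ' hne, if_pos hbt, if_pos hb'] at hodd
      exact absurd hodd (by decide)
    · push Not at hin
      obtain ⟨δ, hδ, δ', hδ', hs⟩ := h.outer_neighbor hR hpq ht fun γ' hγ' => (hin γ' hγ').symm
      refine ⟨δ, hO hδ, ?_, ?_⟩
      · rintro rfl; exact htO hδ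
      · rw [isBeyond_iff_of_add_eq hQ hs]
        exact hstart _ hδ'
  refine ⟨Finset.mem_sdiff.mpr ⟨?_, fun hcon => ?_⟩, p, q, γ, γ', rfl, hpq, htT, hγ', hbt, hb'⟩
  · obtain ⟨s, hs, -⟩ := hc.hasShift hpq htT hγ' hne
    exact hc.mem_toricCurves.mpr ⟨p, q, s, rfl, hs⟩
  · obtain ⟨a, b, s, hab, hne', δ, δ', d1, d2, d3, -⟩ := (hc.mono hO).mem_toricCurves.mp hcon
    have hswap : ∀ r, ({p, q, r} : Finset LatticePoint) = {a, b, r} := by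
      intro r
      rcases pair_eq_cases hab with ⟨rfl, rfl⟩ | ⟨rfl, rfl⟩
      · rfl
      · exact triple_swap _ _ _
    rw [hswap] at htT htO
    rcases hc.apex_or hne' (hO d1) (hO d2) d3 htT with rfl | rfl <;> contradiction

/-- The lower bound for the number of a run of flops, none of which is undone. -/
lemma lower_bound (h : IsFlopRun T₀ R n T i j α β) (hu : NotUndone n i j α β)
    (hR : IsRegularRegion T₀ R) :
    4 * Real.sqrt n ≤ ((∑ e ∈ toricCurves (T n) \ toricCurves (T₀ \ R),
      curveNumber (T n) e : ℕ) : ℝ) := by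
  classical
  set F : ℕ → LatticePoint → ℤ := fun l => flopForm (i l) (j l) (α l) with hF
  set Θ : Finset (LatticePoint → ℤ) := (Finset.range n).image F with hΘ
  set E := toricCurves (T n) \ toricCurves (T₀ \ R) with hE
  have hc := h.comb n le_rfl
  have hmemΘ : ∀ Q ∈ Θ, ∃ l < n, Q = F l := by
    intro Q hQ
    obtain ⟨l, hl, rfl⟩ := Finset.mem_image.mp hQ
    exact ⟨l, Finset.mem_range.mp hl, rfl⟩
  -- `Θ` contains no two opposite forms, so the separating forms count different Farey edges.
  have hcurve : ∀ e ∈ E, (Θ.filter (fun Q => IsSeparatedBy (T n) Q e)).card ≤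
      curveNumber (T n) e := by
    intro e he
    obtain ⟨p, q, s, rfl, hs⟩ := hc.mem_toricCurves.mp (Finset.mem_sdiff.mp he).1
    rw [hc.curveNumber_eq hs]
    refine card_le_of_separates hc hs _ fun Q hQ => ?_
    rw [Finset.mem_filter] at hQ
    obtain ⟨hQ, a, b, γ, γ', hab, -, h1, h2, h3, h4⟩ := hQ
    obtain ⟨l, hl, rfl⟩ := hmemΘ Q hQ
    refine ⟨h.isBasisForm hl, fun hcon => ?_, γ, γ', ?_⟩
    · rw [Finset.mem_filter] at hcon
      obtain ⟨k, hk, hkl⟩ := hmemΘ _ hcon.1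
      exact h.form_ne_neg hu hR hl hk hkl.symm
    · have hswap : ∀ r, ({p, q, r} : Finset LatticePoint) = {a, b, r} := by
        intro r
        rcases pair_eq_cases hab with ⟨rfl, rfl⟩ | ⟨rfl, rfl⟩
        · rfl
        · exact triple_swap _ _ _
      rw [hswap, hswap]
      exact ⟨h1, h2, h3, h4⟩
  have hform : ∀ Q ∈ Θ, 4 * Real.sqrt (((Finset.range n).filter (fun l => F l = Q)).card : ℝ) ≤
      ((E.filter (fun e => IsSeparatedBy (T n) Q e)).card : ℝ) := by
    intro Q hQ
    obtain ⟨l, hl, hlQ⟩ := hmemΘ Q hQ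
    have hbf : IsBasisForm Q := by rw [hlQ]; exact h.isBasisForm hl
    obtain ⟨x, y, hxy, hxyQ⟩ := id hbf
    obtain ⟨M, hM, -, hpar⟩ := h.exists_cells hu hxy
    rw [← hxyQ] at hM hpar
    rw [show ((Finset.range n).filter (fun l => F l = Q)).card = M.card from hM.symm]
    refine (four_mul_sqrt_le_card_cellBoundary hxy M).trans ?_
    norm_cast
    refine Finset.card_le_card fun e he => ?_
    obtain ⟨h1, h2⟩ := sideParity_of_mem_cellBoundary hxy he
    have hstart : ∀ t ∈ R, ¬ IsBeyond Q t := by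
      rw [hlQ]; exact fun t ht => h.not_isBeyond_start hu hR hl ht
    rw [← hpar, ← h.parity_inner hR.subset hbf
      (by rw [hlQ]; exact fun k hk => h.form_ne_neg hu hR hk hl) hstart h2 n le_rfl] at h1
    exact Finset.mem_filter.mpr (h.isSeparatedBy_of_parity hR hbf hstart h2 h1)
  have hn : (n : ℝ) = ∑ Q ∈ Θ, (((Finset.range n).filter (fun l => F l = Q)).card : ℝ) := by
    have := Finset.card_eq_sum_card_image F (Finset.range n)
    rw [Finset.card_range] at this
    exact_mod_cast this
  calc 4 * Real.sqrt n
      ≤ 4 * ∑ Q ∈ Θ, Real.sqrt (((Finset.range n).filter (fun l => F l = Q)).card : ℝ) := by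
        rw [hn]
        gcongr
        exact Real.sqrt_sum_le_sum_sqrt _ _ fun Q _ => Nat.cast_nonneg _
    _ ≤ ∑ Q ∈ Θ, ((E.filter (fun e => IsSeparatedBy (T n) Q e)).card : ℝ) := by
        rw [Finset.mul_sum]
        exact Finset.sum_le_sum hform
    -- Double counting of the pairs of a form and a curve separated by it.
    _ = ((∑ e ∈ E, (Θ.filter (fun Q => IsSeparatedBy (T n) Q e)).card : ℕ) : ℝ) := by
        exact_mod_cast Finset.sum_card_bipartiteAbove_eq_sum_card_bipartiteBelow
          (s := Θ) (t := E) (fun Q e => IsSeparatedBy (T n) Q e)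
    _ ≤ _ := by
        exact_mod_cast Finset.sum_le_sum hcurve

end IsFlopRun

/-! ### The upper bound -/

namespace IsFlopQuad

variable {T : Finset (Finset LatticePoint)} {i j α β : LatticePoint}

/-- The sides of the parallelogram of a flop. -/
def sides (i j α β : LatticePoint) : Finset (Finset LatticePoint) :=
  {{i, α}, {i, β}, {j, α}, {j, β}}

lemma curveNumber_new (h : IsFlopQuad T i j α β) (hT : IsCombTriangulation T) :
    curveNumber (flopSet T i j α β) {α, β} = 0 := by
  have hs : HasShift (flopSet T i j α β) α β 0 :=
    ⟨h.ne', i, j, mem_flopSet.mpr (by tauto), mem_flopSet.mpr (by tauto), h.ne,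
      by rw [← h.add_eq]; simp⟩
  rw [(h.isCombTriangulation hT).curveNumber_eq hs]; rfl

lemma mem_sides {p q r : LatticePoint} (hpq : p ≠ q)
    (ht : ({p, q, r} : Finset LatticePoint) = {α, β, i} ∨
      ({p, q, r} : Finset LatticePoint) = {α, β, j})
    (hne : ({p, q} : Finset LatticePoint) ≠ {α, β}) :
    ({p, q} : Finset LatticePoint) ∈ sides i j α β := by
  have hsub : ({p, q} : Finset LatticePoint) ⊆ {p, q, r} := by intro x; simp; tauto
  simp only [sides, Finset.mem_insert, Finset.mem_singleton]
  rcases ht with ht | ht <;> rw [ht, subset_triple_iff (Finset.card_pair hpq)] at hsub <;> tauto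

/-- A flop changes the numbers of the sides of its parallelogram by at most one. -/
lemma curveNumber_flopSet_le (h : IsFlopQuad T i j α β) (hT : IsCombTriangulation T)
    {e : Finset LatticePoint} (he : e ∈ toricCurves (flopSet T i j α β)) (hne : e ≠ {α, β}) :
    e ∈ toricCurves T ∧ curveNumber (flopSet T i j α β) e ≤
      curveNumber T e + if e ∈ sides i j α β then 1 else 0 := by
  have hT' := h.isCombTriangulation hT
  obtain ⟨p, q, s, rfl, hs⟩ := hT'.mem_toricCurves.mp he
  rw [hT'.curveNumber_eq hs]
  obtain ⟨hpq, γ, γ', h1, h2, h3, h4⟩ := hs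
  obtain ⟨n1, n2, -⟩ := hT'.ne_and_abs_det hpq h1
  obtain ⟨n3, n4, -⟩ := hT'.ne_and_abs_det hpq h2
  have one : ∀ γ γ' : LatticePoint, p ≠ γ → q ≠ γ → γ + γ' = (1 + s) • p + (1 - s) • q →
      (({p, q, γ} : Finset LatticePoint) = {α, β, i} ∨
        ({p, q, γ} : Finset LatticePoint) = {α, β, j}) →
      ({p, q, γ'} ∈ T ∧ ({p, q, γ'} : Finset LatticePoint) ≠ {i, j, α} ∧
        ({p, q, γ'} : Finset LatticePoint) ≠ {i, j, β}) →
      {p, q} ∈ toricCurves T ∧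
        s.natAbs ≤ curveNumber T {p, q} + if {p, q} ∈ sides i j α β then 1 else 0 := by
    intro γ γ' n1 n2 h4 hn ho
    obtain ⟨δ, hδ, hshift⟩ := flop_new_old h.add_eq hpq n1 n2 hn hne
    have hδT : {p, q, δ} ∈ T := by
      rcases hδ with e | e <;> rw [e]
      · exact h.left
      · exact h.right
    have hδne : δ ≠ γ' := by
      rintro rfl; tauto
    -- The apex over a side moves by ± the side, which changes the signed number by one.
    obtain ⟨s', hs', hval⟩ : ∃ s', (s' = s + 1 ∨ s' = s - 1) ∧
        δ + γ' = (1 + s') • p + (1 - s') • q := by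
      rcases hshift with rfl | rfl
      · refine ⟨s - 1, Or.inr rfl, ?_⟩
        rw [add_right_comm, h4]; module
      · refine ⟨s + 1, Or.inl rfl, ?_⟩
        rw [add_right_comm, h4]; module
    have hsh : HasShift T p q s' := ⟨hpq, δ, γ', hδT, ho.1, hδne, hval⟩
    refine ⟨hT.mem_toricCurves.mpr ⟨p, q, s', rfl, hsh⟩, ?_⟩
    rw [hT.curveNumber_eq hsh, if_pos (mem_sides hpq hn hne)]
    omega
  rcases mem_flopSet.mp h1 with o1 | c1 <;> rcases mem_flopSet.mp h2 with o2 | c2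
  · have hsh : HasShift T p q s := ⟨hpq, γ, γ', o1.1, o2.1, h3, h4⟩
    refine ⟨hT.mem_toricCurves.mpr ⟨p, q, s, rfl, hsh⟩, ?_⟩
    rw [hT.curveNumber_eq hsh]
    omega
  · exact one γ' γ n3 n4 (by rw [add_comm, h4]) c2 o1
  · exact one γ γ' n1 n2 h4 c1 o2
  · exfalso
    rcases c1 with c1 | c1 <;> rcases c2 with c2 | c2
    · exact h3 (triple_apex_eq n1 n2 (c1.trans c2.symm))
    · exact hne (new_pair h.ne hpq c1 c2)
    · exact hne (new_pair h.ne hpq c2 c1)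
    · exact h3 (triple_apex_eq n1 n2 (c1.trans c2.symm))

/-- Besides the new diagonal, which counts 0, all curves are old ones, and only the four sides can
gain, each at most one. -/
lemma deformationCount_flopSet_le (h : IsFlopQuad T i j α β) (hT : IsCombTriangulation T) :
    deformationCount (flopSet T i j α β) ≤ deformationCount T + 4 := by
  have hsub : (toricCurves (flopSet T i j α β)).erase {α, β} ⊆ toricCurves T := fun e he =>
    (h.curveNumber_flopSet_le hT (Finset.mem_of_mem_erase he) (Finset.ne_of_mem_erase he)).1
  calc deformationCount (flopSet T i j α β)
      = ∑ e ∈ (toricCurves (flopSet T i j α β)).erase {α, β},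
          curveNumber (flopSet T i j α β) e :=
        (Finset.sum_erase _ (h.curveNumber_new hT)).symm
    _ ≤ ∑ e ∈ (toricCurves (flopSet T i j α β)).erase {α, β},
          (curveNumber T e + if e ∈ sides i j α β then 1 else 0) :=
        Finset.sum_le_sum fun e he => (h.curveNumber_flopSet_le hT (Finset.mem_of_mem_erase he)
          (Finset.ne_of_mem_erase he)).2
    _ ≤ ∑ e ∈ toricCurves T, (curveNumber T e + if e ∈ sides i j α β then 1 else 0) :=
        Finset.sum_le_sum_of_subset hsub
    _ = deformationCount T + ((toricCurves T).filter (· ∈ sides i j α β)).card := by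
        rw [Finset.sum_add_distrib, deformationCount, Finset.card_filter]
    _ ≤ deformationCount T + (sides i j α β).card := by
        gcongr
        intro e he
        exact (Finset.mem_filter.mp he).2
    _ ≤ deformationCount T + 4 := by
        gcongr
        exact Finset.card_le_four

end IsFlopQuad

lemma IsFlopRun.deformationCount_le {T₀ R : Finset (Finset LatticePoint)} {n : ℕ}
    {T : ℕ → Finset (Finset LatticePoint)} {i j α β : ℕ → LatticePoint}
    (h : IsFlopRun T₀ R n T i j α β) :
    ∀ k ≤ n, deformationCount (T k) ≤ deformationCount T₀ + 4 * k := by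
  intro k
  induction k with
  | zero => intro _; rw [h.start]; simp
  | succ k ih =>
    intro hk
    have h1 := ih (by omega)
    have h2 := (h.quad k hk).deformationCount_flopSet_le (h.comb k (by omega))
    rw [h.step k hk]
    omega

/-! ### The quadrilateral: uniqueness of the count -/

lemma basis_combination_inj {u v : LatticePoint} (h : |latticeDet u v| = 1) {a b c d : ℤ}
    (he : a • u + b • v = c • u + d • v) : a = c ∧ b = d := by
  have h0 : latticeDet u v ≠ 0 := by intro h0; rw [h0] at h; norm_num at h
  have e1 := congrArg Prod.fst he
  have e2 := congrArg Prod.snd he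
  simp only [Prod.fst_add, Prod.snd_add, Prod.smul_fst, Prod.smul_snd, smul_eq_mul] at e1 e2
  constructor
  · apply mul_right_cancel₀ h0
    simp only [latticeDet]
    linear_combination v.2 * e1 - v.1 * e2
  · apply mul_right_cancel₀ h0
    simp only [latticeDet]
    linear_combination u.1 * e2 - u.2 * e1

lemma cellCorner_inj {o u v : LatticePoint} (h : |latticeDet u v| = 1) {c d : ℕ × ℕ}
    (he : cellCorner o u v c = cellCorner o u v d) : c = d := by
  unfold cellCorner at he
  rw [add_assoc, add_assoc, add_right_inj] at he
  obtain ⟨h1, h2⟩ := basis_combination_inj h he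
  ext
  · exact_mod_cast h1
  · exact_mod_cast h2

/-- The diagonal of a cell is contained in no triangle of another cell. -/
lemma eq_of_diagonal_mem {o u v : LatticePoint} (h : |latticeDet u v| = 1) {c d : ℕ × ℕ}
    {t : Finset LatticePoint}
    (ht : t = {cellCorner o u v d, cellCorner o u v d + u, cellCorner o u v d + v} ∨
      t = {cellCorner o u v d + u, cellCorner o u v d + v, cellCorner o u v d + u + v})
    (h1 : cellCorner o u v c + u ∈ t) (h2 : cellCorner o u v c + v ∈ t) : c = d := by
  obtain ⟨r, s⟩ := c
  obtain ⟨r', s'⟩ := d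
  have key : ∀ {x y : LatticePoint} {a b a' b' : ℤ},
      x = cellCorner o u v (r, s) + (a • u + b • v) →
      y = cellCorner o u v (r', s') + (a' • u + b' • v) → x = y →
      r + a = r' + a' ∧ s + b = s' + b' := by
    rintro x y a b a' b' rfl rfl he
    apply basis_combination_inj h
    have : o + (((r : ℤ) + a) • u + ((s : ℤ) + b) • v) =
        o + (((r' : ℤ) + a') • u + ((s' : ℤ) + b') • v) := by
      unfold cellCorner at he
      simp only at he
      calc _ = o + (r : ℤ) • u + (s : ℤ) • v + (a • u + b • v) := by module
        _ = _ := he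
        _ = _ := by module
    exact add_left_cancel this
  have k1 : cellCorner o u v (r, s) + u = cellCorner o u v (r, s) + ((1 : ℤ) • u + (0 : ℤ) • v) := by
    simp
  have k2 : cellCorner o u v (r, s) + v = cellCorner o u v (r, s) + ((0 : ℤ) • u + (1 : ℤ) • v) := by
    simp
  have l0 : cellCorner o u v (r', s') =
      cellCorner o u v (r', s') + ((0 : ℤ) • u + (0 : ℤ) • v) := by simp
  have l1 : cellCorner o u v (r', s') + u =
      cellCorner o u v (r', s') + ((1 : ℤ) • u + (0 : ℤ) • v) := by simp
  have l2 : cellCorner o u v (r', s') + v =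
      cellCorner o u v (r', s') + ((0 : ℤ) • u + (1 : ℤ) • v) := by simp
  have l3 : cellCorner o u v (r', s') + u + v =
      cellCorner o u v (r', s') + ((1 : ℤ) • u + (1 : ℤ) • v) := by simp [add_assoc]
  have : r = r' ∧ s = s' := by
    rcases ht with rfl | rfl <;> rw [mem_triple] at h1 h2
    · have g1 := h1.imp (key k1 l0) (Or.imp (key k1 l1) (key k1 l2))
      have g2 := h2.imp (key k2 l0) (Or.imp (key k2 l1) (key k2 l2))
      omega
    · have g1 := h1.imp (key k1 l1) (Or.imp (key k1 l2) (key k1 l3))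
      have g2 := h2.imp (key k2 l1) (Or.imp (key k2 l2) (key k2 l3))
      omega
  rw [this.1, this.2]

/-- A finite check in coordinates: `d` is the common edge, `w` a second edge of the first triangle,
and `(1 - s) d - w`, `-s d - w` are the other edges of the second. The bounds on the single
coordinates hold for both shapes of triangles and give |s| ≤ 1; the bounds on the sums say that the
second triangle also has the shape of the first. -/
lemma shift_eq_zero_aux {d₁ d₂ w₁ w₂ s : ℤ} (hdet : |d₁ * w₂ - d₂ * w₁| = 1) (h1 : |d₁| ≤ 1)
    (h2 : |d₂| ≤ 1) (h3 : |d₁ + d₂| ≤ 1) (h4 : |w₁| ≤ 1) (h5 : |w₂| ≤ 1) (h6 : |w₁ + w₂| ≤ 1)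
    (h4' : |w₁ - d₁| ≤ 1) (h5' : |w₂ - d₂| ≤ 1) (h6' : |w₁ - d₁ + (w₂ - d₂)| ≤ 1)
    (k1 : |(1 - s) * d₁ - w₁| ≤ 1) (k2 : |(1 - s) * d₂ - w₂| ≤ 1)
    (k4 : |-s * d₁ - w₁| ≤ 1) (k5 : |-s * d₂ - w₂| ≤ 1) :
    (|(1 - s) * d₁ - w₁ + ((1 - s) * d₂ - w₂)| ≤ 1 ∧
      |-s * d₁ - w₁ + (-s * d₂ - w₂)| ≤ 1 → s = 0) ∧
    s.natAbs ≤ 1 := by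
  rw [abs_eq (by norm_num)] at hdet
  simp only [abs_le] at *
  obtain ⟨a1, a2⟩ := h1
  obtain ⟨b1, b2⟩ := h2
  interval_cases d₁ <;> interval_cases d₂ <;> omega

/-- `z` is one of the vectors `0, ±u, ±v, ±(u - v)`. -/
def IsFlatVector (u v z : LatticePoint) : Prop :=
  |latticeDet z v| ≤ 1 ∧ |latticeDet u z| ≤ 1 ∧ |latticeDet z v + latticeDet u z| ≤ 1

/-- All edges of the triangle `t` are among `±u, ±v, ±(u - v)`. -/
def IsFlat (u v : LatticePoint) (t : Finset LatticePoint) : Prop :=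
  ∀ p ∈ t, ∀ q ∈ t, IsFlatVector u v (p - q)

lemma isFlatVector_zero (u v : LatticePoint) : IsFlatVector u v 0 := by
  simp [IsFlatVector, latticeDet]

lemma isFlatVector_neg (u v z : LatticePoint) : IsFlatVector u v (-z) ↔ IsFlatVector u v z := by
  have h1 : latticeDet (-z) v = -latticeDet z v := by
    simp only [latticeDet, Prod.fst_neg, Prod.snd_neg]; ring
  have h2 : latticeDet u (-z) = -latticeDet u z := by
    simp only [latticeDet, Prod.fst_neg, Prod.snd_neg]; ring
  rw [IsFlatVector, IsFlatVector, h1, h2, ← neg_add, abs_neg, abs_neg, abs_neg]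

lemma forall_sub_triple {P : LatticePoint → Prop} (h0 : P 0) (hneg : ∀ z, P (-z) ↔ P z)
    (p q r : LatticePoint) :
    (∀ a ∈ ({p, q, r} : Finset LatticePoint), ∀ b ∈ ({p, q, r} : Finset LatticePoint), P (a - b)) ↔
      P (q - p) ∧ P (r - p) ∧ P (r - q) := by
  have hc : ∀ a b : LatticePoint, P (a - b) ↔ P (b - a) := fun a b => by rw [← neg_sub, hneg]
  constructor
  · intro h
    exact ⟨h _ (by simp) _ (by simp), h _ (by simp) _ (by simp), h _ (by simp) _ (by simp)⟩
  · rintro ⟨h1, h2, h3⟩ a ha b hb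
    rw [mem_triple] at ha hb
    rcases ha with rfl | rfl | rfl <;> rcases hb with rfl | rfl | rfl <;>
      first
        | (rw [sub_self]; exact h0)
        | assumption
        | (rw [hc]; assumption)

lemma isFlat_triple {u v p q r : LatticePoint} :
    IsFlat u v {p, q, r} ↔
      IsFlatVector u v (q - p) ∧ IsFlatVector u v (r - p) ∧ IsFlatVector u v (r - q) :=
  forall_sub_triple (isFlatVector_zero u v) (isFlatVector_neg u v) p q r

lemma isFlat_of_add_eq {u v a b δ δ' : LatticePoint} (hs : δ + δ' = a + b)
    (h : IsFlat u v {a, b, δ'}) : IsFlat u v {a, b, δ} := by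
  have e : δ' = a + b - δ := by rw [← hs]; abel
  have e1 : δ' - a = -(δ - b) := by rw [e]; abel
  have e2 : δ' - b = -(δ - a) := by rw [e]; abel
  rw [isFlat_triple, e1, e2, isFlatVector_neg, isFlatVector_neg] at h
  rw [isFlat_triple]
  tauto

lemma IsRegularRegion.isFlat {T R : Finset (Finset LatticePoint)} (hR : IsRegularRegion T R)
    {u v : LatticePoint} {t t' : Finset LatticePoint} (ht : t ∈ R)
    (ht' : t' ∈ R) (h : IsFlat u v t) : IsFlat u v t' := by
  obtain ⟨a, b, -, hab⟩ := hR.tessellation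
  have key : ∀ t ∈ R, (IsFlat u v t ↔
      IsFlatVector u v a ∧ IsFlatVector u v b ∧ IsFlatVector u v (b - a)) := by
    intro t ht
    obtain ⟨p, rfl | rfl⟩ := hab t ht
    · rw [isFlat_triple, add_sub_cancel_left, add_sub_cancel_left, add_sub_add_left_eq_sub]
    · rw [isFlat_triple, add_sub_add_left_eq_sub, add_sub_cancel_left,
        show p + a + b - (p + b) = a by abel]
      tauto
  rwa [key t' ht', ← key t ht]

/-- The number of an edge between two triangles with small edge vectors. -/
lemma shift_of_isFlat {u v p q γ γ' : LatticePoint} {s : ℤ} (huv : |latticeDet u v| = 1)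
    (hd : |latticeDet (q - p) (γ - p)| = 1) (hs : γ + γ' = (1 + s) • p + (1 - s) • q)
    (h : IsFlat u v {p, q, γ}) :
    (IsFlat u v {p, q, γ'} → s = 0) ∧ (IsFlat u (-v) {p, q, γ'} → s.natAbs ≤ 1) := by
  have e1 : γ' - p = (1 - s) • (q - p) - (γ - p) := by
    rw [eq_sub_of_add_eq' hs]; module
  have e2 : γ' - q = (-s) • (q - p) - (γ - p) := by
    rw [eq_sub_of_add_eq' hs]; module
  have e3 : γ - q = (γ - p) - (q - p) := by abel
  rw [isFlat_triple] at h
  rw [isFlat_triple, isFlat_triple]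
  rw [e1, e2]
  rw [e3] at h
  have hdet : |latticeDet (q - p) v * latticeDet u (γ - p) -
      latticeDet u (q - p) * latticeDet (γ - p) v| = 1 := by
    rw [latticeDet_mul_latticeDet, abs_mul, huv, hd, one_mul]
  generalize q - p = d at *
  generalize γ - p = w at *
  have l1 : ∀ (m : ℤ) (d w : LatticePoint),
      latticeDet (m • d - w) v = m * latticeDet d v - latticeDet w v := by
    intro m d w
    simp only [latticeDet, Prod.fst_sub, Prod.snd_sub, Prod.smul_fst, Prod.smul_snd, smul_eq_mul]
    ring
  have l2 : ∀ (m : ℤ) (d w : LatticePoint),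
      latticeDet u (m • d - w) = m * latticeDet u d - latticeDet u w := by
    intro m d w
    simp only [latticeDet, Prod.fst_sub, Prod.snd_sub, Prod.smul_fst, Prod.smul_snd, smul_eq_mul]
    ring
  have l3 := l1 1 w d
  have l4 := l2 1 w d
  rw [one_smul, one_mul] at l3 l4
  have l5 : ∀ z, latticeDet z (-v) = -latticeDet z v := by
    intro z; simp only [latticeDet, Prod.fst_neg, Prod.snd_neg]; ring
  simp only [IsFlatVector, l1, l2, l3, l4, l5, abs_neg] at h ⊢
  obtain ⟨⟨a1, a2, a3⟩, ⟨b1, b2, b3⟩, ⟨c1, c2, c3⟩⟩ := h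
  constructor
  · rintro ⟨-, ⟨f1, f2, f3⟩, ⟨g1, g2, g3⟩⟩
    exact (shift_eq_zero_aux hdet a1 a2 a3 b1 b2 b3 c1 c2 c3 f1 f2 g1 g2).1 ⟨f3, g3⟩
  · rintro ⟨-, ⟨f1, f2, f3⟩, ⟨g1, g2, g3⟩⟩
    exact (shift_eq_zero_aux hdet a1 a2 a3 b1 b2 b3 c1 c2 c3 f1 f2 g1 g2).2

/-! ### The cells of the k × k quadrilateral and their boundary -/

/-- The lattice points at the corners of the cells of the quadrilateral. -/
def cellCorners (k : ℕ) (o u v : LatticePoint) : Finset LatticePoint :=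
  (Finset.range k ×ˢ Finset.range k).image (cellCorner o u v)

lemma card_cellCorners {k : ℕ} {o u v : LatticePoint} (huv : |latticeDet u v| = 1) :
    (cellCorners k o u v).card = k ^ 2 := by
  rw [cellCorners, Finset.card_image_of_injective _ fun _ _ => cellCorner_inj huv]
  simp [sq]

lemma card_cellBoundary_cellCorners_le {k : ℕ} {o u v : LatticePoint}
    (huv : |latticeDet u v| = 1) :
    (cellBoundary u v (cellCorners k o u v)).card ≤ 4 * k := by
  have hmem : ∀ r s, r < k → s < k → cellCorner o u v (r, s) ∈ cellCorners k o u v := by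
    intro r s hr hs
    exact Finset.mem_image_of_mem _ (by simp [hr, hs])
  -- Only cells in an outermost row or column lack the neighbour in a given direction; `f` lists
  -- them.
  have bound : ∀ (w : LatticePoint) (f : ℕ → ℕ × ℕ),
      (∀ r s, r < k → s < k → cellCorner o u v (r, s) - w ∉ cellCorners k o u v →
        ∃ a < k, (r, s) = f a) →
      ((cellCorners k o u v).filter (fun z => z - w ∉ cellCorners k o u v)).card ≤ k := by
    intro w f hf
    calc _ ≤ ((Finset.range k).image (fun a => cellCorner o u v (f a))).card := by
          refine Finset.card_le_card fun z hz => ?_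
          rw [Finset.mem_filter] at hz
          obtain ⟨⟨r, s⟩, hc, rfl⟩ := Finset.mem_image.mp hz.1
          rw [Finset.mem_product, Finset.mem_range, Finset.mem_range] at hc
          obtain ⟨a, ha, he⟩ := hf r s hc.1 hc.2 hz.2
          rw [he]
          exact Finset.mem_image_of_mem _ (Finset.mem_range.mpr ha)
      _ ≤ (Finset.range k).card := Finset.card_image_le
      _ = k := Finset.card_range k
  have b1 := bound u (fun a => (0, a)) (by
    intro r s hr hs hn
    rcases r with _ | r
    · exact ⟨s, hs, rfl⟩
    · exfalso; apply hn
      convert hmem r s (by omega) hs using 1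
      simp only [cellCorner]; push_cast; module)
  have b2 := bound (-u) (fun a => (k - 1, a)) (by
    intro r s hr hs hn
    by_cases hrk : r = k - 1
    · exact ⟨s, hs, by rw [hrk]⟩
    · exfalso; apply hn
      convert hmem (r + 1) s (by omega) hs using 1
      simp only [cellCorner]; push_cast; module)
  have b3 := bound v (fun a => (a, 0)) (by
    intro r s hr hs hn
    rcases s with _ | s
    · exact ⟨r, hr, rfl⟩
    · exfalso; apply hn
      convert hmem r s hr (by omega) using 1
      simp only [cellCorner]; push_cast; module)
  have b4 := bound (-v) (fun a => (a, k - 1)) (by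
    intro r s hr hs hn
    by_cases hsk : s = k - 1
    · exact ⟨r, hr, by rw [hsk]⟩
    · exfalso; apply hn
      convert hmem r (s + 1) hr (by omega) using 1
      simp only [cellCorner]; push_cast; module)
  rw [card_cellBoundary huv]
  omega

lemma cellDiagonal_inj {o u v : LatticePoint} (huv : |latticeDet u v| = 1) {c d : ℕ × ℕ}
    (h : ({cellCorner o u v c + u, cellCorner o u v c + v} : Finset LatticePoint) =
      {cellCorner o u v d + u, cellCorner o u v d + v}) : c = d := by
  have hsub : ∀ x, x ∈ ({cellCorner o u v c + u, cellCorner o u v c + v} : Finset LatticePoint) →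
      x ∈ ({cellCorner o u v d, cellCorner o u v d + u, cellCorner o u v d + v} :
        Finset LatticePoint) := by
    intro x hx
    rw [h, Finset.mem_insert, Finset.mem_singleton] at hx
    rw [mem_triple]; tauto
  exact eq_of_diagonal_mem huv (Or.inl rfl) (hsub _ (by simp)) (hsub _ (by simp))

lemma card_quadrilateralDiagonals {k : ℕ} {o u v : LatticePoint} (huv : |latticeDet u v| = 1) :
    (quadrilateralDiagonals k o u v).card = k ^ 2 := by
  rw [quadrilateralDiagonals, Finset.card_image_of_injective _ fun _ _ => cellDiagonal_inj huv]
  simp [sq]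

lemma IsUnimodularTriangle.card_eq {t : Finset LatticePoint} (h : IsUnimodularTriangle t) :
    t.card = 3 := by
  obtain ⟨p, q, r, rfl, hd⟩ := h
  obtain ⟨h1, h2, h3⟩ := ne_of_abs_latticeDet_eq_one hd
  exact Finset.card_eq_three.mpr ⟨p, q, r, h1, h2, h3, rfl⟩

lemma IsQuadrilateralIn.abs_det {T R : Finset (Finset LatticePoint)} {k : ℕ} {o u v : LatticePoint}
    (hq : IsQuadrilateralIn R k o u v) (hT : IsCombTriangulation T) (hR : R ⊆ T) (hk : k ≠ 0) :
    |latticeDet u v| = 1 := by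
  have h0 := hq (0, 0) (by simp; omega)
  have huv : u ≠ v := by
    rintro rfl
    have h3 := (hT.unimodular _ (hR h0.1)).card_eq
    have h2 := Finset.card_le_two (a := cellCorner o u u (0, 0)) (b := cellCorner o u u (0, 0) + u)
    rw [Finset.pair_eq_singleton] at h3
    omega
  have h1 := hT.ne_and_abs_det (p := cellCorner o u v (0, 0) + u)
    (q := cellCorner o u v (0, 0) + v) (r := cellCorner o u v (0, 0))
    (fun h => huv (add_left_cancel h)) (hR (by rw [← triple_rotate]; exact h0.1))
  rw [← h1.2.2]
  congr 1
  simp only [latticeDet, Prod.fst_sub, Prod.snd_sub, Prod.fst_add, Prod.snd_add]; ring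

/-! ### Runs that flop exactly the diagonals of the cells -/

namespace IsFlopRun

variable {T₀ R : Finset (Finset LatticePoint)} {n : ℕ} {T : ℕ → Finset (Finset LatticePoint)}
  {i j α β : ℕ → LatticePoint} {k : ℕ} {o u v : LatticePoint}

/-- The triangles of a cell are present as long as its diagonal has not been flopped. -/
lemma cell_mem (h : IsFlopRun T₀ R n T i j α β) (hR : R ⊆ T₀) (huv : |latticeDet u v| = 1)
    (hq : IsQuadrilateralIn R k o u v)
    (hdiag : ∀ l < n, ∃ c ∈ Finset.range k ×ˢ Finset.range k, ({i l, j l} : Finset LatticePoint) =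
      {cellCorner o u v c + u, cellCorner o u v c + v})
    {c : ℕ × ℕ} (hc : c ∈ Finset.range k ×ˢ Finset.range k) :
    ∀ m ≤ n, (∀ l < m, ({i l, j l} : Finset LatticePoint) ≠
      {cellCorner o u v c + u, cellCorner o u v c + v}) →
      {cellCorner o u v c, cellCorner o u v c + u, cellCorner o u v c + v} ∈ T m := by
  intro m
  induction m with
  | zero => intro _ _; rw [h.start]; exact hR (hq c hc).1
  | succ m ih =>
    intro hm hne
    rw [h.step m hm]
    have hold := ih (by omega) fun l hl => hne l (by omega)
    refine IsFlopQuad.mem_flopSet.mpr (Or.inl ⟨hold, ?_⟩)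
    rw [← not_or]
    intro hcon
    obtain ⟨d, hd, hdm⟩ := hdiag m hm
    have hmem : ∀ x ∈ ({i m, j m} : Finset LatticePoint),
        x ∈ ({cellCorner o u v c, cellCorner o u v c + u, cellCorner o u v c + v} :
          Finset LatticePoint) := by
      intro x hx
      rw [Finset.mem_insert, Finset.mem_singleton] at hx
      rcases hcon with e | e <;> rw [e, mem_triple] <;> tauto
    rw [hdm] at hmem
    have hdc : d = c :=
      eq_of_diagonal_mem huv (Or.inl rfl) (hmem _ (by simp)) (hmem _ (by simp))
    rw [hdc] at hdm
    exact hne m (by omega) hdm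

/-- When the flopped curves are the diagonals of the cells, each flop replaces the diagonal of a
cell by the other one. -/
lemma exists_cell (h : IsFlopRun T₀ R n T i j α β) (hR : R ⊆ T₀) (huv : |latticeDet u v| = 1)
    (hq : IsQuadrilateralIn R k o u v) (hn : n = k ^ 2)
    (himage : (Finset.range n).image (fun l => ({i l, j l} : Finset LatticePoint)) =
      quadrilateralDiagonals k o u v) {l : ℕ} (hl : l < n) :
    ∃ z ∈ cellCorners k o u v, ({i l, j l} : Finset LatticePoint) = {z + u, z + v} ∧
      ({α l, β l} : Finset LatticePoint) = {z, z + u + v} ∧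
      flopForm (i l) (j l) (α l) = basisForm u v := by
  have hdiag : ∀ l < n, ∃ c ∈ Finset.range k ×ˢ Finset.range k,
      ({i l, j l} : Finset LatticePoint) =
        {cellCorner o u v c + u, cellCorner o u v c + v} := by
    intro l hl
    have := Finset.mem_image_of_mem (fun l => ({i l, j l} : Finset LatticePoint))
      (Finset.mem_range.mpr hl)
    rw [himage, quadrilateralDiagonals, Finset.mem_image] at this
    obtain ⟨c, hc, he⟩ := this
    exact ⟨c, hc, he.symm⟩
  -- There are as many flops as diagonals, so each diagonal is flopped once; until then its cell
  -- still contains the triangle at its corner.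
  have hinj : Set.InjOn (fun l => ({i l, j l} : Finset LatticePoint)) (Finset.range n) := by
    apply Finset.injOn_of_card_image_eq
    rw [himage, card_quadrilateralDiagonals huv, Finset.card_range, hn]
  obtain ⟨c, hc, hlc⟩ := hdiag l hl
  have hmem := h.cell_mem hR huv hq hdiag hc l hl.le (by
    intro m hm hcon
    have := hinj (by simp; omega) (by simpa using hl) (hcon.trans hlc.symm)
    omega)
  set z := cellCorner o u v c
  have hquad := h.quad l hl
  have hcomb := h.comb l hl.le
  obtain ⟨hu0, hv0, -, -⟩ := ne_of_basis huv
  have hadd : i l + j l = (z + u) + (z + v) := by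
    rcases pair_eq_cases hlc with ⟨h1, h2⟩ | ⟨h1, h2⟩ <;> rw [h1, h2]
    exact add_comm _ _
  have hi : i l ∈ ({z, z + u, z + v} : Finset LatticePoint) := by
    rcases pair_eq_cases hlc with ⟨h1, h2⟩ | ⟨h1, h2⟩ <;> rw [h1] <;> simp
  have hj : j l ∈ ({z, z + u, z + v} : Finset LatticePoint) := by
    rcases pair_eq_cases hlc with ⟨h1, h2⟩ | ⟨h1, h2⟩ <;> rw [h2] <;> simp
  have hzi : z ≠ i l := by
    rcases pair_eq_cases hlc with ⟨h1, h2⟩ | ⟨h1, h2⟩ <;> rw [h1] <;> simpa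
  have hzj : z ≠ j l := by
    rcases pair_eq_cases hlc with ⟨h1, h2⟩ | ⟨h1, h2⟩ <;> rw [h2] <;> simpa
  have hz : z = α l ∨ z = β l := by
    have : z ∈ ({z, z + u, z + v} : Finset LatticePoint) := by simp
    rcases hquad.eq_of_mem_old hcomb hmem hi hj with e | e <;> rw [e, mem_triple] at this <;> tauto
  have hsum := hquad.add_eq
  rw [hadd] at hsum
  refine ⟨z, Finset.mem_image_of_mem _ hc, hlc, ?_⟩
  rcases hz with hz | hz
  · have hβ : β l = z + u + v := by
      rw [← hz] at hsum
      apply add_left_cancel (a := z)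
      rw [hsum]; abel
    refine ⟨by rw [← hz, hβ], ?_⟩
    rw [flopForm, ← hz]
    rcases pair_eq_cases hlc with ⟨h1, h2⟩ | ⟨h1, h2⟩ <;>
      rw [h1, h2, add_sub_cancel_left, add_sub_cancel_left]
    exact basisForm_comm _ _
  · have hα : α l = z + u + v := by
      rw [← hz] at hsum
      apply add_right_cancel (b := z)
      rw [hsum]; abel
    refine ⟨by rw [← hz, hα, Finset.pair_comm], ?_⟩
    have e1 : z + u - (z + u + v) = -v := by abel
    have e2 : z + v - (z + u + v) = -u := by abel
    rw [flopForm, hα]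
    rcases pair_eq_cases hlc with ⟨h1, h2⟩ | ⟨h1, h2⟩ <;>
      rw [h1, h2, e1, e2, basisForm_neg_left, basisForm_neg_right, neg_neg]
    exact basisForm_comm _ _

/-- Flops with the same form do not undo each other. -/
lemma notUndone_of_form_eq (h : IsFlopRun T₀ R n T i j α β) {Q : LatticePoint → ℤ}
    (hform : ∀ l < n, flopForm (i l) (j l) (α l) = Q) : NotUndone n i j α β := by
  rintro l k hlk hk ⟨he, -⟩
  have h1 := (h.quad k hk).flopForm_old (h.comb k hk.le)
  have h2 := (h.quad l (by omega)).flopForm_new (h.comb l (by omega))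
  rw [hform k hk] at h1
  rw [hform l (by omega)] at h2
  have hQ : IsBasisForm Q := by rw [← hform k hk]; exact h.isBasisForm hk
  rcases pair_eq_cases he with ⟨e1, e2⟩ | ⟨e1, e2⟩ <;> rw [e1, e2] at h1
  · omega
  · rw [hQ.sub_comm] at h1; omega

/-- During the flops of the quadrilateral, an inner triangle either has edges `u, v, u - v`, or it
has edges `u, v, u + v`. -/
lemma inner_flat (h : IsFlopRun T₀ R n T i j α β) (hR : IsRegularRegion T₀ R)
    (huv : |latticeDet u v| = 1)
    (hcell : ∀ l < n, ∃ z, ({i l, j l} : Finset LatticePoint) = {z + u, z + v} ∧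
      ({α l, β l} : Finset LatticePoint) = {z, z + u + v} ∧
      flopForm (i l) (j l) (α l) = basisForm u v)
    (hstart : ∀ t ∈ R, ¬ IsBeyond (basisForm u v) t ∧ IsFlat u v t) :
    ∀ m ≤ n, ∀ t ∈ T m \ (T₀ \ R), (IsFlat u v t ∧ ¬ IsBeyond (basisForm u v) t) ∨
      (IsFlat u (-v) t ∧ IsBeyond (basisForm u v) t) := by
  intro m
  induction m with
  | zero =>
    intro _ t ht
    rw [h.inner_zero hR.subset] at ht
    exact Or.inl (hstart t ht).symm
  | succ m ih =>
    intro hm t ht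
    rw [h.step_inner hm] at ht
    have hquad := h.quad m hm
    have hcomb := h.comb m (Nat.le_of_lt hm)
    obtain ⟨z, hz1, hz2, hz3⟩ := hcell m hm
    have hpos : 0 < basisForm u v (β m - α m) := by
      rw [← hz3, hquad.flopForm_new hcomb]; norm_num
    have hD : latticeDet u v = 1 ∨ latticeDet u v = -1 := (abs_eq (by norm_num)).mp huv
    have hf : ∀ a b : ℤ, |a| ≤ 1 → |b| ≤ 1 → |a - b| ≤ 1 → IsFlatVector u (-v) (a • u + b • v) := by
      intro a b ha hb hab
      have l1 : latticeDet (a • u + b • v) (-v) = -(a * latticeDet u v) := by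
        simp only [latticeDet, Prod.fst_add, Prod.snd_add, Prod.smul_fst, Prod.smul_snd,
          smul_eq_mul, Prod.fst_neg, Prod.snd_neg]; ring
      have l2 : latticeDet u (a • u + b • v) = b * latticeDet u v := by
        simp only [latticeDet, Prod.fst_add, Prod.snd_add, Prod.smul_fst, Prod.smul_snd,
          smul_eq_mul]; ring
      rw [IsFlatVector, l1, l2]
      rw [abs_le] at *
      simp only [abs_le]
      rcases hD with h | h <;> rw [h] <;> omega
    have hflat : ∀ x, x = z + u ∨ x = z + v → IsFlat u (-v) {α m, β m, x} := by
      intro x hx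
      have hset : ({α m, β m, x} : Finset LatticePoint) = {z, z + u + v, x} := by
        rcases pair_eq_cases hz2 with ⟨e1, e2⟩ | ⟨e1, e2⟩ <;> rw [e1, e2]
        exact triple_swap _ _ _
      rw [hset, isFlat_triple]
      have f1 := hf 1 0 (by norm_num) (by norm_num) (by norm_num)
      have f2 := hf 0 1 (by norm_num) (by norm_num) (by norm_num)
      have f3 := hf 1 1 (by norm_num) (by norm_num) (by norm_num)
      simp only [one_smul, zero_smul, add_zero, zero_add] at f1 f2 f3
      rcases hx with rfl | rfl
      · rw [add_assoc, add_sub_cancel_left, add_sub_cancel_left, add_sub_add_left_eq_sub,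
          sub_add_cancel_left, isFlatVector_neg]
        exact ⟨f3, f1, f2⟩
      · rw [add_assoc, add_sub_cancel_left, add_sub_cancel_left, add_sub_add_left_eq_sub,
          sub_add_cancel_right, isFlatVector_neg]
        exact ⟨f3, f2, f1⟩
    have hbf : IsBasisForm (basisForm u v) := ⟨u, v, huv, rfl⟩
    rcases IsFlopQuad.mem_flopSet.mp ht with ⟨ht, -⟩ | ht | ht
    · exact ih (by omega) t ht
    · refine Or.inr ⟨?_, isBeyond_of_pos hbf (hquad.new_unimodular hcomb (Or.inl ht)) (p := α m)
        (q := β m) (by rw [ht]; simp) (by rw [ht]; simp) hpos⟩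
      rw [ht]
      refine hflat _ ?_
      rcases pair_eq_cases hz1 with ⟨e1, e2⟩ | ⟨e1, e2⟩ <;> tauto
    · refine Or.inr ⟨?_, isBeyond_of_pos hbf (hquad.new_unimodular hcomb (Or.inr ht)) (p := α m)
        (q := β m) (by rw [ht]; simp) (by rw [ht]; simp) hpos⟩
      rw [ht]
      refine hflat _ ?_
      rcases pair_eq_cases hz1 with ⟨e1, e2⟩ | ⟨e1, e2⟩ <;> tauto

open scoped Classical in
/-- The curves that contribute to the number after the flops are on the boundary of the union of the
flopped cells, and have number one. -/
lemma curveNumber_le_of_flat (h : IsFlopRun T₀ R n T i j α β) (hR : IsRegularRegion T₀ R)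
    (huv : |latticeDet u v| = 1)
    (hstart : ∀ t ∈ R, ¬ IsBeyond (basisForm u v) t ∧ IsFlat u v t)
    (hflat : ∀ t ∈ T n \ (T₀ \ R), (IsFlat u v t ∧ ¬ IsBeyond (basisForm u v) t) ∨
      (IsFlat u (-v) t ∧ IsBeyond (basisForm u v) t))
    (hneg : ∀ l < n, basisForm u v ≠ -flopForm (i l) (j l) (α l))
    {M : Finset LatticePoint} (hM : ∀ e, e.card = 2 →
      ∑ l ∈ (Finset.range n).filter (fun l => flopForm (i l) (j l) (α l) = basisForm u v),
        (if IsQuadSide (i l) (j l) (α l) (β l) e then (1 : ZMod 2) else 0) = sideParity u v M e)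
    {e : Finset LatticePoint} (he : e ∈ toricCurves (T n) \ toricCurves (T₀ \ R)) :
    curveNumber (T n) e ≤ if e ∈ cellBoundary u v M then 1 else 0 := by
  classical
  have hc := h.comb n le_rfl
  have hci := h.comb_inner le_rfl
  have hO := h.inside n le_rfl
  have hbf : IsBasisForm (basisForm u v) := ⟨u, v, huv, rfl⟩
  have huv' : |latticeDet u (-v)| = 1 := by
    rw [← huv, ← abs_neg]; congr 1; simp only [latticeDet, Prod.fst_neg, Prod.snd_neg]; ring
  rw [Finset.mem_sdiff] at he
  obtain ⟨p, q, s, rfl, hs⟩ := hc.mem_toricCurves.mp he.1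
  rw [hc.curveNumber_eq hs]
  obtain ⟨hpq, γ, γ', h1, h2, h3, h4⟩ := hs
  have hnot : ¬ ({p, q, γ} ∈ T₀ \ R ∧ {p, q, γ'} ∈ T₀ \ R) := fun hcon =>
    he.2 ((hc.mono hO).mem_toricCurves.mpr ⟨p, q, s, rfl, hpq, γ, γ', hcon.1, hcon.2, h3, h4⟩)
  -- An outer triangle next to an inner one is the reflection of a triangle of `R` and has the
  -- initial shape.
  have outer : ∀ γ γ', {p, q, γ} ∈ T₀ \ R → {p, q, γ'} ∈ T n → {p, q, γ'} ∉ T₀ \ R → γ ≠ γ' →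
      IsFlat u v {p, q, γ} ∧ ¬ IsBeyond (basisForm u v) {p, q, γ} := by
    intro γ γ' ho ht hni hne
    have hall : ∀ δ, {p, q, δ} ∈ T n → δ = γ' ∨ δ = γ := fun δ hδ =>
      hc.apex_or hpq ht (hO ho) hne.symm hδ
    obtain ⟨δ, hδ, δ', hδ', hsum⟩ := h.outer_neighbor hR hpq (Finset.mem_sdiff.mpr ⟨ht, hni⟩) (by
      intro δ hδ
      rw [Finset.mem_sdiff] at hδ
      rcases hall δ hδ.1 with rfl | rfl
      · rfl
      · exact absurd ho hδ.2)
    obtain rfl : δ = γ := by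
      rcases hall δ (hO hδ) with rfl | rfl
      · exact absurd hδ hni
      · rfl
    rw [isBeyond_iff_of_add_eq hbf hsum]
    exact ⟨isFlat_of_add_eq hsum (hstart _ hδ').2, (hstart _ hδ').1⟩
  have type : ∀ γ γ', {p, q, γ} ∈ T n → {p, q, γ'} ∈ T n → γ ≠ γ' →
      ¬ ({p, q, γ} ∈ T₀ \ R ∧ {p, q, γ'} ∈ T₀ \ R) →
      (IsFlat u v {p, q, γ} ∧ ¬ IsBeyond (basisForm u v) {p, q, γ}) ∨
      (IsFlat u (-v) {p, q, γ} ∧ IsBeyond (basisForm u v) {p, q, γ} ∧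
        {p, q, γ} ∈ T n \ (T₀ \ R)) := by
    intro γ γ' h1 h2 hne hno
    by_cases ho : {p, q, γ} ∈ T₀ \ R
    · exact Or.inl (outer γ γ' ho h2 (fun hc => hno ⟨ho, hc⟩) hne)
    · have hin := Finset.mem_sdiff.mpr ⟨h1, ho⟩
      have := hflat _ hin
      tauto
  have boundary : ∀ γ γ', {p, q, γ} ∈ T n → {p, q, γ'} ∈ T n → γ ≠ γ' →
      {p, q, γ} ∈ T n \ (T₀ \ R) → IsBeyond (basisForm u v) {p, q, γ} →
      ¬ IsBeyond (basisForm u v) {p, q, γ'} → {p, q} ∈ cellBoundary u v M := by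
    intro γ γ' h1 h2 hne hin hb hb'
    apply mem_cellBoundary_of_sideParity huv
    have hcard := Finset.card_pair hpq
    rw [← hM _ hcard]
    have hp := h.parity_inner hR.subset hbf hneg (fun t ht => (hstart t ht).1) hcard n le_rfl
    refine hp.symm.trans ?_
    have hpair : ({p, q} : Finset LatticePoint) ⊆ {p, q, γ} := by intro x; simp; tauto
    rw [Finset.sum_eq_single_of_mem _ hin, if_pos ⟨hb, hpair⟩]
    intro t ht htne
    refine if_neg fun hcon => ?_
    obtain ⟨r, rfl, -⟩ := (hci.unimodular t ht).exists_apex (hcon.2 (by simp : p ∈ _))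
      (hcon.2 (by simp : q ∈ _)) hpq
    rcases hc.apex_or hpq h1 h2 hne (Finset.mem_sdiff.mp ht).1 with rfl | rfl
    · exact htne rfl
    · exact hb' hcon.1
  have d1 := (hc.ne_and_abs_det hpq h1).2.2
  have d2 := (hc.ne_and_abs_det hpq h2).2.2
  have h4' : γ' + γ = (1 + s) • p + (1 - s) • q := by rw [add_comm, h4]
  -- Triangles of equal shape meet in a curve with number 0. Triangles of different shapes are
  -- separated by the form, so their curve is a boundary side, with number at most 1.
  rcases type γ γ' h1 h2 h3 hnot with ⟨f1, b1⟩ | ⟨f1, b1, m1⟩ <;>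
  rcases type γ' γ h2 h1 h3.symm (fun hcon => hnot hcon.symm) with ⟨f2, b2⟩ | ⟨f2, b2, m2⟩
  · rw [(shift_of_isFlat huv d1 h4 f1).1 f2]; simp
  · rw [if_pos (boundary γ' γ h2 h1 h3.symm m2 b2 b1)]
    exact (shift_of_isFlat huv d1 h4 f1).2 f2
  · rw [if_pos (boundary γ γ' h1 h2 h3 m1 b1 b2)]
    exact (shift_of_isFlat huv d2 h4' f2).2 f1
  · rw [(shift_of_isFlat huv' d1 h4 f1).1 f2]; simp

/-- The number of a run whose flopped curves are the diagonals of a quadrilateral. -/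
lemma deformationCount_quadrilateral (h : IsFlopRun T₀ R n T i j α β)
    (hR : IsRegularRegion T₀ R) (hq : IsQuadrilateralIn R k o u v) (hn : n = k ^ 2)
    (himage : (Finset.range n).image (fun l => ({i l, j l} : Finset LatticePoint)) =
      quadrilateralDiagonals k o u v) :
    (deformationCount (T n) : ℝ) - deformationCount T₀ = 4 * Real.sqrt n := by
  classical
  rcases Nat.eq_zero_or_pos k with rfl | hk
  · obtain rfl : n = 0 := by simpa using hn
    rw [h.start]; simp
  have hT₀ : IsCombTriangulation T₀ := by rw [← h.start]; exact h.comb 0 (Nat.zero_le n)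
  have huv := hq.abs_det hT₀ hR.subset hk.ne'
  have hcell := fun l (hl : l < n) => h.exists_cell hR.subset huv hq hn himage hl
  have hform : ∀ l < n, flopForm (i l) (j l) (α l) = basisForm u v := fun l hl => by
    obtain ⟨z, -, -, -, hz⟩ := hcell l hl
    exact hz
  have hu : NotUndone n i j α β := h.notUndone_of_form_eq hform
  have hn0 : 0 < n := by rw [hn]; positivity
  have hdef : (deformationCount (T n) : ℝ) - deformationCount T₀ =
      ((∑ e ∈ toricCurves (T n) \ toricCurves (T₀ \ R), curveNumber (T n) e : ℕ) : ℝ) := by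
    rw [hR.deformationCount_eq hT₀,
      (h.comb n le_rfl).deformationCount_eq_add (h.inside n le_rfl), Nat.cast_add,
      add_sub_cancel_right]
  rw [hdef]
  refine le_antisymm ?_ (h.lower_bound hu hR)
  have hsqrt : Real.sqrt n = k := by
    rw [hn, Nat.cast_pow, Real.sqrt_sq (Nat.cast_nonneg k)]
  rw [hsqrt]
  obtain ⟨M, hMcard, hMmem, hMpar⟩ := h.exists_cells hu huv
  have hMn : M.card = k ^ 2 := by
    rw [hMcard, Finset.filter_true_of_mem fun l hl => hform l (Finset.mem_range.mp hl),
      Finset.card_range, hn]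
  have hMsub : M ⊆ cellCorners k o u v := by
    intro z hz
    obtain ⟨l, hl, hzl⟩ := hMmem z hz
    obtain ⟨w, hw, hwl, -, -⟩ := hcell l hl
    have hadd : i l + j l = (w + u) + (w + v) := by
      rcases pair_eq_cases hwl with ⟨h1, h2⟩ | ⟨h1, h2⟩ <;> rw [h1, h2]
      exact add_comm _ _
    obtain rfl : z = w := two_smul_injective (by
      apply add_right_cancel (b := u + v)
      rw [← hzl, hadd]; abel)
    exact hw
  -- The flops fill k² different cells among the k² cells of the quadrilateral, so they fill all of
  -- them.
  have hMeq : M = cellCorners k o u v :=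
    Finset.eq_of_subset_of_card_le hMsub (by rw [card_cellCorners huv, hMn])
  have hstart : ∀ t ∈ R, ¬ IsBeyond (basisForm u v) t ∧ IsFlat u v t := by
    intro t ht
    refine ⟨by rw [← hform 0 hn0]; exact h.not_isBeyond_start hu hR hn0 ht, ?_⟩
    refine hR.isFlat (hq (0, 0) (by simp; omega)).1 ht ?_
    rw [isFlat_triple, add_sub_cancel_left, add_sub_cancel_left, add_sub_add_left_eq_sub]
    have s1 : latticeDet (v - u) v = -latticeDet u v := by
      simp only [latticeDet, Prod.fst_sub, Prod.snd_sub]; ring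
    have s2 : latticeDet u (v - u) = latticeDet u v := by
      simp only [latticeDet, Prod.fst_sub, Prod.snd_sub]; ring
    simp only [IsFlatVector, s1, s2, latticeDet_self, huv, abs_neg, abs_zero, add_zero, zero_add,
      neg_add_cancel]
    norm_num
  have hflat := h.inner_flat hR huv
    (fun l hl => by obtain ⟨z, -, hz⟩ := hcell l hl; exact ⟨z, hz⟩) hstart n le_rfl
  have hcurve : ∀ e ∈ toricCurves (T n) \ toricCurves (T₀ \ R),
      curveNumber (T n) e ≤ if e ∈ cellBoundary u v M then 1 else 0 := fun e he =>
    h.curveNumber_le_of_flat hR huv hstart hflat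
      (fun l hl => by rw [← hform 0 hn0]; exact h.form_ne_neg hu hR hl hn0)
      (fun e _ => hMpar e) he
  have hbound : ∑ e ∈ toricCurves (T n) \ toricCurves (T₀ \ R), curveNumber (T n) e ≤ 4 * k := by
    calc _ ≤ ∑ e ∈ toricCurves (T n) \ toricCurves (T₀ \ R),
            (if e ∈ cellBoundary u v M then 1 else 0) := Finset.sum_le_sum hcurve
      _ = ((toricCurves (T n) \ toricCurves (T₀ \ R)).filter (· ∈ cellBoundary u v M)).card := by
          rw [Finset.card_filter]
      _ ≤ (cellBoundary u v M).card :=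
          Finset.card_le_card fun e he => (Finset.mem_filter.mp he).2
      _ ≤ 4 * k := by rw [hMeq]; exact card_cellBoundary_cellCorners_le huv
  exact_mod_cast hbound

end IsFlopRun

/-! ### Existence of a flop sequence for the quadrilateral -/

/-- The flops of the diagonals of the cells of a quadrilateral, row by row. -/
def quadrilateralFlops (T₀ : Finset (Finset LatticePoint)) (k : ℕ) (o u v : LatticePoint) :
    ℕ → Finset (Finset LatticePoint)
  | 0 => T₀
  | l + 1 =>
    flopSet (quadrilateralFlops T₀ k o u v l) (cellCorner o u v (l / k, l % k) + u)
      (cellCorner o u v (l / k, l % k) + v) (cellCorner o u v (l / k, l % k))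
      (cellCorner o u v (l / k, l % k) + u + v)

lemma div_mod_mem_range {k l : ℕ} (hl : l < k ^ 2) :
    (l / k, l % k) ∈ Finset.range k ×ˢ Finset.range k := by
  have hk : 0 < k := by rcases Nat.eq_zero_or_pos k with rfl | h <;> simp_all
  rw [Finset.mem_product, Finset.mem_range, Finset.mem_range]
  exact ⟨Nat.div_lt_of_lt_mul (by rwa [← sq]), Nat.mod_lt _ hk⟩

/-- A triangle that is no triangle of a flopped cell is kept. -/
lemma mem_quadrilateralFlops {T₀ : Finset (Finset LatticePoint)} {k : ℕ} {o u v : LatticePoint}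
    {t : Finset LatticePoint} (ht : t ∈ T₀) : ∀ l, (∀ m < l, ¬ (
      cellCorner o u v (m / k, m % k) + u ∈ t ∧ cellCorner o u v (m / k, m % k) + v ∈ t ∧
      (t = {cellCorner o u v (m / k, m % k) + u, cellCorner o u v (m / k, m % k) + v,
          cellCorner o u v (m / k, m % k)} ∨
        t = {cellCorner o u v (m / k, m % k) + u, cellCorner o u v (m / k, m % k) + v,
          cellCorner o u v (m / k, m % k) + u + v}))) →
      t ∈ quadrilateralFlops T₀ k o u v l := by
  intro l
  induction l with
  | zero => intro _; exact ht
  | succ l ih =>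
    intro h
    refine IsFlopQuad.mem_flopSet.mpr (Or.inl ⟨ih fun m hm => h m (by omega), ?_⟩)
    rw [← not_or]
    intro hcon
    refine h l (by omega) ⟨?_, ?_, hcon⟩ <;> rcases hcon with rfl | rfl <;> simp

/-- Earlier flops concern other cells, since quotient and remainder modulo `k` determine the index.
-/
lemma cell_mem_quadrilateralFlops {T₀ : Finset (Finset LatticePoint)} {k : ℕ}
    {o u v : LatticePoint} (huv : |latticeDet u v| = 1) {l : ℕ} {t : Finset LatticePoint}
    (ht : t ∈ T₀)
    (hl : t = {cellCorner o u v (l / k, l % k), cellCorner o u v (l / k, l % k) + u,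
        cellCorner o u v (l / k, l % k) + v} ∨
      t = {cellCorner o u v (l / k, l % k) + u, cellCorner o u v (l / k, l % k) + v,
        cellCorner o u v (l / k, l % k) + u + v}) :
    t ∈ quadrilateralFlops T₀ k o u v l := by
  refine mem_quadrilateralFlops ht l fun m hm hcon => ?_
  have h := eq_of_diagonal_mem huv hl hcon.1 hcon.2.1
  rw [Prod.mk.injEq] at h
  have h1 := Nat.div_add_mod m k
  have h2 := Nat.div_add_mod l k
  rw [h.1, h.2] at h1
  omega

/-- The flops of the diagonals of a quadrilateral, row by row, form a flop sequence. -/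
lemma IsQuadrilateralIn.exists_isFlopSequence {T₀ R : Finset (Finset LatticePoint)} {n k : ℕ}
    {o u v : LatticePoint} (hq : IsQuadrilateralIn R k o u v) (hT : IsCombTriangulation T₀)
    (hR : R ⊆ T₀) (hn : n = k ^ 2) :
    ∃ (T : ℕ → Finset (Finset LatticePoint)) (C C' : ℕ → Finset LatticePoint),
      IsFlopSequence T₀ R n T C C' ∧ NoFlopUndone n C C' ∧
      (Finset.range n).image C = quadrilateralDiagonals k o u v := by
  rcases Nat.eq_zero_or_pos k with rfl | hk
  · obtain rfl : n = 0 := by simpa using hn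
    refine ⟨fun _ => T₀, fun _ => ∅, fun _ => ∅, ⟨rfl, fun k hk => absurd hk (by omega),
      fun _ _ => Finset.sdiff_subset⟩, fun k l _ hl => absurd hl (by omega), ?_⟩
    simp [quadrilateralDiagonals]
  have huv := hq.abs_det hT hR hk.ne'
  obtain ⟨hu0, hv0, hne, -⟩ := ne_of_basis huv
  set z : ℕ → LatticePoint := fun l => cellCorner o u v (l / k, l % k)
  have hcell : ∀ l < n, _ := fun l hl => hq (l / k, l % k) (div_mod_mem_range (hn ▸ hl))
  refine ⟨quadrilateralFlops T₀ k o u v, fun l => {z l + u, z l + v},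
    fun l => {z l, z l + u + v}, ⟨rfl, fun l hl => ?_, fun l hl t ht => ?_⟩, ?_, ?_⟩
  · refine ⟨z l + u, z l + v, z l, z l + u + v, rfl, rfl, fun h => hne (add_left_cancel h), ?_,
      ?_, ?_, by abel, rfl⟩
    · intro h
      rw [add_assoc] at h
      have h0 := left_eq_add.mp h
      exact (ne_of_basis huv).2.2.2 (eq_neg_of_add_eq_zero_left h0)
    · rw [← triple_rotate]
      exact cell_mem_quadrilateralFlops huv (hR (hcell l hl).1) (Or.inl rfl)
    · exact cell_mem_quadrilateralFlops huv (hR (hcell l hl).2) (Or.inr rfl)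
  · rw [Finset.mem_sdiff] at ht
    refine mem_quadrilateralFlops ht.1 l fun m hm hcon => ht.2 ?_
    obtain ⟨h1, h2⟩ := hcell m (by omega)
    rcases hcon.2.2 with rfl | rfl
    · rwa [← triple_rotate]
    · exact h2
  -- A flopped diagonal has direction u - v and a created one u + v, so they never agree.
  · rintro l m - - ⟨h, -⟩
    have h' : ({z m + u, z m + v} : Finset LatticePoint) = {z l, z l + u + v} := h
    rcases pair_eq_cases h' with ⟨h1, h2⟩ | ⟨h1, h2⟩
    · rw [← h1] at h2
      have : v = u + u + v := add_left_cancel (a := z m) (by rw [h2]; abel)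
      exact hu0 (two_smul_injective (by rw [right_eq_add.mp this, add_zero]))
    · rw [← h2] at h1
      have : u = v + v + u := add_left_cancel (a := z m) (by rw [h1]; abel)
      exact hv0 (two_smul_injective (by rw [right_eq_add.mp this, add_zero]))
  · rw [quadrilateralDiagonals]
    ext e
    rw [Finset.mem_image, Finset.mem_image]
    constructor
    · rintro ⟨l, hl, rfl⟩
      exact ⟨(l / k, l % k), div_mod_mem_range (hn ▸ Finset.mem_range.mp hl), rfl⟩
    · rintro ⟨⟨r, s⟩, hc, rfl⟩
      rw [Finset.mem_product, Finset.mem_range, Finset.mem_range] at hc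
      refine ⟨k * r + s, ?_, ?_⟩
      · rw [Finset.mem_range, hn, sq]
        calc k * r + s < k * r + k := by omega
          _ = k * (r + 1) := by ring
          _ ≤ k * k := Nat.mul_le_mul_left k hc.1
      · have h1 : (k * r + s) / k = r := by
          rw [Nat.mul_add_div hk, Nat.div_eq_of_lt hc.2, add_zero]
        have h2 : (k * r + s) % k = s := by rw [Nat.mul_add_mod, Nat.mod_eq_of_lt hc.2]
        simp only [z, h1, h2]

theorem mainTheorem2 (T₀ R : Finset (Finset LatticePoint))
    (hT : IsTriangulation T₀) (hR : IsRegularRegion T₀ R) :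
    (∀ (n : ℕ) (T : ℕ → Finset (Finset LatticePoint)) (C C' : ℕ → Finset LatticePoint),
      IsFlopSequence T₀ R n T C C' →
        (deformationCount (T n) : ℝ) - (deformationCount T₀ : ℝ) ≤ 4 * (n : ℝ) ∧
        (NoFlopUndone n C C' →
          4 * Real.sqrt (n : ℝ) ≤ (deformationCount (T n) : ℝ) - (deformationCount T₀ : ℝ))) ∧
    (∀ (n k : ℕ) (o u v : LatticePoint), n = k ^ 2 → IsQuadrilateralIn R k o u v →
      (∃ (T : ℕ → Finset (Finset LatticePoint)) (C C' : ℕ → Finset LatticePoint),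
        IsFlopSequence T₀ R n T C C' ∧ NoFlopUndone n C C' ∧
        (Finset.range n).image C = quadrilateralDiagonals k o u v) ∧
      (∀ (T : ℕ → Finset (Finset LatticePoint)) (C C' : ℕ → Finset LatticePoint),
        IsFlopSequence T₀ R n T C C' →
        (Finset.range n).image C = quadrilateralDiagonals k o u v →
        (deformationCount (T n) : ℝ) - (deformationCount T₀ : ℝ) = 4 * Real.sqrt (n : ℝ))) := by
  have hc := hT.isCombTriangulation
  refine ⟨fun n T C C' hs => ?_, fun n k o u v hn hq =>
    ⟨hq.exists_isFlopSequence hc hR.subset hn, fun T C C' hs himage => ?_⟩⟩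
  · obtain ⟨i, j, α, β, h, hC⟩ := hs.exists_isFlopRun hc
    refine ⟨?_, fun hu => ?_⟩
    · have := h.deformationCount_le n le_rfl
      rw [sub_le_iff_le_add']
      exact_mod_cast this
    · have hu' : IsFlopRun.NotUndone n i j α β := by
        intro l k hlk hk hcon
        have := hu l k hlk hk
        rw [(hC k hk).1, (hC k hk).2, (hC l (by omega)).1, (hC l (by omega)).2] at this
        exact this hcon
      rw [hR.deformationCount_eq hc,
        (h.comb n le_rfl).deformationCount_eq_add (h.inside n le_rfl), Nat.cast_add,
        add_sub_cancel_right]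
      exact h.lower_bound hu' hR
  · obtain ⟨i, j, α, β, h, hC⟩ := hs.exists_isFlopRun hc
    refine h.deformationCount_quadrilateral hR hq hn ?_
    rw [← himage]
    exact Finset.image_congr fun l hl => (hC l (Finset.mem_range.mp hl)).1.symm
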